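/- Theorem. Notation. For a permutation $\sigma\in\mathfrak S_n$ let $\mathrm{exc}(\sigma)$ be the number of $i$ with $\sigma(i)>i$. Let $\bar\sigma$ be the word $\sigma(1)\cdots\sigma(n)$ in which the letter $\sigma(i)$ is replaced by a barred letter $\overline{\sigma(i)}$ whenever $\sigma(i)>i$. Order letters by $\bar 1<\dots<\bar n<1<\dots<n$, and let $\mathrm{Exd}(\sigma)\subseteq\{1,\dots,n-1\}$ be the set of $i$ such that the $i$-th letter of $\bar\sigma$ is larger than the $(i+1)$-st. For $S\subseteq\{1,\dots,n-1\}$ let $$F_{S,n}=\sum x_{i_1}x_{i_2}\cdots x_{i_n},$$ the sum being over all integers $i_1\ge i_2\ge\dots\ge i_n\ge 1$ with $i_k>i_{k+1}$ for all $k\in S$. For $j\in\mathbb Z$ and a partition $\lambda\vdash n$ let $$Q_{n,j}=\sum_{\sigma\in\mathfrak S_n,\ \mathrm{exc}(\sigma)=j}F_{\mathrm{Exd}(\sigma),n},\qquad Q_{\lambda,j}=\sum_{\substack{\sigma\in\mathfrak S_n,\ \mathrm{exc}(\sigma)=j\\ \sigma\text{ of cycle type }\lambda}}F_{\mathrm{Exd}(\sigma),n};$$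 in particular $Q_{n,-1}=0$. The Frobenius characteristic of a virtual (complex, finite-dimensional) representation $V$ of $\mathfrak S_n$ is $\mathrm{ch}\,V=\sum_{\lambda\vdash n}z_\lambda^{-1}\chi^V_\lambda p_\lambda$, where $\chi^V_\lambda$ is the value of the character of $V$ on permutations of cycle type $\lambda$, $p_\lambda=\prod_i p_{\lambda_i}$ with $p_k=\sum_{i\ge1}x_i^k$, and $z_\lambda=\prod_i i^{m_i}m_i!$ if $\lambda$ has $m_i$ parts equal to $i$. Statement. Let $n\ge 2$ and $0\le j\le n-1$. There is exactly one virtual representation $V_{(n),j}$ of $\mathfrak S_n$ (as an element of the Grothendieck group of representations) whose Frobenius characteristic is $Q_{(n),j}$, where $(n)$ is the partition with the single part $n$. Its restriction to $\mathfrak S_{n-1}$ is (the class of) a permutation representation, that is, of the representation on $\mathbb C[X]$ for some finite $\mathfrak S_{n-1}$-set $X$, and the Frobenius characteristic of this permutation representation is $Q_{n-1,j-1}$. -/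

import Mathlib

open scoped BigOperators Nat

noncomputable section

namespace EulerianQuasisymmetric

/-! ## Virtual representations -/

/-- The additive relations `[C] = [A] + [B]`, one for every isomorphism `C ≅ A ⊕ B` of
finite-dimensional complex representations of `G`. (With `B = 0` they identify isomorphic
representations.) -/
def directSumRelations (G : Type) [Group G] : Set (FreeAbelianGroup (FDRep ℂ G)) :=
  {x | ∃ A B C : FDRep ℂ G, Nonempty (Representation.Equiv C.ρ (Representation.prod A.ρ B.ρ)) ∧
    x = FreeAbelianGroup.of C - (FreeAbelianGroup.of A + FreeAbelianGroup.of B)}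

/-- Virtual representations of `G`: the Grothendieck group of finite-dimensional complex
representations of `G` under direct sum. -/
abbrev VirtualRep (G : Type) [Group G] : Type 1 :=
  FreeAbelianGroup (FDRep ℂ G) ⧸ AddSubgroup.closure (directSumRelations G)

namespace VirtualRep

variable {G H : Type} [Group G] [Group H]

/-- The class of an actual representation. -/
def mk (V : FDRep ℂ G) : VirtualRep G :=
  QuotientAddGroup.mk (FreeAbelianGroup.of V)

theorem mk_eq_add {A B C : FDRep ℂ G}
    (e : Representation.Equiv C.ρ (Representation.prod A.ρ B.ρ)) : mk C = mk A + mk B := by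
  rw [← sub_eq_zero]
  exact (QuotientAddGroup.eq_zero_iff (N := AddSubgroup.closure (directSumRelations G))
    (FreeAbelianGroup.of C - (FreeAbelianGroup.of A + FreeAbelianGroup.of B))).2
    (AddSubgroup.subset_closure ⟨A, B, C, ⟨e⟩, rfl⟩)

/-- An invariant of representations that is additive on direct sums extends to virtual
representations. -/
def lift {M : Type*} [AddCommGroup M] (f : FDRep ℂ G → M)
    (hf : ∀ A B C : FDRep ℂ G, Representation.Equiv C.ρ (Representation.prod A.ρ B.ρ) → f C = f A + f B) :
    VirtualRep G →+ M :=
  QuotientAddGroup.lift _ (FreeAbelianGroup.lift f) <| by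
    rw [AddSubgroup.closure_le]
    rintro _ ⟨A, B, C, ⟨e⟩, rfl⟩
    simp [hf A B C e]

@[simp] theorem lift_mk {M : Type*} [AddCommGroup M] (f : FDRep ℂ G → M)
    (hf : ∀ A B C : FDRep ℂ G, Representation.Equiv C.ρ (Representation.prod A.ρ B.ρ) → f C = f A + f B)
    (V : FDRep ℂ G) : lift f hf (mk V) = f V :=
  FreeAbelianGroup.lift_apply_of f V

/-- The character of a virtual representation. -/
def character : VirtualRep G →+ (G → ℂ) :=
  lift (fun V => Representation.character V.ρ) fun A B C e => by
    rw [Representation.char_iso e]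
    funext g
    exact LinearMap.trace_prodMap' (A.ρ g) (B.ρ g)

/-- The restriction of a representation along a group homomorphism `f : H → G`. -/
def resRep (f : H →* G) (V : FDRep ℂ G) : FDRep ℂ H :=
  FDRep.of (MonoidHom.comp V.ρ f : Representation ℂ H V)

/-- The restriction of virtual representations along a group homomorphism `f : H → G`. -/
def res (f : H →* G) : VirtualRep G →+ VirtualRep H :=
  lift (fun V => mk (resRep f V)) fun A B C e =>
    mk_eq_add (A := resRep f A) (B := resRep f B) (C := resRep f C)
      (Representation.Equiv.mk e.toLinearEquiv fun h => e.toIntertwiningMap.isIntertwining' (f h))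

/-- The class of the permutation representation on `ℂ[X]` of a finite `G`-set `X`. -/
def permutation (G : Type) [Group G] (X : Type) [Finite X] [MulAction G X] : VirtualRep G :=
  mk (FDRep.of (Representation.ofMulAction ℂ G X))

end VirtualRep

/-! ## The Frobenius characteristic

Symmetric and quasisymmetric functions are formal power series in the variables indexed by `ℕ+`.
-/

/-- The power sum `p_k = ∑_{i ≥ 1} x_i ^ k` (for `k ≥ 1`). -/
def powerSum (k : ℕ) : MvPowerSeries ℕ+ ℚ :=
  fun m => open Classical in if ∃ i : ℕ+, m = Finsupp.single i k then 1 else 0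

/-- `p_λ`, the product of the `p_k` over the parts `k` of `λ`. -/
def powerSumPartition {n : ℕ} (lam : n.Partition) : MvPowerSeries ℕ+ ℚ :=
  (lam.parts.map powerSum).prod

/-- `z_λ = ∏_i i ^ (m_i) * (m_i)!`, where `m_i` is the number of parts of `λ` equal to `i`. -/
def zPartition {n : ℕ} (lam : n.Partition) : ℕ :=
  ∏ i ∈ Finset.Icc 1 n, i ^ lam.parts.count i * (lam.parts.count i)!

/-- The permutation `σ` has cycle type `λ` (fixed points count as parts equal to `1`). -/
def HasCycleType {n : ℕ} (σ : Equiv.Perm (Fin n)) (lam : n.Partition) : Prop :=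
  σ.partition.parts = lam.parts

theorem exists_hasCycleType {n : ℕ} (lam : n.Partition) :
    ∃ σ : Equiv.Perm (Fin n), HasCycleType σ lam := by
  have hsplit := Multiset.filter_add_not (fun k => 2 ≤ k) lam.parts
  have hone : lam.parts.filter (fun k => ¬ 2 ≤ k) =
      Multiset.replicate (Multiset.card (lam.parts.filter (fun k => ¬ 2 ≤ k))) 1 := by
    rw [Multiset.eq_replicate]
    refine ⟨rfl, fun b hb => ?_⟩
    rw [Multiset.mem_filter] at hb
    have := lam.parts_pos hb.1
    omega
  have hsum : (lam.parts.filter (fun k => 2 ≤ k)).sum +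
      Multiset.card (lam.parts.filter (fun k => ¬ 2 ≤ k)) = n := by
    have h := congrArg Multiset.sum hsplit
    rw [Multiset.sum_add, lam.parts_sum, hone, Multiset.sum_replicate] at h
    simpa using h
  obtain ⟨σ, hσ⟩ := (Equiv.Perm.exists_with_cycleType_iff (Fin n)
    (m := lam.parts.filter (fun k => 2 ≤ k))).2
    ⟨by rw [Fintype.card_fin]; omega, fun a ha => (Multiset.mem_filter.1 ha).2⟩
  refine ⟨σ, ?_⟩
  have hc : Fintype.card (Fin n) - σ.support.card =
      Multiset.card (lam.parts.filter (fun k => ¬ 2 ≤ k)) := by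
    rw [← Equiv.Perm.sum_cycleType, hσ, Fintype.card_fin]
    omega
  rw [HasCycleType, Equiv.Perm.parts_partition, hσ, hc, ← hone]
  exact hsplit

/-- `χ^V_λ`, the value of the character of `V` on the conjugacy class of type `λ`. -/
def characterValue {n : ℕ} (V : VirtualRep (Equiv.Perm (Fin n))) (lam : n.Partition) : ℂ :=
  V.character (exists_hasCycleType lam).choose

/-- The Frobenius characteristic `ch V = ∑_{λ ⊢ n} z_λ⁻¹ χ^V_λ p_λ`. -/
def frobeniusChar {n : ℕ} (V : VirtualRep (Equiv.Perm (Fin n))) : MvPowerSeries ℕ+ ℂ :=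
  ∑ lam : n.Partition, ((zPartition lam : ℂ)⁻¹ * characterValue V lam) •
    MvPowerSeries.map (algebraMap ℚ ℂ) (powerSumPartition lam)

/-! ## Eulerian quasisymmetric functions

Positions and values of permutations in `S_n` are numbered from `0` to `n - 1` here, so position
`k` stands for the position `k + 1` of `[n]`. -/

/-- The fundamental quasisymmetric function `F_{S,n}`, the sum of `x_{a_1} ⋯ x_{a_n}` over all
sequences `a_1 ≥ ⋯ ≥ a_n ≥ 1` with `a_k > a_{k+1}` for all `k ∈ S`. The coefficient of a monomial
is the number of these sequences (there is at most one) that give it. -/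
def fundamental (n : ℕ) (S : Set ℕ) : MvPowerSeries ℕ+ ℚ :=
  fun m => (Set.ncard {a : Fin n → ℕ+ | Antitone a ∧
    (∀ (k : ℕ) (hk : k + 1 < n), k ∈ S → a ⟨k + 1, hk⟩ < a ⟨k, Nat.lt_of_succ_lt hk⟩) ∧
    ∑ i, Finsupp.single (a i) 1 = m} : ℚ)

/-- The excedance number. -/
def exc {n : ℕ} (σ : Equiv.Perm (Fin n)) : ℕ :=
  (Finset.univ.filter fun i => i < σ i).card

/-- The word `σ̄`: the letter `σ i` is barred (first entry `false`) when `i` is an excedance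
position and unbarred (first entry `true`) otherwise. In the lexicographic order on letters all
barred letters come before all unbarred ones. -/
def barWord {n : ℕ} (σ : Equiv.Perm (Fin n)) (i : Fin n) : Bool ×ₗ Fin n :=
  toLex (decide (¬ i < σ i), σ i)

/-- `Exd σ`, the descent set of the word `σ̄`. -/
def exd {n : ℕ} (σ : Equiv.Perm (Fin n)) : Set ℕ :=
  {k | ∃ hk : k + 1 < n, barWord σ ⟨k + 1, hk⟩ < barWord σ ⟨k, Nat.lt_of_succ_lt hk⟩}

/-- The Eulerian quasisymmetric function `Q_{n,j}`. The index `j` is an integer, and the function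
is `0` (an empty sum) for `j < 0`. -/
def eulerianQ (n : ℕ) (j : ℤ) : MvPowerSeries ℕ+ ℚ :=
  ∑ σ : Equiv.Perm (Fin n), if (exc σ : ℤ) = j then fundamental n (exd σ) else 0

/-- The cycle type Eulerian quasisymmetric function `Q_{λ,j}`. -/
def cycleTypeEulerianQ {n : ℕ} (lam : n.Partition) (j : ℤ) : MvPowerSeries ℕ+ ℚ :=
  open Classical in
  ∑ σ : Equiv.Perm (Fin n),
    if (exc σ : ℤ) = j ∧ HasCycleType σ lam then fundamental n (exd σ) else 0

/-- `V` has Frobenius characteristic `f`. -/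
def HasFrobeniusChar {n : ℕ} (V : VirtualRep (Equiv.Perm (Fin n)))
    (f : MvPowerSeries ℕ+ ℚ) : Prop :=
  frobeniusChar V = MvPowerSeries.map (algebraMap ℚ ℂ) f

/-- The standard embedding of `S_{n-1}` in `S_n`, as the permutations fixing the last point. -/
def permEmbedding (n : ℕ) : Equiv.Perm (Fin (n - 1)) →* Equiv.Perm (Fin n) :=
  Equiv.Perm.viaEmbeddingHom (Fin.castLEEmb (Nat.sub_le n 1))

end EulerianQuasisymmetric

end

open scoped BigOperators Nat

noncomputable section

namespace EulerianQuasisymmetric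

/-! ### Virtual representations are determined by their characters -/

section
namespace VirtualRep

variable {G : Type} [Group G]

/-! Construction. For `r ≥ 1`, `S_n` acts on the distributions of `n` points over a cyclic sequence
of `r` blocks, where block `i` carries a mark `b_i` with `1 ≤ b_i < size` and the marks add up to
`j` (`Conf n r j 0`). Rotation of the blocks commutes with this action, so the functions on which it
acts by a fixed primitive `r`-th root of unity form a representation `W_r`. The virtual
representation sought is the sum of the `W_r` for `1 ≤ r ≤ n`.

Restriction. The character of `W_r` at `g` is `1/r` times a sum over `k < r` of `ω^k` times the
number of `y` with `g y = rot^k y`. If `g` fixes the last point and `0 < k < r`, there is no such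
`y`, since rotation moves the block of that point. The remaining term `k = 0` is `1/r` of a
permutation character. Rotating the last point into block `0` and deleting it absorbs the factor
`1/r`; what is left is the permutation character on configurations of `n - 1` points in which the
mark of block `0` may be as large as the block (`Pi.single 0 1`).

Frobenius characteristics. The coefficient of `ch V` at a monomial averages `χ(σ)` times the number
of `σ`-invariant colorings with that content (`coeff_frobeniusChar`). A twisted Burnside lemma
(`card_smul_eq_twist`) and a sum over roots of unity (`sum_pow_mul_card_isPeriodicPt`) show that
`W_r` contributes `1/r` times the number of primitive cyclic words of `r` marked multisets. The
restricted representation counts all words whose first multiset has the wider range of marks.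

The quasisymmetric side. A pair of a permutation and a coloring counted by its fundamental function
is encoded, in the style of Gessel and Reutenauer, by reading along each cycle the colors, barred at
excedances. This gives a bijection with shift-invariant multisets of periodic words
(`cycleWords_injective`, `exists_cycleWords_eq`), and `n`-cycles correspond to primitive orbits.
Closed words are closed walks for a transfer matrix `T`. Let `t` count bars, `H` be the sum of all
complete symmetric functions `h_n`, `H~` its version with every variable multiplied by `t`, and `M =
∑ h_n (t + ⋯ + t^(n-1))` the generating function of marked multisets. Then `det (1 - T) = (1 - M) /
(H H~)`. Logarithmic derivatives (`closedWords_eq`) show that closed words are equinumerous with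
closed sequences of marked multisets, up to words without bars; the factor `H~` accounts for the
words with only barred letters, which are excluded.

Two consequences finish the proof. Passing to primitive orbits gives the one-part function as the
sum over `r` of `1/r` times the number of primitive sequences (`coeff_cycleTypeEulerianQ`).
Integrating gives `∑ Q_{n,j} t^j = H / (1 - M)`; since the wider marks have generating function `M₁
= tH - t(1 - M)`, one gets `M₁ / (1 - M) = t (∑ Q_{n,j} t^j - 1)`, which identifies the restriction
(`coeff_eulerianQ_eq_sum`). Uniqueness holds because both the character and the Frobenius
characteristic are injective. -/

theorem character_mk (V : FDRep ℂ G) : character (mk V) = Representation.character V.ρ :=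
  lift_mk _ _ V

section Splitting

variable {V W : Type} [AddCommGroup V] [Module ℂ V] [FiniteDimensional ℂ V]
  [AddCommGroup W] [Module ℂ W] [FiniteDimensional ℂ W]
  (ρ : Representation ℂ G V) (σ : Representation ℂ G W)

theorem mk_prod : mk (FDRep.of (ρ.prod σ)) = mk (FDRep.of ρ) + mk (FDRep.of σ) :=
  mk_eq_add (A := FDRep.of ρ) (B := FDRep.of σ) (C := FDRep.of (ρ.prod σ))
    (Representation.Equiv.refl (ρ.prod σ))

/-- The zero space is isomorphic to its sum with itself, so its class `x` satisfies `x = x + x`. -/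
theorem mk_of_subsingleton [Subsingleton V] : mk (FDRep.of ρ) = 0 := by
  have h := mk_eq_add (A := FDRep.of ρ) (B := FDRep.of ρ) (C := FDRep.of ρ)
    (Representation.Equiv.mk (ρ := ρ) (σ := ρ.prod ρ)
      { (0 : V →ₗ[ℂ] V × V) with
        invFun := 0
        left_inv := fun _ => Subsingleton.elim _ _
        right_inv := fun _ => Subsingleton.elim _ _ }
      fun g => Subsingleton.elim _ _)
  simpa using h

variable {ρ σ}

/-- The defining relations only concern direct sums; the second summand is taken to be zero. -/
theorem mk_congr (e : Representation.Equiv ρ σ) : mk (FDRep.of ρ) = mk (FDRep.of σ) := by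
  let τ : Representation ℂ G PUnit.{1} := Representation.trivial ℂ G PUnit
  have h := mk_eq_add (A := FDRep.of σ) (B := FDRep.of τ) (C := FDRep.of ρ)
    (Representation.Equiv.mk (ρ := ρ) (σ := σ.prod τ)
      (e.toLinearEquiv ≪≫ₗ (LinearEquiv.prodUnique (M₂ := PUnit.{1})).symm) fun g => by
        ext v
        exact LinearMap.congr_fun (e.toIntertwiningMap.isIntertwining' g) v)
  rw [h, mk_of_subsingleton τ, add_zero]

theorem mk_eq_add_of_isCompl (K Q : Subrepresentation ρ)
    (h : IsCompl K.toSubmodule Q.toSubmodule) :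
    mk (FDRep.of ρ) =
      mk (FDRep.of K.toRepresentation) + mk (FDRep.of Q.toRepresentation) := by
  rw [← mk_prod]
  refine (mk_congr (Representation.Equiv.mk (Submodule.prodEquivOfIsCompl _ _ h) fun g => ?_)).symm
  ext v <;> simp only [LinearMap.coe_comp, LinearEquiv.coe_coe, Function.comp_apply,
    LinearMap.inl_apply, LinearMap.inr_apply, Submodule.coe_prodEquivOfIsCompl',
    Representation.prod, MonoidHom.coe_mk, OneHom.coe_mk, LinearMap.prodMap_apply, map_zero,
    ZeroMemClass.coe_zero, add_zero, zero_add] <;> rfl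

omit [FiniteDimensional ℂ V] in
theorem exists_isCompl_toSubmodule [Finite G] (K : Subrepresentation ρ) :
    ∃ Q : Subrepresentation ρ, IsCompl K.toSubmodule Q.toSubmodule := by
  -- Maschke's theorem: with this instance the lattice of subrepresentations is complemented.
  have : NeZero (Nat.card G : ℂ) := ⟨by simp [Nat.card_pos.ne']⟩
  obtain ⟨Q, hQ⟩ := exists_isCompl K
  refine ⟨Q, ?_, ?_⟩
  · rw [disjoint_iff, ← Subrepresentation.toSubmodule_inf, hQ.inf_eq_bot]; rfl
  · rw [codisjoint_iff, ← Subrepresentation.toSubmodule_sup, hQ.sup_eq_top]; rfl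

/-- The kernel of an intertwining map. -/
def kerSub (f : Representation.IntertwiningMap ρ σ) : Subrepresentation ρ where
  toSubmodule := LinearMap.ker f.toLinearMap
  apply_mem_toSubmodule g v hv := by
    have := LinearMap.congr_fun (f.isIntertwining' g) v
    rw [LinearMap.mem_ker] at hv ⊢
    rw [LinearMap.comp_apply, LinearMap.comp_apply, hv, map_zero] at this
    exact this

/-- The range of an intertwining map. -/
def rangeSub (f : Representation.IntertwiningMap ρ σ) : Subrepresentation σ where
  toSubmodule := LinearMap.range f.toLinearMap
  apply_mem_toSubmodule g v hv := by
    obtain ⟨u, rfl⟩ := hv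
    exact ⟨ρ g u, LinearMap.congr_fun (f.isIntertwining' g) u⟩

/-- An invariant complement of the kernel is mapped isomorphically onto the range. -/
theorem mk_eq_ker_add_range [Finite G] (f : Representation.IntertwiningMap ρ σ) :
    mk (FDRep.of ρ) = mk (FDRep.of (kerSub f).toRepresentation) +
      mk (FDRep.of (rangeSub f).toRepresentation) := by
  obtain ⟨Q, hQ⟩ := exists_isCompl_toSubmodule (kerSub f)
  rw [mk_eq_add_of_isCompl _ _ hQ]
  congr 1
  let r : Q.toSubmodule →ₗ[ℂ] (rangeSub f).toSubmodule :=
    (f.toLinearMap.rangeRestrict) ∘ₗ Q.toSubmodule.subtype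
  have hr : Function.Bijective r := by
    constructor
    · rw [← LinearMap.ker_eq_bot, LinearMap.ker_eq_bot']
      intro v hv
      have h1 : (v : V) ∈ (kerSub f).toSubmodule := congrArg Subtype.val hv
      have h2 := Submodule.disjoint_def.1 hQ.disjoint _ h1 v.2
      exact Subtype.ext h2
    · rintro ⟨_, u, rfl⟩
      have hu : u ∈ (kerSub f).toSubmodule ⊔ Q.toSubmodule := by
        rw [hQ.sup_eq_top]; trivial
      obtain ⟨a, ha, b, hb, rfl⟩ := Submodule.mem_sup.1 hu
      refine ⟨⟨b, hb⟩, Subtype.ext ?_⟩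
      change f.toLinearMap b = f.toLinearMap (a + b)
      rw [map_add, LinearMap.mem_ker.1 ha, zero_add]
  refine mk_congr (Representation.Equiv.mk (LinearEquiv.ofBijective r hr) fun g => ?_)
  ext v
  exact LinearMap.congr_fun (f.isIntertwining' g) v

end Splitting

/-- Induction on the dimension. The dimension of `Hom(ρ, σ)` depends only on the characters, so it
equals that of `Hom(ρ, ρ)` and there is a nonzero intertwining map. Its range is a common part of
both classes. What remains, the kernel in `ρ` and a complement of the range in `σ`, again has equal
characters, and the kernel is smaller than `ρ`. -/
theorem mk_eq_mk_of_character_eq [Finite G] (n : ℕ) :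
    ∀ {V W : Type} [AddCommGroup V] [Module ℂ V] [FiniteDimensional ℂ V]
      [AddCommGroup W] [Module ℂ W] [FiniteDimensional ℂ W]
      (ρ : Representation ℂ G V) (σ : Representation ℂ G W), Module.finrank ℂ V = n →
      ρ.character = σ.character → mk (FDRep.of ρ) = mk (FDRep.of σ) := by
  induction n using Nat.strong_induction_on with
  | _ n ih =>
  intro V W _ _ _ _ _ _ ρ σ hn hχ
  have hfin : Module.finrank ℂ V = Module.finrank ℂ W := by
    have := congrFun hχ 1
    rw [Representation.char_one, Representation.char_one] at this
    exact_mod_cast this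
  rcases subsingleton_or_nontrivial V with hV | hV
  · have : Subsingleton W := Module.finrank_zero_iff.1 (hfin ▸ Module.finrank_zero_of_subsingleton)
    rw [mk_of_subsingleton, mk_of_subsingleton]
  have := Fintype.ofFinite G
  have : Invertible (Nat.card G : ℂ) := invertibleOfNonzero (by simp)
  have hhom : Module.finrank ℂ (Representation.IntertwiningMap ρ ρ) =
      Module.finrank ℂ (Representation.IntertwiningMap ρ σ) := by
    have h1 := Representation.card_inv_mul_sum_char_mul_char_eq_finrank ρ ρ
    have h2 := Representation.card_inv_mul_sum_char_mul_char_eq_finrank ρ σ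
    rw [← hχ, h1] at h2
    exact_mod_cast h2
  have hpos : 0 < Module.finrank ℂ (Representation.IntertwiningMap ρ ρ) := by
    have : Nontrivial (Representation.IntertwiningMap ρ ρ) := by
      obtain ⟨v, hv⟩ := exists_ne (0 : V)
      exact ⟨⟨1, 0, fun h => hv (congrArg (fun f : Representation.IntertwiningMap ρ ρ => f v) h)⟩⟩
    exact Module.finrank_pos
  rw [hhom] at hpos
  have := Module.finrank_pos_iff.1 hpos
  obtain ⟨f, hf⟩ := exists_ne (0 : Representation.IntertwiningMap ρ σ)
  obtain ⟨Q, hQ⟩ := exists_isCompl_toSubmodule (rangeSub f)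
  have e1 := mk_eq_ker_add_range f
  have e2 := mk_eq_add_of_isCompl _ _ hQ
  have hlt : Module.finrank ℂ (kerSub f).toSubmodule < n := by
    rw [← hn]
    refine Submodule.finrank_lt fun h => hf ?_
    exact Representation.IntertwiningMap.ext (LinearMap.ker_eq_top.1 h)
  rw [e1, e2, add_comm, ih _ hlt _ Q.toRepresentation rfl ?_]
  have c1 := congrArg character e1
  have c2 := congrArg character e2
  rw [map_add, character_mk, character_mk, character_mk] at c1 c2
  have : ρ.character = σ.character := hχ
  change ρ.character = (kerSub f).toRepresentation.character + _ at c1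
  change σ.character = _ + Q.toRepresentation.character at c2
  rw [c1, c2, add_comm] at this
  exact add_left_cancel this

theorem exists_eq_mk_sub_mk (x : VirtualRep G) : ∃ A B : FDRep ℂ G, x = mk A - mk B := by
  have hadd : ∀ A B : FDRep ℂ G, mk A + mk B = mk (FDRep.of (Representation.prod A.ρ B.ρ)) :=
    fun A B => (mk_eq_add (A := A) (B := B) (C := FDRep.of (Representation.prod A.ρ B.ρ))
      (Representation.Equiv.refl (Representation.prod A.ρ B.ρ))).symm
  have hz : mk (FDRep.of (Representation.trivial ℂ G PUnit.{1})) = 0 := mk_of_subsingleton _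
  obtain ⟨y, rfl⟩ := QuotientAddGroup.mk_surjective x
  induction y using FreeAbelianGroup.induction_on with
  | zero => exact ⟨_, _, (sub_self (mk (FDRep.of (Representation.trivial ℂ G PUnit.{1})))).symm⟩
  | of A => exact ⟨A, FDRep.of (Representation.trivial ℂ G PUnit.{1}), by rw [hz, sub_zero]; rfl⟩
  | neg A _ =>
    exact ⟨FDRep.of (Representation.trivial ℂ G PUnit.{1}), A, by rw [hz, zero_sub]; rfl⟩
  | add y z hy hz =>
    obtain ⟨A, B, hA⟩ := hy
    obtain ⟨C, D, hC⟩ := hz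
    refine ⟨FDRep.of (Representation.prod A.ρ C.ρ), FDRep.of (Representation.prod B.ρ D.ρ), ?_⟩
    rw [← hadd, ← hadd, QuotientAddGroup.mk_add, hA, hC]
    abel

theorem character_injective [Finite G] : Function.Injective (character (G := G)) := by
  rw [injective_iff_map_eq_zero]
  intro x hx
  obtain ⟨A, B, rfl⟩ := exists_eq_mk_sub_mk x
  rw [map_sub, sub_eq_zero, character_mk, character_mk] at hx
  rw [sub_eq_zero]
  exact mk_eq_mk_of_character_eq _ A.ρ B.ρ rfl hx

end VirtualRep

end

/-! ### Characters of permutation representations and of isotypic components -/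

section
namespace VirtualRep

variable {G : Type} [Group G]

theorem trace_pi_eq_sum {Y : Type} [Fintype Y] [DecidableEq Y] (f : (Y → ℂ) →ₗ[ℂ] (Y → ℂ)) :
    LinearMap.trace ℂ (Y → ℂ) f = ∑ y, f (Pi.single y 1) y := by
  rw [LinearMap.trace_eq_matrix_trace ℂ (Pi.basisFun ℂ Y), Matrix.trace]
  simp

theorem character_permutation (X : Type) [Finite X] [MulAction G X] (g : G) :
    character (permutation G X) g = Nat.card {x : X // g • x = x} := by
  classical
  have := Fintype.ofFinite X
  rw [permutation, character_mk]
  change LinearMap.trace ℂ _ (Representation.ofMulAction ℂ G X g) = _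
  rw [LinearMap.trace_eq_matrix_trace ℂ (MonoidAlgebra.basis X ℂ), Matrix.trace,
    Nat.card_eq_fintype_card, Fintype.card_subtype, Finset.card_filter, Nat.cast_sum]
  refine Finset.sum_congr rfl fun x _ => ?_
  rw [Matrix.diag_apply, LinearMap.toMatrix_apply]
  simp [MonoidAlgebra.basis, Finsupp.single_apply]

section Isotypic

variable {Y : Type} [MulAction G Y] (τ : Equiv.Perm Y) (ω : ℂ)

/-- The functions on `Y` on which `τ` acts by the scalar `ω⁻¹`. -/
def isotypicSub (hcomm : ∀ (g : G) y, τ (g • y) = g • τ y) :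
    Subrepresentation ({
      toFun := fun g => LinearMap.funLeft ℂ ℂ fun y : Y => g⁻¹ • y
      map_one' := by ext; simp [LinearMap.funLeft]
      map_mul' := fun g h => by
        ext f y
        simp [LinearMap.funLeft, mul_smul] } : Representation ℂ G (Y → ℂ)) where
  toSubmodule :=
    { carrier := {f | ∀ y, ω * f (τ y) = f y}
      add_mem' := fun {f f'} hf hf' y => by simp [mul_add, hf y, hf' y]
      zero_mem' := fun y => by simp
      smul_mem' := fun c f hf y => by
        simp only [Pi.smul_apply, smul_eq_mul]
        rw [← hf y]; ring }
  apply_mem_toSubmodule g f hf y := by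
    have := hf (g⁻¹ • y)
    rw [hcomm] at this
    exact this

/-- The average `P` of the operators `ω^k (τ^k)^*` is a projection onto the isotypic functions.
Hence the trace of `g` there is the trace of `g P` on all functions, which is read off the diagonal
in the basis of point masses. -/
theorem exists_character_eq_isotypic [Finite Y] (hcomm : ∀ (g : G) y, τ (g • y) = g • τ y)
    {r : ℕ} (hr : r ≠ 0) (hτ : τ ^ r = 1) (hω : ω ^ r = 1) :
    ∃ V : VirtualRep G, ∀ g, character V g =
      (r : ℂ)⁻¹ * ∑ k ∈ Finset.range r, ω ^ k * Nat.card {y : Y // g • y = (τ ^ k) y} := by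
  classical
  have := Fintype.ofFinite Y
  refine ⟨mk (FDRep.of (isotypicSub τ ω hcomm).toRepresentation), fun g => ?_⟩
  rw [character_mk]
  change LinearMap.trace ℂ _ ((isotypicSub τ ω hcomm).toRepresentation g) = _
  let P : (Y → ℂ) →ₗ[ℂ] (Y → ℂ) := (r : ℂ)⁻¹ • ∑ k ∈ Finset.range r,
    ω ^ k • LinearMap.funLeft ℂ ℂ fun y : Y => (τ ^ k) y
  have hP : ∀ f y, P f y = (r : ℂ)⁻¹ * ∑ k ∈ Finset.range r, ω ^ k * f ((τ ^ k) y) := by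
    intro f y
    simp [P, LinearMap.funLeft]
  have hmem : ∀ f, P f ∈ (isotypicSub τ ω hcomm).toSubmodule := by
    intro f y
    rw [hP, hP, mul_left_comm]
    congr 1
    rw [Finset.mul_sum]
    -- Applying the operator moves the index `k` to `k + 1`. Splitting the sum over `0, …, r` at
    -- either end shows that nothing changes, because the terms `0` and `r` agree.
    have h1 := Finset.sum_range_succ (fun k => ω ^ k * f ((τ ^ k) y)) r
    have h2 := Finset.sum_range_succ' (fun k => ω ^ k * f ((τ ^ k) y)) r
    simp only [hτ, hω, pow_zero] at h1 h2
    rw [← add_right_cancel_iff (a := 1 * f ((1 : Equiv.Perm Y) y)), ← h1, h2]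
    congr 1
    refine Finset.sum_congr rfl fun k _ => ?_
    rw [pow_succ', pow_succ, Equiv.Perm.mul_apply]; ring
  have hid : ∀ f ∈ (isotypicSub τ ω hcomm).toSubmodule, P f = f := by
    intro f hf
    have hk : ∀ k y, ω ^ k * f ((τ ^ k) y) = f y := by
      intro k
      induction k with
      | zero => intro y; simp
      | succ k ih =>
        intro y
        have := hf y
        rw [← this, pow_succ' ω, pow_succ τ, Equiv.Perm.mul_apply, mul_assoc, ih]
    funext y
    rw [hP, Finset.sum_congr rfl fun k _ => hk k y]
    simp [hr]
  let A : (Y → ℂ) →ₗ[ℂ] (Y → ℂ) := LinearMap.funLeft ℂ ℂ (fun y : Y => g⁻¹ • y) ∘ₗ P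
  have hA : ∀ f, A f ∈ (isotypicSub τ ω hcomm).toSubmodule := fun f =>
    (isotypicSub τ ω hcomm).apply_mem_toSubmodule g (hmem f)
  have hrestr : (isotypicSub τ ω hcomm).toRepresentation g =
      A.restrict (fun f (_ : f ∈ (isotypicSub τ ω hcomm).toSubmodule) => hA f) := by
    ext1 f
    apply Subtype.ext
    change LinearMap.funLeft ℂ ℂ (fun y : Y => g⁻¹ • y) f.1 =
      LinearMap.funLeft ℂ ℂ (fun y : Y => g⁻¹ • y) (P f.1)
    rw [hid _ f.2]
  rw [hrestr, A.trace_restrict_eq_of_forall_mem _ hA, trace_pi_eq_sum]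
  have hdiag : ∀ y, A (Pi.single y 1) y =
      (r : ℂ)⁻¹ * ∑ k ∈ Finset.range r, ω ^ k * if g • y = (τ ^ k) y then 1 else 0 := by
    intro y
    change P (Pi.single y 1) (g⁻¹ • y) = _
    rw [hP]
    congr 1
    refine Finset.sum_congr rfl fun k _ => ?_
    have hk : (τ ^ k) (g⁻¹ • y) = g⁻¹ • (τ ^ k) y := by
      clear * - hcomm
      induction k generalizing y with
      | zero => simp
      | succ k ih => rw [pow_succ, Equiv.Perm.mul_apply, hcomm, ih]; rfl
    rw [Pi.single_apply, hk]
    simp only [inv_smul_eq_iff, eq_comm (a := (τ ^ k) y)]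
  simp only [hdiag]
  rw [← Finset.mul_sum, Finset.sum_comm]
  congr 1
  refine Finset.sum_congr rfl fun k _ => ?_
  rw [← Finset.mul_sum, Nat.card_eq_fintype_card, Fintype.card_subtype, Finset.card_filter,
    Nat.cast_sum]
  simp

end Isotypic

theorem character_res {H : Type} [Group H] (f : H →* G) (V : VirtualRep G) (h : H) :
    character (res f V) h = character V (f h) := by
  obtain ⟨A, B, rfl⟩ := exists_eq_mk_sub_mk V
  have : ∀ A : FDRep ℂ G, character (res f (mk A)) h = character (mk A) (f h) := by
    intro A
    rw [res, lift_mk, character_mk, character_mk]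
    rfl
  rw [map_sub, map_sub, map_sub, Pi.sub_apply, Pi.sub_apply, this, this]

theorem character_isConj {V : VirtualRep G} {g h : G} (hgh : IsConj g h) :
    character V g = character V h := by
  obtain ⟨c, rfl⟩ := isConj_iff.1 hgh
  obtain ⟨A, B, rfl⟩ := exists_eq_mk_sub_mk V
  rw [map_sub, Pi.sub_apply, Pi.sub_apply, character_mk, character_mk,
    Representation.char_conj, Representation.char_conj]

end VirtualRep

end

/-! ### Power sums, colorings constant on cycles, and injectivity of the Frobenius characteristic -/

section

section Colorings

variable {K : Type} [Fintype K] {size : K → ℕ} (hs : ∀ k, 0 < size k)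

theorem sum_single_apply (a : K → ℕ+) (i : ℕ+) :
    (∑ k, Finsupp.single (a k) (size k)) i = ∑ k, if a k = i then size k else 0 := by
  rw [Finsupp.finsetSum_apply]
  exact Finset.sum_congr rfl fun k _ => Finsupp.single_apply

include hs in
theorem mem_support_sum_single (a : K → ℕ+) (i : ℕ+) :
    i ∈ (∑ k, Finsupp.single (a k) (size k)).support ↔ ∃ k, a k = i := by
  rw [Finsupp.mem_support_iff, sum_single_apply, Ne, Finset.sum_eq_zero_iff]
  simp [(hs _).ne']

include hs in
theorem finite_sum_single_eq (m : ℕ+ →₀ ℕ) :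
    Finite {a : K → ℕ+ // ∑ k, Finsupp.single (a k) (size k) = m} := by
  have hmem : ∀ (a : {a : K → ℕ+ // ∑ k, Finsupp.single (a k) (size k) = m}) k,
      a.1 k ∈ m.support := by
    rintro ⟨a, rfl⟩ k
    exact (mem_support_sum_single hs a _).2 ⟨k, rfl⟩
  refine Finite.of_injective (β := K → m.support) (fun a k => ⟨a.1 k, hmem a k⟩) ?_
  intro a b hab
  refine Subtype.ext (funext fun k => ?_)
  exact congrArg Subtype.val (congrFun hab k)

theorem coeff_powerSum (k : ℕ) (m : ℕ+ →₀ ℕ) [Decidable (∃ i : ℕ+, m = Finsupp.single i k)] :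
    MvPowerSeries.coeff m (powerSum k) = if ∃ i : ℕ+, m = Finsupp.single i k then 1 else 0 := by
  change powerSum k m = _
  unfold powerSum
  congr

include hs in
theorem coeff_prod_powerSum (m : ℕ+ →₀ ℕ) :
    MvPowerSeries.coeff m (∏ k, powerSum (size k)) =
      Nat.card {a : K → ℕ+ // ∑ k, Finsupp.single (a k) (size k) = m} := by
  classical
  rw [MvPowerSeries.coeff_prod]
  have : ∀ l : K →₀ ℕ+ →₀ ℕ, ∏ k, MvPowerSeries.coeff (l k) (powerSum (size k)) =
      if ∀ k, ∃ i : ℕ+, l k = Finsupp.single i (size k) then 1 else 0 := by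
    intro l
    simp only [coeff_powerSum, Finset.prod_ite_zero, Finset.mem_univ, true_imp_iff,
      Finset.prod_const_one]
  rw [Finset.sum_congr rfl fun l _ => this l, ← Finset.sum_filter, Finset.sum_const, nsmul_one,
    ← Fintype.card_coe, ← Nat.card_eq_fintype_card]
  congr 1
  refine (Nat.card_congr (Equiv.ofBijective (fun a => ⟨Finsupp.equivFunOnFinite.symm
    (fun k => Finsupp.single (a.1 k) (size k)), Finset.mem_filter.2 ⟨Finset.mem_finsuppAntidiag.2
      ⟨a.2, Finset.subset_univ _⟩, fun k => ⟨a.1 k, rfl⟩⟩⟩) ⟨?_, ?_⟩)).symm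
  · intro a b hab
    ext k
    have := DFunLike.congr_fun (congrArg Subtype.val hab) k
    have h2 : Finsupp.single (a.1 k) (size k) = Finsupp.single (b.1 k) (size k) := this
    rw [Finsupp.single_left_inj (hs k).ne'] at h2
    rw [h2]
  · rintro ⟨l, hl⟩
    rw [Finset.mem_filter, Finset.mem_finsuppAntidiag] at hl
    choose a ha using hl.2
    refine ⟨⟨a, ?_⟩, ?_⟩
    · rw [← hl.1.1]
      exact Finset.sum_congr rfl fun k _ => (ha k).symm
    · ext k : 2
      exact (ha k).symm

end Colorings

section Cycles

variable {n : ℕ} (σ : Equiv.Perm (Fin n))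

/-- The cycles of a permutation, fixed points included. -/
abbrev Cyc : Type := {c // c ∈ σ.cycleFactorsFinset} ⊕ {i // i ∈ σ.supportᶜ}

/-- The length of a cycle. -/
def cycSize : Cyc σ → ℕ := Sum.elim (fun c => c.1.support.card) (fun _ => 1)

/-- The cycle that contains a point. -/
def cycOf (i : Fin n) : Cyc σ :=
  if h : i ∈ σ.support then Sum.inl ⟨σ.cycleOf i, Equiv.Perm.cycleOf_mem_cycleFactorsFinset_iff.2 h⟩
  else Sum.inr ⟨i, Finset.mem_compl.2 h⟩

theorem cycSize_pos (k : Cyc σ) : 0 < cycSize σ k := by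
  rcases k with ⟨c, hc⟩ | i
  · have := (Equiv.Perm.mem_cycleFactorsFinset_iff.1 hc).1.two_le_card_support
    simp only [cycSize, Sum.elim_inl]; omega
  · exact one_pos

theorem parts_partition_eq_map_cycSize :
    σ.partition.parts = Finset.univ.val.map (cycSize σ) := by
  rw [Equiv.Perm.parts_partition, ← Finset.univ_disjSum_univ, Finset.val_disjSum,
    Multiset.disjSum, Multiset.map_add, Multiset.map_map, Multiset.map_map]
  congr 1
  · rw [Equiv.Perm.cycleType_def]
    change _ = Multiset.map (fun c : {c // c ∈ σ.cycleFactorsFinset} => c.1.support.card) _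
    rw [Finset.univ_eq_attach]
    exact (Multiset.attach_map_val' σ.cycleFactorsFinset.val
      (Finset.card ∘ Equiv.Perm.support)).symm
  · change _ = Multiset.map (Function.const _ 1) _
    rw [Multiset.map_const, Finset.card_val, Finset.card_univ, Fintype.card_coe, Finset.card_compl]

theorem cycOf_apply (i : Fin n) : cycOf σ (σ i) = cycOf σ i := by
  by_cases h : i ∈ σ.support
  · have h' : σ i ∈ σ.support := Equiv.Perm.apply_mem_support.2 h
    simp only [cycOf, h, h', dif_pos, Sum.inl.injEq, Subtype.mk.injEq]
    exact (Equiv.Perm.SameCycle.cycleOf_eq ⟨1, rfl⟩).symm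
  · rw [Equiv.Perm.notMem_support.1 h]

theorem sameCycle_of_cycOf_eq {i j : Fin n} (h : cycOf σ i = cycOf σ j) : σ.SameCycle i j := by
  unfold cycOf at h
  split_ifs at h with h1 h2 h2
  · rw [Sum.inl.injEq, Subtype.mk.injEq] at h
    rw [← Equiv.Perm.mem_support_cycleOf_iff' (Equiv.Perm.mem_support.1 h1), h,
      Equiv.Perm.mem_support_cycleOf_iff]
    exact ⟨.refl _ _, h2⟩
  · rw [Sum.inr.injEq, Subtype.mk.injEq] at h
    rw [h]

theorem card_cycOf_fiber (k : Cyc σ) :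
    (Finset.univ.filter fun i => cycOf σ i = k).card = cycSize σ k := by
  rcases k with ⟨c, hc⟩ | ⟨i, hi⟩
  · change _ = c.support.card
    congr 1
    ext i
    refine Finset.mem_filter.trans ?_
    simp only [Finset.mem_univ, true_and, cycOf]
    split_ifs with h
    · rw [Sum.inl.injEq, Subtype.mk.injEq]
      constructor
      · rintro rfl
        rw [Equiv.Perm.mem_support_cycleOf_iff]
        exact ⟨.refl _ _, h⟩
      · exact fun hi => (Equiv.Perm.cycle_is_cycleOf hi hc).symm
    · simp only [false_iff]
      exact fun hi => h (Equiv.Perm.mem_cycleFactorsFinset_support_le hc hi)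
  · change _ = 1
    rw [Finset.card_eq_one]
    refine ⟨i, ?_⟩
    ext x
    refine Finset.mem_filter.trans ?_
    simp only [Finset.mem_univ, true_and, cycOf, Finset.mem_singleton]
    split_ifs with h
    · simp only [false_iff]
      rintro rfl
      exact Finset.mem_compl.1 hi h
    · simp

theorem cycOf_surjective : Function.Surjective (cycOf σ) := by
  intro k
  have h := cycSize_pos σ k
  rw [← card_cycOf_fiber, Finset.card_pos] at h
  obtain ⟨i, hi⟩ := h
  exact ⟨i, (Finset.mem_filter.1 hi).2⟩

theorem sum_single_cycOf (b : Cyc σ → ℕ+) :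
    ∑ i, Finsupp.single (b (cycOf σ i)) 1 = ∑ k, Finsupp.single (b k) (cycSize σ k) := by
  rw [← Finset.sum_fiberwise_of_maps_to (s := Finset.univ) (t := Finset.univ) (g := cycOf σ)
    (fun _ _ => Finset.mem_univ _)]
  refine Finset.sum_congr rfl fun k _ => ?_
  rw [Finset.sum_congr rfl fun i hi => by rw [(Finset.mem_filter.1 hi).2], Finset.sum_const,
    card_cycOf_fiber, ← Finsupp.smul_single_one]
  simp

theorem exists_eq_comp_cycOf {α : Type} {a : Fin n → α} (ha : a ∘ σ = a) :
    ∃ b : Cyc σ → α, a = b ∘ cycOf σ := by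
  refine ⟨fun k => a (Function.surjInv (cycOf_surjective σ) k), funext fun i => ?_⟩
  obtain ⟨z, hz⟩ := sameCycle_of_cycOf_eq σ (Function.surjInv_eq (cycOf_surjective σ) (cycOf σ i))
  have hk : ∀ (k : ℕ) x, a ((σ ^ k) x) = a x := by
    intro k
    induction k with
    | zero => intro x; rfl
    | succ k ih => intro x; rw [pow_succ, Equiv.Perm.mul_apply, ih]; exact congrFun ha x
  have hz' : ∀ (z : ℤ) x, a ((σ ^ z) x) = a x := by
    intro z x
    obtain ⟨k, rfl | rfl⟩ := z.eq_nat_or_neg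
    · rw [zpow_natCast, hk]
    · rw [← hk k ((σ ^ (-(k : ℤ))) x), ← Equiv.Perm.mul_apply, ← zpow_natCast, ← zpow_add]
      simp
  exact (congrArg a hz).symm.trans (hz' _ _)

/-- An invariant coloring is a choice of one color per cycle, and a cycle of length `k` uses its
color `k` times, exactly as a monomial of `p_k` does. -/
theorem coeff_prod_powerSum_partition (m : ℕ+ →₀ ℕ) :
    MvPowerSeries.coeff m (σ.partition.parts.map powerSum).prod =
      Nat.card {a : Fin n → ℕ+ // a ∘ σ = a ∧ ∑ i, Finsupp.single (a i) 1 = m} := by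
  rw [parts_partition_eq_map_cycSize, Multiset.map_map]
  change MvPowerSeries.coeff m (∏ k, powerSum (cycSize σ k)) = _
  rw [coeff_prod_powerSum (cycSize_pos σ)]
  congr 1
  refine Nat.card_congr (Equiv.ofBijective (fun b => ⟨b.1 ∘ cycOf σ,
    funext fun i => congrArg b.1 (cycOf_apply σ i), (sum_single_cycOf σ b.1).trans b.2⟩) ⟨?_, ?_⟩)
  · intro b b' h
    exact Subtype.ext ((cycOf_surjective σ).injective_comp_right (congrArg Subtype.val h))
  · rintro ⟨a, ha, hm⟩
    obtain ⟨b, rfl⟩ := exists_eq_comp_cycOf σ ha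
    refine ⟨⟨b, ?_⟩, rfl⟩
    rw [← hm]
    exact (sum_single_cycOf σ b).symm

end Cycles

/-- The known count of permutations by cycle type treats fixed points separately: the parts `≥ 2`
form `m`, and the factor of `z_λ` at `i = 1` is `(n - m.sum)!`. -/
theorem zPartition_mul_card {n : ℕ} (lam : n.Partition) :
    zPartition lam * Nat.card {σ : Equiv.Perm (Fin n) // HasCycleType σ lam} = n ! := by
  classical
  set m := lam.parts.filter (fun k => 2 ≤ k) with hm
  have hcyc : ∀ σ : Equiv.Perm (Fin n), HasCycleType σ lam ↔ σ.cycleType = m := by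
    intro σ
    obtain ⟨τ, hτ⟩ := exists_hasCycleType lam
    have hτ' : τ.cycleType = m := by
      rw [hm, ← hτ, Equiv.Perm.filter_parts_partition_eq_cycleType]
    rw [HasCycleType, ← hτ, ← hτ', ← Equiv.Perm.isConj_iff_cycleType_eq,
      Equiv.Perm.partition_eq_of_isConj, Nat.Partition.ext_iff]
  obtain ⟨τ, hτ⟩ := exists_hasCycleType lam
  have hτm := (hcyc τ).1 hτ
  have hle : m.sum ≤ Fintype.card (Fin n) ∧ ∀ a ∈ m, 2 ≤ a := by
    rw [← hτm]
    refine ⟨?_, fun a ha => Equiv.Perm.two_le_of_mem_cycleType ha⟩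
    rw [Equiv.Perm.sum_cycleType]
    exact Finset.card_le_univ _
  have hcard := Equiv.Perm.card_of_cycleType_mul_eq (Fin n) m
  rw [if_pos hle, Fintype.card_fin] at hcard
  have hone : lam.parts.count 1 = n - m.sum := by
    rw [← hτ, Equiv.Perm.parts_partition, Multiset.count_add, hτm, ← Equiv.Perm.sum_cycleType,
      hτm, Multiset.count_eq_zero.2 fun h => by have := hle.2 1 h; omega]
    simp
  have hcount : ∀ i, 2 ≤ i → lam.parts.count i = m.count i := by
    intro i hi
    rw [hm, Multiset.count_filter_of_pos hi]
  rw [Nat.card_eq_fintype_card, Fintype.card_subtype, ← hcard, mul_comm]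
  simp only [hcyc]
  congr 1
  have hmem : ∀ i ∈ m, 2 ≤ i ∧ i ≤ n := by
    intro i hi
    refine ⟨hle.2 i hi, (Multiset.le_sum_of_mem hi).trans ?_⟩
    simpa using hle.1
  have hsub : m.toFinset ⊆ Finset.Icc 2 n := by
    intro i hi
    rw [Multiset.mem_toFinset] at hi
    exact Finset.mem_Icc.2 (hmem i hi)
  rw [zPartition]
  rcases Nat.eq_zero_or_pos n with rfl | hn
  · have : m = 0 := Multiset.eq_zero_of_forall_notMem fun i hi => by have := hmem i hi; omega
    simp [this]
  rw [← Finset.insert_Icc_succ_left_eq_Icc (show 1 ≤ n from hn), Finset.prod_insert (by simp), hone, one_pow, one_mul,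
    mul_assoc]
  congr 1
  change ∏ i ∈ Finset.Icc 2 n, _ = _
  rw [Finset.prod_congr rfl (g := fun i => i ^ m.count i * (m.count i)!) fun i hi => by
    rw [hcount i (Finset.mem_Icc.1 hi).1], Finset.prod_mul_distrib,
    Finset.prod_multiset_count_of_subset m _ hsub]
  congr 1
  refine (Finset.prod_subset hsub fun i _ hi => ?_).symm
  rw [Multiset.mem_toFinset] at hi
  simp [Multiset.count_eq_zero.2 hi]

/-- Since `n!/z_λ` is the size of the conjugacy class of type `λ`, the sum over partitions is an
average over the group. -/
theorem coeff_frobeniusChar {n : ℕ} (V : VirtualRep (Equiv.Perm (Fin n))) (m : ℕ+ →₀ ℕ) :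
    MvPowerSeries.coeff m (frobeniusChar V) = (n ! : ℂ)⁻¹ * ∑ σ, V.character σ *
      Nat.card {a : Fin n → ℕ+ // a ∘ σ = a ∧ ∑ i, Finsupp.single (a i) 1 = m} := by
  classical
  have hterm : ∀ lam : n.Partition,
      MvPowerSeries.coeff m (((zPartition lam : ℂ)⁻¹ * characterValue V lam) •
        MvPowerSeries.map (algebraMap ℚ ℂ) (powerSumPartition lam)) =
      (n ! : ℂ)⁻¹ * ∑ σ ∈ Finset.univ.filter fun σ => HasCycleType σ lam, V.character σ *
        Nat.card {a : Fin n → ℕ+ // a ∘ σ = a ∧ ∑ i, Finsupp.single (a i) 1 = m} := by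
    intro lam
    have hσ : ∀ σ ∈ Finset.univ.filter fun σ => HasCycleType σ lam, V.character σ *
        Nat.card {a : Fin n → ℕ+ // a ∘ σ = a ∧ ∑ i, Finsupp.single (a i) 1 = m} =
        characterValue V lam * algebraMap ℚ ℂ (MvPowerSeries.coeff m (powerSumPartition lam)) := by
      intro σ hσ
      have h := (Finset.mem_filter.1 hσ).2
      congr 1
      · refine VirtualRep.character_isConj (Equiv.Perm.partition_eq_of_isConj.2 ?_)
        rw [Nat.Partition.ext_iff, (exists_hasCycleType lam).choose_spec]
        exact h
      · rw [powerSumPartition, ← h, coeff_prod_powerSum_partition]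
        simp
    have hz := zPartition_mul_card lam
    rw [Nat.card_eq_fintype_card, Fintype.card_subtype] at hz
    rw [Finset.sum_congr rfl hσ, Finset.sum_const, MvPowerSeries.coeff_smul, MvPowerSeries.coeff_map,
      ← hz, nsmul_eq_mul]
    have hz0 : zPartition lam ≠ 0 := fun h => (Nat.factorial_ne_zero n) (by rw [← hz, h, zero_mul])
    have hc0 : (Finset.univ.filter fun σ => HasCycleType σ lam).card ≠ 0 :=
      fun h => (Nat.factorial_ne_zero n) (by rw [← hz, h, mul_zero])
    push_cast
    have h1 : (zPartition lam : ℂ) ≠ 0 := by exact_mod_cast hz0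
    have h2 : ((Finset.univ.filter fun σ => HasCycleType σ lam).card : ℂ) ≠ 0 := by
      exact_mod_cast hc0
    field_simp
  rw [frobeniusChar, map_sum, Finset.sum_congr rfl fun lam _ => hterm lam, ← Finset.mul_sum]
  congr 1
  let part : Equiv.Perm (Fin n) → n.Partition := fun σ =>
    ⟨σ.partition.parts, σ.partition.parts_pos, by rw [σ.partition.parts_sum, Fintype.card_fin]⟩
  rw [← Finset.sum_fiberwise_of_maps_to (s := Finset.univ) (t := Finset.univ) (g := part)
    (fun _ _ => Finset.mem_univ _)]
  refine Finset.sum_congr rfl fun lam _ => Finset.sum_congr ?_ fun _ _ => rfl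
  ext σ
  refine Finset.mem_filter.trans (Iff.trans ?_ Finset.mem_filter.symm)
  rw [Nat.Partition.ext_iff]
  rfl

end

/-- If there are at least as many colors as cycles, then distinct cycles have distinct colors, and
the cycle lengths are the multiplicities of the colors. -/
theorem parts_partition_of_card_support {n : ℕ} (σ : Equiv.Perm (Fin n)) {a : Fin n → ℕ+}
    (ha : a ∘ σ = a) {m : ℕ+ →₀ ℕ} (hm : ∑ i, Finsupp.single (a i) 1 = m)
    (h : Fintype.card (Cyc σ) ≤ m.support.card) :
    σ.partition.parts = m.support.val.map m := by
  classical
  obtain ⟨b, rfl⟩ := exists_eq_comp_cycOf σ ha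
  have h1 : (∑ i, Finsupp.single ((b ∘ cycOf σ) i) 1) = _ := sum_single_cycOf σ b
  rw [h1] at hm
  have himg : m.support = Finset.univ.image b := by
    ext i
    rw [← hm, mem_support_sum_single (cycSize_pos σ) b i]
    simp
  have hinj : Function.Injective b := by
    rw [himg] at h
    have := Finset.card_image_iff.1 (le_antisymm Finset.card_image_le h)
    simpa using this
  rw [parts_partition_eq_map_cycSize, himg, Finset.image_val_of_injOn hinj.injOn,
    Multiset.map_map]
  refine Multiset.map_congr rfl fun k _ => ?_
  rw [Function.comp_apply, ← hm, sum_single_apply]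
  simp [hinj.eq_iff]

/-- Triangularity with respect to the number of cycles. Among the `σ` with `f σ ≠ 0` take `σ₀` with
the most cycles and color these with distinct colors. Any `σ` in the support of `f` that has an
invariant coloring of this content is then conjugate to `σ₀`, so the relation for this content reads
`f σ₀` times a positive number equals zero. -/
theorem eq_zero_of_sum_mul_card_eq_zero {n : ℕ} (f : Equiv.Perm (Fin n) → ℂ)
    (hf : ∀ σ τ, IsConj σ τ → f σ = f τ)
    (h : ∀ m : ℕ+ →₀ ℕ, ∑ σ, f σ * Nat.card {a : Fin n → ℕ+ // a ∘ σ = a ∧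
      ∑ i, Finsupp.single (a i) 1 = m} = 0) : f = 0 := by
  classical
  by_contra hne
  obtain ⟨τ, hτ⟩ : ∃ τ, f τ ≠ 0 := by
    by_contra hc
    push Not at hc
    exact hne (funext hc)
  obtain ⟨σ₀, hσ₀, hmax⟩ := Finset.exists_max_image (Finset.univ.filter fun σ => f σ ≠ 0)
    (fun σ => Fintype.card (Cyc σ)) ⟨τ, Finset.mem_filter.2 ⟨Finset.mem_univ _, hτ⟩⟩
  replace hσ₀ : f σ₀ ≠ 0 := (Finset.mem_filter.1 hσ₀).2
  let b : Cyc σ₀ → ℕ+ := fun k => ⟨Fintype.equivFin _ k + 1, Nat.succ_pos _⟩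
  have hb : Function.Injective b := by
    intro k l hkl
    have : ((Fintype.equivFin (Cyc σ₀) k : ℕ) + 1) = (Fintype.equivFin (Cyc σ₀) l : ℕ) + 1 :=
      congrArg PNat.val hkl
    exact (Fintype.equivFin _).injective (Fin.ext (by omega))
  set a : Fin n → ℕ+ := b ∘ cycOf σ₀ with ha
  have haσ : a ∘ σ₀ = a := funext fun i => congrArg b (cycOf_apply σ₀ i)
  set m : ℕ+ →₀ ℕ := ∑ i, Finsupp.single (a i) 1 with hm
  have hcard : m.support.card = Fintype.card (Cyc σ₀) := by
    have : m = ∑ k, Finsupp.single (b k) (cycSize σ₀ k) := sum_single_cycOf σ₀ b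
    rw [this, ← Finset.card_univ, ← Finset.card_image_of_injective _ hb]
    congr 1
    ext i
    rw [mem_support_sum_single (cycSize_pos σ₀)]
    simp
  have hp₀ := parts_partition_of_card_support σ₀ haσ rfl hcard.ge
  have key : ∀ σ, f σ * Nat.card {a : Fin n → ℕ+ // a ∘ σ = a ∧
      ∑ i, Finsupp.single (a i) 1 = m} = f σ₀ * ((if f σ ≠ 0 then Nat.card {a : Fin n → ℕ+ //
        a ∘ σ = a ∧ ∑ i, Finsupp.single (a i) 1 = m} else 0 : ℕ) : ℂ) := by
    intro σ
    split_ifs with h0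
    · rcases isEmpty_or_nonempty {a : Fin n → ℕ+ // a ∘ σ = a ∧
        ∑ i, Finsupp.single (a i) 1 = m} with he | ⟨⟨c, hc, hcm⟩⟩
      · simp
      · congr 1
        refine hf _ _ (Equiv.Perm.partition_eq_of_isConj.2 (Nat.Partition.ext_iff.2 ?_))
        rw [hp₀]
        refine parts_partition_of_card_support σ hc hcm ?_
        rw [hcard]
        exact hmax σ (Finset.mem_filter.2 ⟨Finset.mem_univ _, h0⟩)
    · rw [not_ne_iff.1 h0]; simp
  have hsum := h m
  rw [Finset.sum_congr rfl fun σ _ => key σ, ← Finset.mul_sum, mul_eq_zero, ← Nat.cast_sum,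
    Nat.cast_eq_zero, Finset.sum_eq_zero_iff] at hsum
  have h2 := (hsum.resolve_left hσ₀) σ₀ (Finset.mem_univ _)
  rw [if_pos hσ₀] at h2
  have hfin : Finite {a : Fin n → ℕ+ // a ∘ σ₀ = a ∧ ∑ i, Finsupp.single (a i) 1 = m} := by
    have := finite_sum_single_eq (K := Fin n) (size := fun _ => 1) (fun _ => one_pos) m
    exact Finite.of_injective (β := {a : Fin n → ℕ+ // ∑ i, Finsupp.single (a i) 1 = m})
      (fun a => ⟨a.1, a.2.2⟩) fun a b h => Subtype.ext (Subtype.mk.inj h)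
  have : Nonempty {a : Fin n → ℕ+ // a ∘ σ₀ = a ∧ ∑ i, Finsupp.single (a i) 1 = m} :=
    ⟨⟨a, haσ, rfl⟩⟩
  exact Nat.card_pos.ne' h2

theorem frobeniusChar_injective {n : ℕ} :
    Function.Injective (frobeniusChar : VirtualRep (Equiv.Perm (Fin n)) → _) := by
  intro V W h
  apply VirtualRep.character_injective
  rw [← sub_eq_zero]
  refine eq_zero_of_sum_mul_card_eq_zero _ (fun σ τ hστ => ?_) fun m => ?_
  · rw [Pi.sub_apply, Pi.sub_apply, VirtualRep.character_isConj hστ,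
      VirtualRep.character_isConj hστ]
  · have hm := congrArg (MvPowerSeries.coeff m) h
    rw [coeff_frobeniusChar, coeff_frobeniusChar] at hm
    have := mul_left_cancel₀ (inv_ne_zero (Nat.cast_ne_zero.2 (Nat.factorial_ne_zero n))) hm
    simp only [Pi.sub_apply, sub_mul, Finset.sum_sub_distrib]
    rw [this, sub_self]

/-- A twisted Burnside lemma, in which `Z` is the set of orbits. If `τ` keeps `u` in its orbit, the
`g` with `g u = τ u` form a coset of the stabilizer of `u`; otherwise there are none. Each orbit
fixed by `τ'` therefore contributes the order of `G`. -/
theorem card_smul_eq_twist {G U Z : Type} [Group G] [Finite G] [Finite U] [MulAction G U]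
    (q : U → Z) (hq : Function.Surjective q) (horb : ∀ u v, q u = q v ↔ ∃ g : G, g • u = v)
    (τ : U → U) (τ' : Z → Z) (hτ : ∀ u, q (τ u) = τ' (q u)) :
    Nat.card {p : G × U // p.1 • p.2 = τ p.2} = Nat.card G * Nat.card {z // τ' z = z} := by
  classical
  have := Fintype.ofFinite G
  have := Fintype.ofFinite U
  have : Finite Z := Finite.of_surjective q hq
  have := Fintype.ofFinite Z
  have hfib : ∀ u, (Finset.univ.filter fun v => q v = q u).card *
      (Finset.univ.filter fun g : G => g • u = u).card = Fintype.card G := by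
    intro u
    rw [← MulAction.card_orbit_mul_card_stabilizer_eq_card_group G u]
    congr 1
    · rw [← Set.toFinset_card]
      congr 1
      ext v
      simp only [Finset.mem_filter, Finset.mem_univ, true_and, Set.mem_toFinset]
      rw [eq_comm, horb]
      rfl
    · rw [← Fintype.card_subtype]
      rfl
  have hstab : ∀ u, τ' (q u) = q u → (Finset.univ.filter fun g : G => g • u = τ u).card =
      (Finset.univ.filter fun g : G => g • u = u).card := by
    intro u hu
    obtain ⟨h, hh⟩ := (horb u (τ u)).1 (by rw [hτ, hu])
    refine Finset.card_bij (fun g _ => h⁻¹ * g) ?_ ?_ ?_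
    · intro g hg
      simp only [Finset.mem_filter, Finset.mem_univ, true_and] at hg ⊢
      rw [mul_smul, hg, ← hh, inv_smul_smul]
    · intro a _ b _ hab
      exact mul_left_cancel hab
    · intro g hg
      simp only [Finset.mem_filter, Finset.mem_univ, true_and] at hg
      refine ⟨h * g, ?_, by simp⟩
      simp only [Finset.mem_filter, Finset.mem_univ, true_and]
      rw [mul_smul, hg, hh]
  have hzero : ∀ u, τ' (q u) ≠ q u → (Finset.univ.filter fun g : G => g • u = τ u).card = 0 := by
    intro u hu
    rw [Finset.card_eq_zero, Finset.filter_eq_empty_iff]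
    intro g _ hg
    exact hu (by rw [← hτ, (horb u (τ u)).2 ⟨g, hg⟩])
  have hfibsum : ∀ z, ∑ u ∈ Finset.univ.filter (fun u => q u = z),
      (Finset.univ.filter fun g : G => g • u = τ u).card =
      if τ' z = z then Fintype.card G else 0 := by
    intro z
    split_ifs with hz
    · obtain ⟨u₀, rfl⟩ := hq z
      have hpos : 0 < (Finset.univ.filter fun u => q u = q u₀).card :=
        Finset.card_pos.2 ⟨u₀, by simp⟩
      refine Nat.eq_of_mul_eq_mul_left hpos ?_
      rw [Finset.mul_sum, Finset.sum_congr rfl (g := fun _ => Fintype.card G), Finset.sum_const,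
        smul_eq_mul]
      intro u hu
      have hu' := (Finset.mem_filter.1 hu).2
      rw [hstab u (by rw [hu', hz]), ← hfib u, hu']
    · obtain ⟨u₀, rfl⟩ := hq z
      refine Finset.sum_eq_zero fun u hu => hzero u ?_
      rw [(Finset.mem_filter.1 hu).2]
      exact hz
  calc Nat.card {p : G × U // p.1 • p.2 = τ p.2}
      = ∑ u : U, (Finset.univ.filter fun g : G => g • u = τ u).card := by
        rw [Nat.card_eq_fintype_card, Fintype.card_subtype, Finset.card_filter,
          Fintype.sum_prod_type_right]
        exact Finset.sum_congr rfl fun u _ => (Finset.card_filter _ _).symm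
    _ = ∑ z : Z, if τ' z = z then Fintype.card G else 0 := by
        rw [← Finset.sum_fiberwise_of_maps_to (s := Finset.univ) (t := Finset.univ) (g := q)
          (fun _ _ => Finset.mem_univ _)]
        exact Finset.sum_congr rfl fun z _ => hfibsum z
    _ = _ := by
        rw [← Finset.sum_filter, Finset.sum_const, smul_eq_mul, mul_comm,
          ← Fintype.card_subtype, Nat.card_eq_fintype_card, Nat.card_eq_fintype_card]

/-- A point of period `d`, with `r = d e`, contributes the sum of the `ω^k` over the multiples `k <
r` of `d`. This is the full geometric sum of the primitive `e`-th root of unity `ω^d`, which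
vanishes unless `e = 1`. -/
theorem sum_pow_mul_card_isPeriodicPt {Z : Type} [Finite Z] (τ : Z → Z) {r : ℕ} (hr : 0 < r)
    (hτ : ∀ z, τ^[r] z = z) {ω : ℂ} (hω : IsPrimitiveRoot ω r) :
    ∑ k ∈ Finset.range r, ω ^ k * Nat.card {z // τ^[k] z = z} =
      Nat.card {z // Function.minimalPeriod τ z = r} := by
  classical
  have := Fintype.ofFinite Z
  have hinner : ∀ z, ∑ k ∈ Finset.range r, (ω ^ k * if τ^[k] z = z then 1 else 0) =
      if Function.minimalPeriod τ z = r then 1 else 0 := by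
    intro z
    set d := Function.minimalPeriod τ z with hd
    have hdvd : ∀ k, τ^[k] z = z ↔ d ∣ k := fun k => Function.isPeriodicPt_iff_minimalPeriod_dvd
    obtain ⟨e, he⟩ := (hdvd r).1 (hτ z)
    have hd0 : 0 < d := Nat.pos_of_ne_zero fun h => by rw [h, zero_mul] at he; omega
    have he0 : 0 < e := Nat.pos_of_ne_zero fun h => by rw [h, mul_zero] at he; omega
    have hset : (Finset.range r).filter (fun k => d ∣ k) = (Finset.range e).image (d * ·) := by
      ext k
      simp only [Finset.mem_filter, Finset.mem_range, Finset.mem_image]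
      constructor
      · rintro ⟨hk, l, rfl⟩
        refine ⟨l, ?_, rfl⟩
        rw [he] at hk
        exact lt_of_mul_lt_mul_left hk (Nat.zero_le _)
      · rintro ⟨l, hl, rfl⟩
        exact ⟨by rw [he]; exact Nat.mul_lt_mul_of_pos_left hl hd0, dvd_mul_right _ _⟩
    simp only [hdvd, mul_ite, mul_one, mul_zero]
    rw [← Finset.sum_filter, hset, Finset.sum_image fun a _ b _ h => Nat.eq_of_mul_eq_mul_left hd0 h]
    have hω' : IsPrimitiveRoot (ω ^ d) e := hω.pow hr he
    simp only [pow_mul]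
    split_ifs with h
    · have : e = 1 := by
        rw [h] at he
        exact Nat.eq_of_mul_eq_mul_left hr (by omega)
      simp [this]
    · refine hω'.geom_sum_eq_zero ?_
      by_contra hc
      have : e = 1 := by omega
      rw [this, mul_one] at he
      exact h he.symm
  have hL : ∀ k, (Nat.card {z // τ^[k] z = z} : ℂ) = ∑ z : Z, if τ^[k] z = z then 1 else 0 := by
    intro k
    rw [Nat.card_eq_fintype_card, Fintype.card_subtype, Finset.card_filter, Nat.cast_sum]
    simp
  simp only [hL, Finset.mul_sum]
  rw [Finset.sum_comm, Finset.sum_congr rfl fun z _ => hinner z, Nat.card_eq_fintype_card,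
    Fintype.card_subtype, Finset.card_filter, Nat.cast_sum]
  simp

/-! ### Configurations of points in marked blocks, and their orbits together with colorings -/

section

theorem exists_perm_comp_eq {α P : Type} [Fintype α] [DecidableEq P] {f g : α → P}
    (h : ∀ p, (Finset.univ.filter fun x => f x = p).card =
      (Finset.univ.filter fun x => g x = p).card) : ∃ σ : Equiv.Perm α, f ∘ σ = g := by
  have e : ∀ p, Nonempty ({x // g x = p} ≃ {x // f x = p}) := fun p => by
    rw [← Fintype.card_eq, Fintype.card_subtype, Fintype.card_subtype, h]
  let e' := fun p => (e p).some
  refine ⟨(Equiv.sigmaFiberEquiv g).symm.trans ((Equiv.sigmaCongrRight e').trans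
    (Equiv.sigmaFiberEquiv f)), funext fun x => ?_⟩
  exact (e' (g x) ⟨x, rfl⟩).2

theorem exists_map_univ_eq {P : Type} {n : ℕ} (s : Multiset P) (hs : Multiset.card s = n) :
    ∃ h : Fin n → P, Finset.univ.val.map h = s := by
  subst hs
  induction s using Quotient.inductionOn with
  | h l =>
    refine ⟨l.get, ?_⟩
    exact (Fin.univ_val_map (n := l.length) l.get).trans (congrArg _ (List.ofFn_get l))

/-- The colorings of `Fin n` with content `m`. -/
@[ext]
structure Coloring (n : ℕ) (m : ℕ+ →₀ ℕ) where
  /-- The color of a point. -/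
  a : Fin n → ℕ+
  content : ∑ i, Finsupp.single (a i) 1 = m

namespace Coloring

variable {n : ℕ} {m : ℕ+ →₀ ℕ}

instance : Finite (Coloring n m) := by
  have := finite_sum_single_eq (K := Fin n) (size := fun _ => 1) (fun _ => one_pos) m
  exact Finite.of_injective (β := {a : Fin n → ℕ+ // ∑ i, Finsupp.single (a i) 1 = m})
    (fun a => ⟨a.a, a.content⟩) fun a b h => Coloring.ext (Subtype.mk.inj h)

instance : MulAction (Equiv.Perm (Fin n)) (Coloring n m) where
  smul σ a := ⟨fun x => a.a (σ⁻¹ x),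
    (Equiv.sum_comp σ⁻¹ fun i => Finsupp.single (a.a i) 1).trans a.content⟩
  one_smul a := rfl
  mul_smul σ τ a := Coloring.ext (funext fun x => by
    change a.a ((σ * τ)⁻¹ x) = a.a (τ⁻¹ (σ⁻¹ x))
    rw [mul_inv_rev]; rfl)

theorem smul_a (σ : Equiv.Perm (Fin n)) (c : Coloring n m) (x : Fin n) :
    (σ • c).a x = c.a (σ⁻¹ x) := rfl

end Coloring

/-- Distributions of the points of `Fin n` over a cyclic sequence of `r` blocks, each with a mark
that is positive and smaller than the size of the block, enlarged by `ε`. -/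
@[ext]
structure Conf (n r j : ℕ) [NeZero r] (ε : ZMod r → ℕ) where
  /-- The block of a point. -/
  f : Fin n → ZMod r
  /-- The mark of a block. -/
  b : ZMod r → ℕ
  pos : ∀ i, 1 ≤ b i
  lt : ∀ i, b i < (Finset.univ.filter fun x => f x = i).card + ε i
  sum : ∑ i, b i = j

/-- Cyclic sequences of `r` marked multisets with total content `m` and marks of sum `j`. -/
@[ext]
structure MWord (r : ℕ) [NeZero r] (m : ℕ+ →₀ ℕ) (j : ℕ) (ε : ZMod r → ℕ) where
  /-- The multisets, given by their multiplicities. -/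
  κ : ZMod r → ℕ+ →₀ ℕ
  /-- The marks. -/
  b : ZMod r → ℕ
  pos : ∀ i, 1 ≤ b i
  lt : ∀ i, b i < (κ i).degree + ε i
  content : ∑ i, κ i = m
  sum : ∑ i, b i = j

section Block

variable {n r : ℕ}

theorem card_filter_comp_perm (σ : Equiv.Perm (Fin n)) (f : Fin n → ZMod r) (i : ZMod r) :
    (Finset.univ.filter fun x => f (σ x) = i).card =
      (Finset.univ.filter fun x => f x = i).card :=
  Finset.card_equiv σ (by simp)

theorem block_apply (f : Fin n → ZMod r) (a : Fin n → ℕ+) (i : ZMod r) (p : ℕ+) :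
    (∑ x ∈ Finset.univ.filter (fun x => f x = i), Finsupp.single (a x) 1 : ℕ+ →₀ ℕ) p =
      (Finset.univ.filter fun x => (f x, a x) = (i, p)).card := by
  rw [Finsupp.finsetSum_apply, Finset.sum_congr rfl fun x _ => Finsupp.single_apply,
    ← Finset.sum_filter, Finset.filter_filter, Finset.sum_const, smul_eq_mul, mul_one]
  simp only [Prod.mk.injEq]

theorem degree_block (f : Fin n → ZMod r) (a : Fin n → ℕ+) (i : ZMod r) :
    (∑ x ∈ Finset.univ.filter (fun x => f x = i), Finsupp.single (a x) 1 : ℕ+ →₀ ℕ).degree =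
      (Finset.univ.filter fun x => f x = i).card := by
  rw [map_sum]
  simp

end Block

variable {n r j : ℕ} [NeZero r] {ε : ZMod r → ℕ} {m : ℕ+ →₀ ℕ}

instance : Finite (Conf n r j ε) := by
  have hle : ∀ (y : Conf n r j ε) i, y.b i < j + 1 := fun y i => by
    have := Finset.single_le_sum (f := y.b) (fun _ _ => Nat.zero_le _) (Finset.mem_univ i)
    rw [y.sum] at this
    exact Nat.lt_succ_of_le this
  refine Finite.of_injective (β := (Fin n → ZMod r) × (ZMod r → Fin (j + 1)))
    (fun y => (y.f, fun i => ⟨y.b i, hle y i⟩)) fun y z h => ?_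
  have h' := Prod.mk.inj h
  exact Conf.ext h'.1 (funext fun i => congrArg Fin.val (congrFun h'.2 i))

instance : MulAction (Equiv.Perm (Fin n)) (Conf n r j ε) where
  smul σ y := ⟨fun x => y.f (σ⁻¹ x), y.b, y.pos, fun i => by
    rw [card_filter_comp_perm]
    exact y.lt i, y.sum⟩
  one_smul y := rfl
  mul_smul σ τ y := Conf.ext (funext fun x => by
    change y.f ((σ * τ)⁻¹ x) = y.f (τ⁻¹ (σ⁻¹ x))
    rw [mul_inv_rev]; rfl) rfl

theorem Conf.smul_f (σ : Equiv.Perm (Fin n)) (y : Conf n r j ε) (x : Fin n) :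
    (σ • y).f x = y.f (σ⁻¹ x) := rfl

/-- The marked multisets of colors in the blocks. -/
def blockWord (u : Conf n r j ε × Coloring n m) : MWord r m j ε where
  κ i := ∑ x ∈ Finset.univ.filter (fun x => u.1.f x = i), Finsupp.single (u.2.a x) 1
  b := u.1.b
  pos := u.1.pos
  lt i := by
    rw [degree_block]
    exact u.1.lt i
  content := (Finset.sum_fiberwise_of_maps_to (fun _ _ => Finset.mem_univ _) _).trans u.2.content
  sum := u.1.sum

/-- A word of multisets with total content of degree `n` is a multiset of `n` pairs (block, color);
any enumeration of it by `Fin n` is a preimage. -/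
theorem blockWord_surjective (hm : m.degree = n) :
    Function.Surjective (blockWord : Conf n r j ε × Coloring n m → MWord r m j ε) := by
  classical
  intro u
  let s : Multiset (ZMod r × ℕ+) := ∑ i, (Finsupp.toMultiset (u.κ i)).map fun p => (i, p)
  have hs : Multiset.card s = n := by
    rw [← hm, ← u.content, map_sum, Multiset.card_sum]
    refine Finset.sum_congr rfl fun i _ => ?_
    rw [Multiset.card_map, Finsupp.card_toMultiset]
    rfl
  obtain ⟨h, hh⟩ := exists_map_univ_eq s hs
  have hcount : ∀ i p, (Finset.univ.filter fun x => ((h x).1, (h x).2) = (i, p)).card =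
      u.κ i p := by
    intro i p
    have : Multiset.count (i, p) s = u.κ i p := by
      simp only [s, Multiset.count_sum']
      rw [Finset.sum_eq_single i]
      · rw [Multiset.count_map_eq_count' _ _ (Prod.mk_right_injective i), Finsupp.count_toMultiset]
      · intro i' _ hi'
        rw [Multiset.count_eq_zero]
        intro hmem
        obtain ⟨q, _, hq⟩ := Multiset.mem_map.1 hmem
        exact hi' (congrArg Prod.fst hq)
      · simp
    rw [← this, ← hh, Multiset.count_map, Finset.card_def, Finset.filter_val]
    simp only [Prod.mk.eta, eq_comm]
  have hκ : ∀ i, ∑ x ∈ Finset.univ.filter (fun x => (h x).1 = i), Finsupp.single (h x).2 1 =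
      u.κ i := by
    intro i
    ext p
    rw [block_apply (fun x => (h x).1) (fun x => (h x).2), hcount]
  refine ⟨⟨⟨fun x => (h x).1, u.b, u.pos, fun i => ?_, u.sum⟩, ⟨fun x => (h x).2, ?_⟩⟩, ?_⟩
  · rw [← degree_block (fun x => (h x).1) (fun x => (h x).2), hκ]
    exact u.lt i
  · rw [← u.content, ← Finset.sum_fiberwise_of_maps_to (s := Finset.univ) (t := Finset.univ)
      (g := fun x => (h x).1) (fun _ _ => Finset.mem_univ _)]
    exact Finset.sum_congr rfl fun i _ => hκ i
  · exact MWord.ext (funext hκ) rfl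

/-- Words of marked multisets are the orbits: two maps from the points to pairs (block, color) with
fibers of equal size differ by a permutation of the points. -/
theorem blockWord_eq_iff (u v : Conf n r j ε × Coloring n m) :
    blockWord u = blockWord v ↔ ∃ σ : Equiv.Perm (Fin n), σ • u = v := by
  constructor
  · intro h
    have h1 := congrArg MWord.κ h
    have h2 : u.1.b = v.1.b := congrArg MWord.b h
    obtain ⟨σ, hσ⟩ := exists_perm_comp_eq (f := fun x => (u.1.f x, u.2.a x))
      (g := fun x => (v.1.f x, v.2.a x)) (fun ⟨i, p⟩ => by
        rw [← block_apply, ← block_apply]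
        exact congrArg (fun κ : ZMod r → ℕ+ →₀ ℕ => κ i p) h1)
    refine ⟨σ⁻¹, Prod.ext (Conf.ext ?_ h2) (Coloring.ext ?_)⟩
    · funext x
      rw [Prod.smul_fst, Conf.smul_f, inv_inv]
      exact congrArg Prod.fst (congrFun hσ x)
    · funext x
      rw [Prod.smul_snd, Coloring.smul_a, inv_inv]
      exact congrArg Prod.snd (congrFun hσ x)
  · rintro ⟨σ, rfl⟩
    refine MWord.ext (funext fun i => ?_) rfl
    ext p
    refine (block_apply _ _ _ _).trans (Eq.trans ?_ (block_apply _ _ _ _).symm)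
    refine (Finset.card_equiv σ⁻¹ fun x => ?_).symm
    rw [Finset.mem_filter, Finset.mem_filter]
    simp only [Finset.mem_univ, true_and]
    rfl

/-- The twisted Burnside lemma on pairs (configuration, coloring), with the twist acting on the
configuration only, so that the fixed pairs of each `σ` form a product. -/
theorem sum_card_conf_mul_card_coloring (hm : m.degree = n) (T : Conf n r j ε → Conf n r j ε)
    (T' : MWord r m j ε → MWord r m j ε) (hT : ∀ y a, blockWord (T y, a) = T' (blockWord (y, a))) :
    ∑ σ : Equiv.Perm (Fin n), Nat.card {y : Conf n r j ε // σ • y = T y} *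
      Nat.card {a : Fin n → ℕ+ // a ∘ σ = a ∧ ∑ i, Finsupp.single (a i) 1 = m} =
    n ! * Nat.card {z : MWord r m j ε // T' z = z} := by
  have h := card_smul_eq_twist (G := Equiv.Perm (Fin n)) (blockWord (ε := ε) (m := m) (j := j))
    (blockWord_surjective hm) blockWord_eq_iff (fun u => (T u.1, u.2)) T' fun u => hT u.1 u.2
  rw [Nat.card_eq_fintype_card (α := Equiv.Perm (Fin n)), Fintype.card_perm, Fintype.card_fin] at h
  have hcol : ∀ σ : Equiv.Perm (Fin n),
      Nat.card {a : Fin n → ℕ+ // a ∘ σ = a ∧ ∑ i, Finsupp.single (a i) 1 = m} =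
      Nat.card {a : Coloring n m // σ • a = a} := fun σ => Nat.card_congr
    { toFun := fun a => ⟨⟨a.1, a.2.2⟩, Coloring.ext (funext fun x => by
        rw [Coloring.smul_a]
        have := congrFun a.2.1 (σ.symm x)
        rw [Function.comp_apply, Equiv.apply_symm_apply] at this
        exact this.symm)⟩
      invFun := fun a => ⟨a.1.a, funext fun x => by
        have := congrFun (congrArg Coloring.a a.2) (σ x)
        rw [Coloring.smul_a, show σ⁻¹ (σ x) = x from σ.symm_apply_apply x] at this
        exact this.symm, a.1.content⟩
      left_inv := fun _ => rfl
      right_inv := fun _ => rfl }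
  rw [← h]
  simp only [hcol, ← Nat.card_prod]
  rw [← Nat.card_sigma]
  exact Nat.card_congr
    { toFun := fun p => ⟨(p.1, (p.2.1.1, p.2.2.1)), Prod.ext p.2.1.2 p.2.2.2⟩
      invFun := fun p => ⟨p.1.1, ⟨p.1.2.1, congrArg Prod.fst p.2⟩,
        ⟨p.1.2.2, congrArg Prod.snd p.2⟩⟩
      left_inv := fun p => rfl
      right_inv := fun p => rfl }

end

/-! ### Rotation of the blocks: Frobenius characteristic and restriction of the isotypic component
-/

section

variable {n r j : ℕ} [NeZero r] {m : ℕ+ →₀ ℕ}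

/-- The rotation of the blocks. -/
def rotConf : Equiv.Perm (Conf n r j 0) where
  toFun y := ⟨fun x => y.f x - 1, fun i => y.b (i + 1), fun i => y.pos _, fun i => by
    simpa only [sub_eq_iff_eq_add, Pi.zero_apply] using y.lt (i + 1),
    (Equiv.sum_comp (Equiv.addRight (1 : ZMod r)) y.b).trans y.sum⟩
  invFun y := ⟨fun x => y.f x + 1, fun i => y.b (i - 1), fun i => y.pos _, fun i => by
    simpa only [← eq_sub_iff_add_eq, Pi.zero_apply] using y.lt (i - 1),
    (Equiv.sum_comp (Equiv.subRight (1 : ZMod r)) y.b).trans y.sum⟩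
  left_inv y := Conf.ext (funext fun x => by simp) (funext fun i => by simp)
  right_inv y := Conf.ext (funext fun x => by simp) (funext fun i => by simp)

/-- The rotation of cyclic words. -/
def rotWord (u : MWord r m j 0) : MWord r m j 0 where
  κ i := u.κ (i + 1)
  b i := u.b (i + 1)
  pos _ := u.pos _
  lt i := u.lt (i + 1)
  content := (Equiv.sum_comp (Equiv.addRight (1 : ZMod r)) u.κ).trans u.content
  sum := (Equiv.sum_comp (Equiv.addRight (1 : ZMod r)) u.b).trans u.sum

theorem rotConf_pow_f (k : ℕ) (y : Conf n r j 0) (x : Fin n) :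
    ((rotConf ^ k) y).f x = y.f x - k := by
  induction k generalizing y with
  | zero => simp
  | succ k ih =>
    rw [pow_succ, Equiv.Perm.mul_apply, ih]
    change y.f x - 1 - k = _
    push_cast; ring

theorem rotConf_pow_b (k : ℕ) (y : Conf n r j 0) (i : ZMod r) :
    ((rotConf ^ k) y).b i = y.b (i + k) := by
  induction k generalizing y with
  | zero => simp
  | succ k ih =>
    rw [pow_succ, Equiv.Perm.mul_apply, ih]
    change y.b (i + k + 1) = _
    push_cast; rw [add_assoc]

theorem rotConf_pow_eq_one : (rotConf : Equiv.Perm (Conf n r j 0)) ^ r = 1 := by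
  ext1 y
  refine Conf.ext (funext fun x => ?_) (funext fun i => ?_)
  · rw [rotConf_pow_f]; simp
  · rw [rotConf_pow_b]; simp

theorem rotWord_iterate_κ (k : ℕ) (u : MWord r m j 0) (i : ZMod r) :
    (rotWord^[k] u).κ i = u.κ (i + k) := by
  induction k generalizing u with
  | zero => simp
  | succ k ih =>
    rw [Function.iterate_succ_apply, ih]
    change u.κ (i + k + 1) = _
    push_cast; rw [add_assoc]

theorem rotWord_iterate_b (k : ℕ) (u : MWord r m j 0) (i : ZMod r) :
    (rotWord^[k] u).b i = u.b (i + k) := by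
  induction k generalizing u with
  | zero => simp
  | succ k ih =>
    rw [Function.iterate_succ_apply, ih]
    change u.b (i + k + 1) = _
    push_cast; rw [add_assoc]

theorem rotWord_iterate_eq (u : MWord r m j 0) : rotWord^[r] u = u := by
  refine MWord.ext (funext fun x => ?_) (funext fun i => ?_)
  · rw [rotWord_iterate_κ]; simp
  · rw [rotWord_iterate_b]; simp

theorem blockWord_rotConf_pow (k : ℕ) (y : Conf n r j 0) (a : Coloring n m) :
    blockWord ((rotConf ^ k) y, a) = rotWord^[k] (blockWord (y, a)) := by
  refine MWord.ext (funext fun i => ?_) (funext fun i => ?_)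
  · rw [rotWord_iterate_κ]
    simp only [blockWord, rotConf_pow_f, sub_eq_iff_eq_add]
  · rw [rotWord_iterate_b]
    simp only [blockWord, rotConf_pow_b]

instance : Finite (MWord r m j 0) :=
  Finite.of_surjective _ (blockWord_surjective (n := m.degree) (ε := 0) (j := j) rfl)

theorem rotConf_smul (σ : Equiv.Perm (Fin n)) (y : Conf n r j 0) :
    rotConf (σ • y) = σ • rotConf y := rfl

theorem coeff_frobeniusChar_eq_zero (V : VirtualRep (Equiv.Perm (Fin n))) (hm : m.degree ≠ n) :
    MvPowerSeries.coeff m (frobeniusChar V) = 0 := by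
  rw [coeff_frobeniusChar]
  have : ∀ σ : Equiv.Perm (Fin n), IsEmpty {a : Fin n → ℕ+ // a ∘ σ = a ∧
      ∑ i, Finsupp.single (a i) 1 = m} := fun σ => ⟨fun a => hm (by
    rw [← a.2.2, map_sum]; simp)⟩
  simp

/-- For each power of the rotation the average over the group counts the words fixed by that power;
the sum over powers of `ω` then keeps only the words of exact period `r`. -/
theorem coeff_frobeniusChar_isotypic (hm : m.degree = n) {ω : ℂ} (hω : IsPrimitiveRoot ω r)
    {V : VirtualRep (Equiv.Perm (Fin n))} (hV : ∀ σ, V.character σ = (r : ℂ)⁻¹ *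
      ∑ k ∈ Finset.range r, ω ^ k * Nat.card {y : Conf n r j 0 // σ • y = (rotConf ^ k) y}) :
    MvPowerSeries.coeff m (frobeniusChar V) = (r : ℂ)⁻¹ *
      Nat.card {z : MWord r m j 0 // Function.minimalPeriod rotWord z = r} := by
  have key : ∀ k, ∑ σ : Equiv.Perm (Fin n),
      (Nat.card {y : Conf n r j 0 // σ • y = (rotConf ^ k) y} : ℂ) *
      Nat.card {a : Fin n → ℕ+ // a ∘ σ = a ∧ ∑ i, Finsupp.single (a i) 1 = m} =
      n ! * Nat.card {z : MWord r m j 0 // rotWord^[k] z = z} := by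
    intro k
    have := sum_card_conf_mul_card_coloring hm (fun y : Conf n r j 0 => (rotConf ^ k) y)
      (fun z : MWord r m j 0 => rotWord^[k] z) fun y a => blockWord_rotConf_pow k y a
    exact_mod_cast this
  rw [← sum_pow_mul_card_isPeriodicPt rotWord (NeZero.pos r) rotWord_iterate_eq hω,
    coeff_frobeniusChar]
  simp only [hV, mul_assoc, Finset.sum_mul]
  rw [← Finset.mul_sum, Finset.sum_comm, mul_left_comm]
  congr 1
  rw [Finset.mul_sum]
  refine Finset.sum_congr rfl fun k _ => ?_
  rw [← Finset.mul_sum, key, mul_left_comm, inv_mul_cancel_left₀]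
  exact_mod_cast Nat.factorial_ne_zero n

theorem coeff_frobeniusChar_permutation {ε : ZMod r → ℕ} (hm : m.degree = n) :
    MvPowerSeries.coeff m (frobeniusChar
      (VirtualRep.permutation (Equiv.Perm (Fin n)) (Conf n r j ε))) = Nat.card (MWord r m j ε) := by
  have key := sum_card_conf_mul_card_coloring hm (fun y : Conf n r j ε => y)
    (fun z : MWord r m j ε => z) fun y a => rfl
  have h2 : Nat.card {z : MWord r m j ε // z = z} = Nat.card (MWord r m j ε) :=
    Nat.card_congr (Equiv.subtypeUnivEquiv fun _ => rfl)
  rw [h2] at key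
  rw [coeff_frobeniusChar]
  simp only [VirtualRep.character_permutation]
  have key' : ∑ σ : Equiv.Perm (Fin n), (Nat.card {y : Conf n r j ε // σ • y = y} : ℂ) *
      Nat.card {a : Fin n → ℕ+ // a ∘ σ = a ∧ ∑ i, Finsupp.single (a i) 1 = m} =
      n ! * Nat.card (MWord r m j ε) := by exact_mod_cast key
  rw [key', inv_mul_cancel_left₀]
  exact_mod_cast Nat.factorial_ne_zero n

section Restriction

theorem permEmbedding_castSucc (σ : Equiv.Perm (Fin n)) (i : Fin n) :
    permEmbedding (n + 1) σ i.castSucc = (σ i).castSucc :=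
  Equiv.Perm.viaEmbedding_apply σ _ i

theorem permEmbedding_last (σ : Equiv.Perm (Fin n)) :
    permEmbedding (n + 1) σ (Fin.last n) = Fin.last n := by
  refine Equiv.Perm.viaEmbedding_apply_of_notMem σ _ _ ?_
  rintro ⟨i, hi⟩
  exact (Fin.castSucc_lt_last i).ne hi

/-- Add a last point to the block `0` and rotate the blocks. -/
def extendConf (p : ZMod r × Conf n r j (Pi.single 0 1)) : Conf (n + 1) r j 0 where
  f := Fin.snoc (α := fun _ => ZMod r) (fun x => p.2.f x + p.1) p.1
  b i := p.2.b (i - p.1)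
  pos i := p.2.pos _
  lt i := by
    -- The enlargement by one of block `0` is the added point, which lies in block `p.1` after the
    -- rotation.
    refine lt_of_lt_of_eq (p.2.lt (i - p.1)) ?_
    rw [Finset.card_filter, Finset.card_filter, Fin.sum_univ_castSucc]
    simp only [Fin.snoc_castSucc, Fin.snoc_last, Pi.zero_apply, add_zero, eq_sub_iff_add_eq,
      Pi.single_apply, sub_eq_zero]
    simp only [eq_comm]
  sum := (Equiv.sum_comp (Equiv.subRight p.1) p.2.b).trans p.2.sum

/-- The rotation is recovered as the block of the last point; undoing it recovers the rest. -/
theorem extendConf_bijective :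
    Function.Bijective (extendConf : _ × Conf n r j (Pi.single 0 1) → _) := by
  constructor
  · rintro ⟨c, x⟩ ⟨d, y⟩ h
    have h0 : c = d := by
      have := congrFun (congrArg Conf.f h) (Fin.last n)
      simpa [extendConf] using this
    subst h0
    refine Prod.ext rfl (Conf.ext (funext fun i => ?_) (funext fun i => ?_))
    · have := congrFun (congrArg Conf.f h) i.castSucc
      simpa [extendConf] using this
    · have := congrFun (congrArg Conf.b h) (i + c)
      simpa [extendConf] using this
  · intro y
    refine ⟨⟨y.f (Fin.last n), ⟨fun x => y.f x.castSucc - y.f (Fin.last n),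
      fun i => y.b (i + y.f (Fin.last n)), fun i => y.pos _, fun i => ?_,
      (Equiv.sum_comp (Equiv.addRight _) y.b).trans y.sum⟩⟩, ?_⟩
    · refine lt_of_lt_of_eq (y.lt (i + y.f (Fin.last n))) ?_
      rw [Finset.card_filter, Finset.card_filter, Fin.sum_univ_castSucc]
      simp only [Pi.zero_apply, add_zero, sub_eq_iff_eq_add, Pi.single_apply]
      simp
    · refine Conf.ext (funext fun x => ?_) (funext fun i => ?_)
      · induction x using Fin.lastCases with
        | last => simp [extendConf]
        | cast x => simp [extendConf]
      · simp [extendConf]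

theorem permEmbedding_smul_extendConf (σ : Equiv.Perm (Fin n))
    (p : ZMod r × Conf n r j (Pi.single 0 1)) :
    permEmbedding (n + 1) σ • extendConf p = extendConf (p.1, σ • p.2) := by
  refine Conf.ext (funext fun x => ?_) rfl
  rw [Conf.smul_f, ← map_inv]
  induction x using Fin.lastCases with
  | last =>
    have h : permEmbedding (n + 1) σ⁻¹ (Fin.last n) = Fin.last n := permEmbedding_last σ⁻¹
    refine (congrArg _ h).trans ?_
    simp [extendConf]
  | cast x =>
    have h : permEmbedding (n + 1) σ⁻¹ x.castSucc = (σ⁻¹ x).castSucc := permEmbedding_castSucc σ⁻¹ x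
    refine (congrArg _ h).trans ?_
    simp [extendConf, Conf.smul_f]

theorem card_permEmbedding_smul_eq (σ : Equiv.Perm (Fin n)) :
    Nat.card {y : Conf (n + 1) r j 0 // permEmbedding (n + 1) σ • y = y} =
      r * Nat.card {x : Conf n r j (Pi.single 0 1) // σ • x = x} := by
  have hr : r * Nat.card {x : Conf n r j (Pi.single 0 1) // σ • x = x} =
      Nat.card (ZMod r × {x : Conf n r j (Pi.single 0 1) // σ • x = x}) := by
    rw [Nat.card_prod, Nat.card_zmod]
  rw [hr]
  refine (Nat.card_congr (Equiv.ofBijective (fun p => ⟨extendConf (p.1, p.2.1),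
    (permEmbedding_smul_extendConf σ (p.1, p.2.1)).trans
      (congrArg extendConf (Prod.ext rfl p.2.2))⟩) ⟨?_, ?_⟩)).symm
  · intro p q h
    have := Prod.mk.inj (extendConf_bijective.1 (Subtype.mk.inj h))
    exact Prod.ext this.1 (Subtype.ext this.2)
  · rintro ⟨y, hy⟩
    obtain ⟨p, rfl⟩ := extendConf_bijective.2 y
    have h := (permEmbedding_smul_extendConf σ p).symm.trans hy
    exact ⟨⟨p.1, p.2, congrArg Prod.snd (extendConf_bijective.1 h)⟩, rfl⟩

/-- For `0 < k < r` the rotation moves the block of the last point, which the embedded permutation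
fixes, so only `k = 0` survives. There the `r` possible blocks of the last point cancel the factor
`1/r`. -/
theorem character_permEmbedding {ω : ℂ} {V : VirtualRep (Equiv.Perm (Fin (n + 1)))}
    (hV : ∀ σ, V.character σ = (r : ℂ)⁻¹ * ∑ k ∈ Finset.range r, ω ^ k *
      Nat.card {y : Conf (n + 1) r j 0 // σ • y = (rotConf ^ k) y}) (σ : Equiv.Perm (Fin n)) :
    V.character (permEmbedding (n + 1) σ) =
      Nat.card {x : Conf n r j (Pi.single 0 1) // σ • x = x} := by
  rw [hV, Finset.sum_eq_single 0]
  · have h := card_permEmbedding_smul_eq (r := r) (j := j) σ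
    simp only [pow_zero, one_mul, Equiv.Perm.coe_one, id_eq]
    rw [h]
    push_cast
    rw [inv_mul_cancel_left₀]
    exact_mod_cast NeZero.ne r
  · intro k hk hk0
    have : IsEmpty {y : Conf (n + 1) r j 0 // permEmbedding (n + 1) σ • y = (rotConf ^ k) y} := by
      refine ⟨fun ⟨y, hy⟩ => ?_⟩
      have h1 := congrFun (congrArg Conf.f hy) (Fin.last n)
      have h : permEmbedding (n + 1) σ⁻¹ (Fin.last n) = Fin.last n := permEmbedding_last σ⁻¹
      rw [rotConf_pow_f, Conf.smul_f, ← map_inv] at h1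
      have h2 := (congrArg y.f h).symm.trans h1
      have h3 : (k : ZMod r) = 0 := sub_eq_self.1 h2.symm
      rw [ZMod.natCast_eq_zero_iff] at h3
      exact hk0 (Nat.eq_zero_of_dvd_of_lt h3 (Finset.mem_range.1 hk))
    simp
  · intro h
    exact absurd (Finset.mem_range.2 (NeZero.pos r)) h

end Restriction

/-- The isotypic component of the rotation action for a primitive root of unity. -/
theorem exists_isotypic (n r j : ℕ) [NeZero r] :
    ∃ V : VirtualRep (Equiv.Perm (Fin (n + 1))),
      (∀ m : ℕ+ →₀ ℕ, m.degree = n + 1 → MvPowerSeries.coeff m (frobeniusChar V) = (r : ℂ)⁻¹ *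
        Nat.card {z : MWord r m j 0 // Function.minimalPeriod rotWord z = r}) ∧
      ∀ σ : Equiv.Perm (Fin n), V.character (permEmbedding (n + 1) σ) =
        Nat.card {x : Conf n r j (Pi.single 0 1) // σ • x = x} := by
  have hω := Complex.isPrimitiveRoot_exp r (NeZero.ne r)
  obtain ⟨V, hV⟩ := VirtualRep.exists_character_eq_isotypic
    (rotConf : Equiv.Perm (Conf (n + 1) r j 0)) _ rotConf_smul (NeZero.ne r) rotConf_pow_eq_one
    hω.pow_eq_one
  exact ⟨V, fun m hm => coeff_frobeniusChar_isotypic hm hω hV, character_permEmbedding hV⟩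

end

/-! ### Pairs of permutations and colorings as shift-invariant multisets of words -/

section

/-- Letters, ordered by decreasing absolute value, barred letters (second entry `false`) first. -/
abbrev Letter : Type := ℕ+ᵒᵈ ×ₗ Bool

namespace Letter

/-- The absolute value of a letter. -/
def ab (l : Letter) : ℕ+ := OrderDual.ofDual (ofLex l).1

/-- Whether a letter is unbarred. -/
def plain (l : Letter) : Bool := (ofLex l).2

theorem ext {l l' : Letter} (h1 : l.ab = l'.ab) (h2 : l.plain = l'.plain) : l = l' :=
  ofLex.injective (Prod.ext h1 h2)

theorem lt_iff {l l' : Letter} :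
    l < l' ↔ l'.ab < l.ab ∨ l.ab = l'.ab ∧ l.plain = false ∧ l'.plain = true := by
  rw [Prod.Lex.lt_iff, Bool.lt_iff]
  rfl

/-- The letters that may follow a given letter. -/
def Allowed (l l' : Letter) : Prop := if l.plain then l.ab ≤ l'.ab else l'.ab ≤ l.ab

theorem lt_of_allowed {l l' : Letter} (h : l.Allowed l') (hl : l.plain = false) (hne : l ≠ l') :
    l < l' := by
  rw [lt_iff]
  simp only [Allowed, hl, Bool.false_eq_true, if_false] at h
  rcases h.lt_or_eq with h | h
  · exact Or.inl h
  · refine Or.inr ⟨h.symm, hl, ?_⟩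
    by_contra hc
    exact hne (ext h.symm (by rw [hl, Bool.eq_false_of_not_eq_true hc]))

theorem gt_of_allowed {l l' : Letter} (h : l.Allowed l') (hl : l.plain = true) (hne : l ≠ l') :
    l' < l := by
  rw [lt_iff]
  simp only [Allowed, hl, if_true] at h
  rcases h.lt_or_eq with h | h
  · exact Or.inl h
  · refine Or.inr ⟨h.symm, ?_, hl⟩
    by_contra hc
    exact hne (ext h (by rw [hl, Bool.eq_true_of_not_eq_false hc]))

end Letter

/-- The infinite words in which barred letters are followed by letters that are not larger and
unbarred letters by letters that are not smaller in absolute value, with infinitely many unbarred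
letters. -/
abbrev BWord : Type :=
  {w : Lex (ℕ → Letter) // (∀ k, (ofLex w k).Allowed (ofLex w (k + 1))) ∧
    ∀ N, ∃ k, N ≤ k ∧ (ofLex w k).plain = true}

namespace BWord

/-- The `k`-th letter. -/
def get (v : BWord) (k : ℕ) : Letter := ofLex v.1 k

theorem ext {v v' : BWord} (h : ∀ k, v.get k = v'.get k) : v = v' :=
  Subtype.ext (ofLex.injective (funext h))

theorem lt_iff {v v' : BWord} :
    v < v' ↔ ∃ k, (∀ i < k, v.get i = v'.get i) ∧ v.get k < v'.get k := Iff.rfl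

/-- Removal of the first letter. -/
def shift (v : BWord) : BWord :=
  ⟨toLex fun k => v.get (k + 1), fun k => v.2.1 (k + 1), fun N => by
    obtain ⟨k, hk, h⟩ := v.2.2 (N + 1)
    obtain ⟨k, rfl⟩ := Nat.exists_eq_add_of_le' (show 1 ≤ k by omega)
    exact ⟨k, by omega, h⟩⟩

theorem get_shift (v : BWord) (k : ℕ) : v.shift.get k = v.get (k + 1) := rfl

theorem get_iterate_shift (v : BWord) (i k : ℕ) : (shift^[i] v).get k = v.get (k + i) := by
  induction i generalizing v with
  | zero => rfl
  | succ i ih => rw [Function.iterate_succ_apply, ih, get_shift]; rfl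

theorem exists_first_ne {v : BWord} (h : v.shift ≠ v) :
    ∃ k, (∀ i ≤ k, v.get i = v.get 0) ∧ v.get k ≠ v.get (k + 1) := by
  classical
  have hex : ∃ k, v.get k ≠ v.get (k + 1) := by
    by_contra hc
    push Not at hc
    exact h (ext fun k => (hc k).symm)
  refine ⟨Nat.find hex, ?_, Nat.find_spec hex⟩
  intro i hi
  induction i with
  | zero => rfl
  | succ i ih =>
    rw [← ih (by omega)]
    exact (not_ne_iff.1 (Nat.find_min hex (show i < Nat.find hex by omega))).symm

/-- A word and its shift are compared at the first change of letter. Until then the letter is the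
barred first one, so the letter that follows is larger in the order on letters. A change exists
because the word has unbarred letters. -/
theorem lt_shift {v : BWord} (h : (v.get 0).plain = false) : v < v.shift := by
  have hne : v.shift ≠ v := by
    intro hs
    have hc : ∀ k, v.get k = v.get 0 := by
      intro k
      induction k with
      | zero => rfl
      | succ k ih => rw [← get_shift, hs, ih]
    obtain ⟨k, _, hk⟩ := v.2.2 0
    have : (v.get k).plain = true := hk
    rw [hc, h] at this
    exact Bool.false_ne_true this
  obtain ⟨k, hk, hk'⟩ := exists_first_ne hne
  refine lt_iff.2 ⟨k, fun i hi => ?_, ?_⟩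
  · rw [get_shift, hk i hi.le, hk (i + 1) hi]
  · exact Letter.lt_of_allowed (v.2.1 k) (by rw [← h, ← hk k le_rfl]) hk'

/-- As for a barred first letter with the order reversed, except that the word may be constant,
hence only a weak inequality. -/
theorem shift_le {v : BWord} (h : (v.get 0).plain = true) : v.shift ≤ v := by
  by_cases hs : v.shift = v
  · exact hs.le
  obtain ⟨k, hk, hk'⟩ := exists_first_ne hs
  refine (lt_iff.2 ⟨k, fun i hi => ?_, ?_⟩).le
  · rw [get_shift, hk i hi.le, hk (i + 1) hi]
  · exact Letter.gt_of_allowed (v.2.1 k) (by rw [← h, ← hk k le_rfl]) hk'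

theorem get_zero_le {v v' : BWord} (h : v ≤ v') : v.get 0 ≤ v'.get 0 := by
  rcases h.lt_or_eq with h | rfl
  · obtain ⟨k, hk, hk'⟩ := lt_iff.1 h
    rcases Nat.eq_zero_or_pos k with rfl | hk0
    · exact hk'.le
    · exact (hk 0 hk0).le
  · exact le_rfl

theorem shift_le_shift {v v' : BWord} (h : v ≤ v') (h0 : v.get 0 = v'.get 0) :
    v.shift ≤ v'.shift := by
  rcases h.lt_or_eq with h | rfl
  · obtain ⟨k, hk, hk'⟩ := lt_iff.1 h
    rcases k with _ | k
    · exact absurd h0 hk'.ne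
    · exact (lt_iff.2 ⟨k, fun i hi => hk (i + 1) (by omega), hk'⟩).le
  · exact le_rfl

end BWord

section Words

variable {n : ℕ}

/-- The colorings that the fundamental quasisymmetric function of `exd σ` counts. -/
def Compatible (σ : Equiv.Perm (Fin n)) (a : Fin n → ℕ+) : Prop :=
  Antitone a ∧ ∀ (k : ℕ) (hk : k + 1 < n), k ∈ exd σ →
    a ⟨k + 1, hk⟩ < a ⟨k, Nat.lt_of_succ_lt hk⟩

/-- The color of a point, barred at excedances. -/
def letter (σ : Equiv.Perm (Fin n)) (a : Fin n → ℕ+) (i : Fin n) : Letter :=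
  toLex (OrderDual.toDual (a i), decide (¬ i < σ i))

theorem letter_plain {σ : Equiv.Perm (Fin n)} {a : Fin n → ℕ+} {i : Fin n} :
    (letter σ a i).plain = true ↔ σ i ≤ i := by
  change decide (¬ i < σ i) = true ↔ _
  rw [decide_eq_true_iff, not_lt]

theorem letter_not_plain {σ : Equiv.Perm (Fin n)} {a : Fin n → ℕ+} {i : Fin n} :
    (letter σ a i).plain = false ↔ i < σ i := by
  rw [← Bool.not_eq_true, letter_plain, not_le]

theorem barWord_injective (σ : Equiv.Perm (Fin n)) : Function.Injective (barWord σ) :=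
  fun _ _ h => σ.injective (congrArg (fun x => (ofLex x).2) h)

/-- Within a run of equal colors the word `σ̄` has to increase, and it is ordered first by bars and
then by values. So compatibility says that the letters (color, bar) increase weakly and that ties
are broken by `σ`. -/
theorem compatible_iff (σ : Equiv.Perm (Fin n)) (a : Fin n → ℕ+) :
    Compatible σ a ↔ ∀ i i', i < i' → letter σ a i < letter σ a i' ∨
      letter σ a i = letter σ a i' ∧ σ i < σ i' := by
  have hbar : ∀ i i', a i = a i' → (barWord σ i < barWord σ i' ↔ letter σ a i < letter σ a i' ∨
      letter σ a i = letter σ a i' ∧ σ i < σ i') := by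
    intro i i' h
    rw [Prod.Lex.lt_iff, Prod.Lex.lt_iff]
    simp only [letter, ofLex_toLex, barWord, h, lt_irrefl, true_and, false_or,
      EmbeddingLike.apply_eq_iff_eq, Prod.mk.injEq]
  constructor
  · rintro ⟨hanti, hexd⟩ i i' hlt
    -- A descent of `σ̄` inside a run of equal colors would force a strict drop of color, so `σ̄` is
    -- monotone along the run.
    have hle : ∀ (d k : ℕ) (hk : k + d < n), a ⟨k + d, hk⟩ = a ⟨k, by omega⟩ →
        barWord σ ⟨k, by omega⟩ ≤ barWord σ ⟨k + d, hk⟩ := by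
      intro d
      induction d with
      | zero => intro k hk _; exact le_rfl
      | succ d ih =>
        intro k hk heq
        have h1 : a ⟨k + d, by omega⟩ ≤ a ⟨k, by omega⟩ := hanti (Fin.mk_le_mk.2 (by omega))
        have h2 : a ⟨k + (d + 1), hk⟩ ≤ a ⟨k + d, by omega⟩ := hanti (Fin.mk_le_mk.2 (by omega))
        refine (ih k (by omega) (le_antisymm h1 (heq ▸ h2))).trans ?_
        by_contra hc
        have := hexd (k + d) hk ⟨hk, not_le.1 hc⟩
        exact absurd (this.trans_le h1) (heq ▸ lt_irrefl _)
    rcases (hanti hlt.le).lt_or_eq with h | h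
    · exact Or.inl (Letter.lt_iff.2 (Or.inl h))
    · rw [← hbar _ _ h.symm]
      refine lt_of_le_of_ne ?_ fun hc => hlt.ne (barWord_injective σ hc)
      obtain ⟨d, hd⟩ := Nat.exists_eq_add_of_le (Fin.le_def.1 hlt.le)
      have hi' : i' = ⟨i + d, hd ▸ i'.2⟩ := Fin.ext hd
      rw [hi'] at h ⊢
      exact hle d i _ h
  · intro h
    have hanti : Antitone a := by
      intro i i' hle
      rcases hle.lt_or_eq with hlt | rfl
      · rcases h i i' hlt with h1 | h1
        · rcases Letter.lt_iff.1 h1 with h2 | h2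
          · exact h2.le
          · exact h2.1.ge
        · exact (congrArg Letter.ab h1.1).ge
      · exact le_rfl
    refine ⟨hanti, fun k hk hkd => ?_⟩
    have hlt : (⟨k, Nat.lt_of_succ_lt hk⟩ : Fin n) < ⟨k + 1, hk⟩ := Fin.mk_lt_mk.2 (by omega)
    refine lt_of_le_of_ne (hanti hlt.le) fun hc => ?_
    obtain ⟨_, hb⟩ := hkd
    exact lt_asymm hb ((hbar _ _ hc.symm).2 (h _ _ hlt))

theorem not_forall_pow_lt (σ : Equiv.Perm (Fin n)) (i : Fin n) :
    ¬ ∀ t : ℕ, (σ ^ t) i < (σ ^ (t + 1)) i := fun h =>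
  not_injective_infinite_finite _ (strictMono_nat_of_lt_succ h).injective

/-- The word of the letters along the cycle of a point. -/
def cycleWord {σ : Equiv.Perm (Fin n)} {a : Fin n → ℕ+} (h : Compatible σ a) (i : Fin n) : BWord :=
  ⟨toLex fun k => letter σ a ((σ ^ k) i), fun k => by
    change (letter σ a ((σ ^ k) i)).Allowed (letter σ a ((σ ^ (k + 1)) i))
    rw [pow_succ', Equiv.Perm.mul_apply]
    unfold Letter.Allowed
    split_ifs with hp
    · exact h.1 (letter_plain.1 hp)
    · exact h.1 (letter_not_plain.1 (Bool.eq_false_of_not_eq_true hp)).le, fun N => by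
    by_contra hc
    push Not at hc
    refine not_forall_pow_lt σ ((σ ^ N) i) fun t => ?_
    have := letter_not_plain.1 (Bool.eq_false_of_not_eq_true (hc (t + N) (Nat.le_add_left _ _)))
    rw [pow_succ', Equiv.Perm.mul_apply, ← Equiv.Perm.mul_apply (σ ^ t), ← pow_add]
    exact this⟩

variable {σ : Equiv.Perm (Fin n)} {a : Fin n → ℕ+}

theorem get_cycleWord (h : Compatible σ a) (i : Fin n) (k : ℕ) :
    (cycleWord h i).get k = letter σ a ((σ ^ k) i) := rfl

theorem shift_cycleWord (h : Compatible σ a) (i : Fin n) :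
    (cycleWord h i).shift = cycleWord h (σ i) :=
  BWord.ext fun k => by
    rw [BWord.get_shift, get_cycleWord, get_cycleWord, pow_succ, Equiv.Perm.mul_apply]

theorem iterate_shift_cycleWord (h : Compatible σ a) (i : Fin n) (k : ℕ) :
    BWord.shift^[k] (cycleWord h i) = cycleWord h ((σ ^ k) i) := by
  induction k generalizing i with
  | zero => rfl
  | succ k ih =>
    rw [Function.iterate_succ_apply, shift_cycleWord, ih, pow_succ, Equiv.Perm.mul_apply]

/-- Equal letters at `i < i'` force `σ i < σ i'`, so the order of two points is preserved along
their cycles for as long as the letters agree. -/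
theorem pow_lt_pow_of_letter_eq (h : Compatible σ a) {i i' : Fin n} (hlt : i < i') (k : ℕ)
    (heq : ∀ t < k, letter σ a ((σ ^ t) i) = letter σ a ((σ ^ t) i')) :
    (σ ^ k) i < (σ ^ k) i' := by
  induction k with
  | zero => exact hlt
  | succ k ih =>
    rw [pow_succ', Equiv.Perm.mul_apply, Equiv.Perm.mul_apply]
    rcases (compatible_iff σ a).1 h _ _ (ih fun t ht => heq t (by omega)) with h1 | h1
    · exact absurd (heq k (by omega)) h1.ne
    · exact h1.2

theorem cycleWord_monotone (h : Compatible σ a) : Monotone (cycleWord h) := by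
  intro i i' hle
  by_contra hc
  obtain ⟨k, hk, hk'⟩ := BWord.lt_iff.1 (not_le.1 hc)
  have hlt : i < i' := lt_of_le_of_ne hle fun he => hc (he ▸ le_rfl)
  rcases (compatible_iff σ a).1 h _ _
    (pow_lt_pow_of_letter_eq h hlt k fun t ht => (hk t ht).symm) with h1 | h1
  · exact lt_asymm h1 hk'
  · exact hk'.ne h1.1.symm

/-- The points are listed in increasing order of their words, and `σ` moves a point to one whose
word is the shift. Hence `σ⁻¹` sorts the shifted words, stably because ties are broken by `σ`; the
list of words alone determines `σ`. -/
theorem symm_eq_sort (h : Compatible σ a) :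
    σ.symm = Tuple.sort (fun i => (cycleWord h i).shift) := by
  rw [Tuple.eq_sort_iff]
  have hs : ∀ i, (cycleWord h (σ.symm i)).shift = cycleWord h i := fun i => by
    rw [shift_cycleWord, Equiv.apply_symm_apply]
  constructor
  · intro i j hij
    simp only [Function.comp_apply, hs]
    exact cycleWord_monotone h hij
  · intro i j hij heq
    rw [hs, hs] at heq
    -- Equality of the shifted words implies equality of the words, because `σ⁻¹` is a power of `σ`.
    have hword : cycleWord h (σ.symm i) = cycleWord h (σ.symm j) := by
      have hord := orderOf_pos σ
      have hp : ∀ i, σ.symm i = (σ ^ (orderOf σ - 1)) i := by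
        intro i
        rw [Equiv.symm_apply_eq, ← Equiv.Perm.mul_apply, ← pow_succ', Nat.sub_add_cancel hord,
          pow_orderOf_eq_one, Equiv.Perm.one_apply]
      rw [hp, hp, ← iterate_shift_cycleWord, ← iterate_shift_cycleWord, heq]
    rcases lt_trichotomy (σ.symm i) (σ.symm j) with h1 | h1 | h1
    · exact h1
    · exact absurd (σ.symm.injective h1) hij.ne
    · rcases (compatible_iff σ a).1 h _ _ h1 with h2 | h2
      · have : letter σ a (σ.symm j) = letter σ a (σ.symm i) :=
          congrArg (fun v => BWord.get v 0) hword.symm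
        exact absurd this h2.ne
      · have := h2.2
        rw [Equiv.apply_symm_apply, Equiv.apply_symm_apply] at this
        exact absurd hij this.not_gt

theorem exists_perm_of_map_eq {P : Type} {f g : Fin n → P}
    (h : Finset.univ.val.map f = Finset.univ.val.map g) :
    ∃ τ : Equiv.Perm (Fin n), f ∘ τ = g := by
  classical
  refine exists_perm_comp_eq fun p => ?_
  have := congrArg (Multiset.count p) h
  rw [Multiset.count_map, Multiset.count_map] at this
  rw [Finset.card_def, Finset.card_def, Finset.filter_val, Finset.filter_val]
  simpa only [eq_comm] using this

theorem eq_of_monotone_of_map_eq {P : Type} [LinearOrder P] {f g : Fin n → P} (hf : Monotone f)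
    (hg : Monotone g) (h : Finset.univ.val.map f = Finset.univ.val.map g) : f = g := by
  obtain ⟨τ, hτ⟩ := exists_perm_of_map_eq h
  have := Tuple.unique_monotone (f := f) (σ := 1) (τ := τ) hf (hτ ▸ hg)
  rw [hτ] at this
  exact this

/-- The multiset of all cycle words. -/
def cycleWords (p : {p : Equiv.Perm (Fin n) × (Fin n → ℕ+) // Compatible p.1 p.2}) :
    Multiset BWord := Finset.univ.val.map (cycleWord p.2)

/-- Monotonicity turns the multiset back into the list of words. The permutation comes from sorting
the shifts and the coloring from the first letters. -/
theorem cycleWords_injective : Function.Injective (cycleWords (n := n)) := by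
  rintro ⟨⟨σ, a⟩, h⟩ ⟨⟨τ, b⟩, h'⟩ heq
  have hw : cycleWord h = cycleWord h' :=
    eq_of_monotone_of_map_eq (cycleWord_monotone h) (cycleWord_monotone h') heq
  have h1 : σ = τ := by
    apply Equiv.symm_bijective.injective
    rw [symm_eq_sort h, symm_eq_sort h', hw]
  have h2 : a = b := funext fun i =>
    congrArg (fun v => Letter.ab (BWord.get v 0)) (congrFun hw i)
  subst h1 h2
  rfl

theorem map_shift_cycleWords (p : {p : Equiv.Perm (Fin n) × (Fin n → ℕ+) // Compatible p.1 p.2}) :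
    (cycleWords p).map BWord.shift = cycleWords p := by
  rw [cycleWords, Multiset.map_map]
  have : BWord.shift ∘ cycleWord p.2 = cycleWord p.2 ∘ p.1.1 :=
    funext fun i => shift_cycleWord p.2 i
  rw [this, ← Multiset.map_map]
  congr 1
  exact Multiset.map_univ_val_equiv p.1.1

/-- The construction inverse to reading cycles: list `M` in increasing order as `w` and let `σ` be
the inverse of the stable sort of the shifted words. Then `w (σ i)` is the shift of `w i`. The
comparison of a word with its shift shows that bars sit exactly at excedances, and stability breaks
the ties as compatibility requires. -/
theorem exists_cycleWords_eq {M : Multiset BWord} (hn : Multiset.card M = n)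
    (hM : M.map BWord.shift = M) : ∃ p, cycleWords (n := n) p = M := by
  obtain ⟨w₀, hw₀⟩ := exists_map_univ_eq M hn
  set w := w₀ ∘ Tuple.sort w₀ with hwdef
  have hmono : Monotone w := Tuple.monotone_sort w₀
  have hwM : Finset.univ.val.map w = M := by
    rw [hwdef, ← Multiset.map_map, ← hw₀]
    congr 1
    exact Multiset.map_univ_val_equiv _
  obtain ⟨ρ, hρ⟩ := exists_perm_of_map_eq (f := BWord.shift ∘ w) (g := w)
    (by rw [← Multiset.map_map, hwM, hM])
  set τ := Tuple.sort (BWord.shift ∘ w) with hτ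
  -- Sorting the shifted words gives back `w`: both are monotone arrangements of the invariant
  -- multiset `M`.
  have hτw : (BWord.shift ∘ w) ∘ τ = w := by
    rw [Tuple.unique_monotone (Tuple.monotone_sort _) (σ := τ) (τ := ρ) (by rw [hρ]; exact hmono),
      hρ]
  set σ : Equiv.Perm (Fin n) := τ.symm with hσ
  have hσw : ∀ i, w (σ i) = (w i).shift := by
    intro i
    rw [← congrFun hτw (σ i)]
    simp [hσ]
  have hstable : ∀ p q, p < q → (w p).shift = (w q).shift → σ p < σ q := by
    intro p q hpq heq
    by_contra hc
    have hlt : σ q < σ p := lt_of_le_of_ne (not_lt.1 hc) fun h => hpq.ne (σ.injective h).symm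
    have := (Tuple.eq_sort_iff.1 hτ).2 _ _ hlt (by simpa [hσ] using heq.symm)
    simp only [hσ, Equiv.apply_symm_apply] at this
    exact lt_asymm this hpq
  have hletter : ∀ i, letter σ (fun i => ((w i).get 0).ab) i = (w i).get 0 := by
    intro i
    refine Letter.ext rfl ?_
    rcases hp : ((w i).get 0).plain
    · rw [letter_not_plain]
      have := BWord.lt_shift hp
      rw [← hσw] at this
      exact hmono.reflect_lt this
    · rw [letter_plain]
      have hle := BWord.shift_le hp
      rw [← hσw] at hle
      rcases hle.lt_or_eq with hlt | heq
      · exact (hmono.reflect_lt hlt).le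
      -- Here the word equals its shift. If `i < σ i`, stability would propagate the inequality to
      -- `σ i < σ² i` and so on, which is impossible in a finite set.
      · by_contra hc
        refine not_forall_pow_lt σ i fun t => ?_
        have key : (σ ^ t) i < (σ ^ (t + 1)) i ∧ w ((σ ^ (t + 1)) i) = w ((σ ^ t) i) := by
          induction t with
          | zero => exact ⟨not_le.1 hc, heq⟩
          | succ t ih =>
            rw [pow_succ' σ (t + 1), Equiv.Perm.mul_apply]
            have h1 : (σ ^ (t + 1)) i = σ ((σ ^ t) i) := by
              rw [pow_succ', Equiv.Perm.mul_apply]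
            constructor
            · conv_lhs => rw [h1]
              exact hstable _ _ ih.1 (by rw [ih.2])
            · rw [hσw, ih.2, ← hσw, ← h1]; exact ih.2
        exact key.1
  have hcompat : Compatible σ fun i => ((w i).get 0).ab := by
    rw [compatible_iff]
    intro i i' hlt
    rw [hletter, hletter]
    have hle := hmono hlt.le
    rcases (BWord.get_zero_le hle).lt_or_eq with h0 | h0
    · exact Or.inl h0
    · refine Or.inr ⟨h0, ?_⟩
      rcases (BWord.shift_le_shift hle h0).lt_or_eq with h1 | h1
      · rw [← hσw, ← hσw] at h1
        exact hmono.reflect_lt h1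
      · exact hstable _ _ hlt h1
  refine ⟨⟨(σ, fun i => ((w i).get 0).ab), hcompat⟩, ?_⟩
  rw [cycleWords, ← hwM]
  congr 1
  funext i
  refine BWord.ext fun k => ?_
  rw [get_cycleWord]
  have hk : ∀ k, w ((σ ^ k) i) = BWord.shift^[k] (w i) := by
    intro k
    induction k with
    | zero => rfl
    | succ k ih => rw [pow_succ', Equiv.Perm.mul_apply, hσw, ih, Function.iterate_succ_apply']
  refine (hletter _).trans ?_
  rw [hk, BWord.get_iterate_shift, zero_add]

end Words

end

/-! ### Closed orbits and invariant multisets of a dynamical system -/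

section

/-- Exponents of the variables: the variable `none` counts bars. -/
abbrev Weight : Type := Option ℕ+ →₀ ℕ

/-- The degree in the variables other than `none`. -/
def Weight.size : Weight →+ ℕ where
  toFun μ := μ.some.degree
  map_zero' := by simp
  map_add' μ ν := by simp

theorem Weight.size_optionElim (m : ℕ+ →₀ ℕ) (j : ℕ) : size (m.optionElim j) = m.degree := by
  simp [size]

section Dynamics

variable {S : Type} (s : S → S) (wt : S → Weight)

/-- The total weight of the first `d` points of an orbit. -/
def orbitWeight (d : ℕ) (w : S) : Weight := ∑ i ∈ Finset.range d, wt (s^[i] w)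

/-- The first `d` points of an orbit. -/
def orbitMultiset (d : ℕ) (w : S) : Multiset S := (Multiset.range d).map fun i => s^[i] w

/-- The number of closed orbits, with a starting point, of given length and weight. -/
def closedCount (d : ℕ) (μ : Weight) : ℕ :=
  Nat.card {w : S // s^[d] w = w ∧ orbitWeight s wt d w = μ}

/-- The number of points of given minimal period with an orbit of given weight. -/
def primCount (d : ℕ) (μ : Weight) : ℕ :=
  Nat.card {w : S // Function.minimalPeriod s w = d ∧ orbitWeight s wt d w = μ}

/-- The number of invariant multisets of given weight. -/
def invCount (μ : Weight) : ℕ :=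
  Nat.card {M : Multiset S // M.map s = M ∧ (M.map wt).sum = μ}

variable {s wt}

theorem sum_map_orbitMultiset (d : ℕ) (w : S) :
    ((orbitMultiset s d w).map wt).sum = orbitWeight s wt d w := by
  rw [orbitMultiset, Multiset.map_map]; rfl

theorem card_orbitMultiset (d : ℕ) (w : S) : Multiset.card (orbitMultiset s d w) = d := by
  rw [orbitMultiset, Multiset.card_map, Multiset.card_range]

theorem map_orbitMultiset {d : ℕ} {w : S} (h : s^[d] w = w) :
    (orbitMultiset s d w).map s = orbitMultiset s d w := by
  rw [orbitMultiset, Multiset.map_map]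
  rcases d with _ | d
  · rfl
  · conv_lhs => rw [Multiset.range_succ, Multiset.map_cons]
    conv_rhs => rw [add_comm, Multiset.range_add, Multiset.map_add, Multiset.map_map]
    rw [← Multiset.singleton_add]
    congr 1
    · rw [Function.comp_apply, ← Function.iterate_succ_apply' s, h]; rfl
    · refine Multiset.map_congr rfl fun i _ => ?_
      rw [Function.comp_apply, Function.comp_apply, ← Function.iterate_succ_apply' s, add_comm]

theorem orbitMultiset_mul {p : ℕ} {w : S} (h : s^[p] w = w) (k : ℕ) :
    orbitMultiset s (k * p) w = k • orbitMultiset s p w := by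
  induction k with
  | zero => simp [orbitMultiset]
  | succ k ih =>
    rw [add_mul, one_mul, succ_nsmul, ← ih, orbitMultiset, Multiset.range_add, Multiset.map_add,
      Multiset.map_map]
    congr 1
    refine Multiset.map_congr rfl fun i _ => ?_
    have hk : s^[k * p] w = w := by
      rw [mul_comm, Function.iterate_mul]
      exact Function.iterate_fixed h k
    change s^[k * p + i] w = _
    rw [add_comm, Function.iterate_add_apply, hk]

theorem size_orbitWeight (hwt : ∀ w, Weight.size (wt w) = 1) (d : ℕ) (w : S) :
    Weight.size (orbitWeight s wt d w) = d := by
  rw [orbitWeight, map_sum]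
  simp [hwt]

open Classical in
theorem count_le_count_iterate {M : Multiset S} (hM : M.map s = M) (i : ℕ) (w : S) :
    M.count w ≤ M.count (s^[i] w) := by
  induction i with
  | zero => exact le_rfl
  | succ i ih =>
    refine ih.trans ?_
    rw [Function.iterate_succ_apply']
    conv_rhs => rw [← hM]
    rw [Multiset.count_map, Multiset.count_eq_card_filter_eq]
    exact Multiset.card_le_card (Multiset.monotone_filter_right M fun x hx => by rw [hx])

open Classical in
theorem isPeriodicPt_of_mem {M : Multiset S} (hM : M.map s = M) {w : S} (hw : w ∈ M) :
    w ∈ Function.periodicPts s := by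
  have hmap : ∀ x ∈ M, s x ∈ M := fun x hx => hM ▸ Multiset.mem_map_of_mem s hx
  let g : M.toFinset → M.toFinset := fun x =>
    ⟨s x, Multiset.mem_toFinset.2 (hmap x (Multiset.mem_toFinset.1 x.2))⟩
  have hg : Function.Surjective g := by
    rintro ⟨y, hy⟩
    rw [Multiset.mem_toFinset, ← hM, Multiset.mem_map] at hy
    obtain ⟨x, hx, rfl⟩ := hy
    exact ⟨⟨x, Multiset.mem_toFinset.2 hx⟩, rfl⟩
  have hinj := Finite.injective_iff_surjective.2 hg
  obtain ⟨k, hk, hp⟩ := hinj.mem_periodicPts ⟨w, Multiset.mem_toFinset.2 hw⟩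
  refine ⟨k, hk, ?_⟩
  have hit : ∀ (k : ℕ) (x : M.toFinset), ((g^[k] x : M.toFinset) : S) = s^[k] x := by
    intro k
    induction k with
    | zero => intro x; rfl
    | succ k ih => intro x; rw [Function.iterate_succ_apply, ih]; rfl
  exact (hit k _).symm.trans (congrArg Subtype.val hp)

theorem nodup_orbitMultiset_minimalPeriod (w : S) :
    (orbitMultiset s (Function.minimalPeriod s w) w).Nodup := by
  refine Multiset.Nodup.map_on ?_ (Multiset.nodup_range _)
  intro i hi k hk h
  exact Function.iterate_injOn_Iio_minimalPeriod (Multiset.mem_range.1 hi) (Multiset.mem_range.1 hk) h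

-- Multiplicities in an invariant multiset do not drop along an orbit, so `k` copies of a primitive
-- cycle through `w` fit into `M` as soon as `w` occurs `k` times.
open Classical in
theorem orbitMultiset_mul_le_iff {M : Multiset S} (hM : M.map s = M) {w : S}
    (hw : w ∈ Function.periodicPts s) (k : ℕ) :
    orbitMultiset s (k * Function.minimalPeriod s w) w ≤ M ↔ k ≤ M.count w := by
  have hp := Function.minimalPeriod_pos_of_mem_periodicPts hw
  rw [orbitMultiset_mul (Function.iterate_minimalPeriod) k]
  constructor
  · intro h
    have h1 := Multiset.count_le_of_le w h
    have h0 : w ∈ orbitMultiset s (Function.minimalPeriod s w) w :=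
      Multiset.mem_map.2 ⟨0, Multiset.mem_range.2 hp, rfl⟩
    rw [Multiset.count_nsmul, Multiset.count_eq_one_of_mem (nodup_orbitMultiset_minimalPeriod w) h0,
      mul_one] at h1
    exact h1
  · intro h
    rw [Multiset.le_iff_count]
    intro v
    rw [Multiset.count_nsmul]
    by_cases hv : v ∈ orbitMultiset s (Function.minimalPeriod s w) w
    · rw [Multiset.count_eq_one_of_mem (nodup_orbitMultiset_minimalPeriod w) hv, mul_one]
      obtain ⟨i, _, rfl⟩ := Multiset.mem_map.1 hv
      exact h.trans (count_le_count_iterate hM i w)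
    · rw [Multiset.count_eq_zero_of_notMem hv, mul_zero]
      exact Nat.zero_le _

-- The possible lengths are the multiples of the minimal period by `1, …, M.count w`. Thus each
-- occurrence of `w` in `M` is labelled by a closed orbit through `w` contained in `M`.
open Classical in
theorem nonempty_equiv_orbitMultiset_le {M : Multiset S} (hM : M.map s = M) (w : S) :
    Nonempty (Fin (M.count w) ≃ {d : ℕ // d ≠ 0 ∧ s^[d] w = w ∧ orbitMultiset s d w ≤ M}) := by
  by_cases hw : w ∈ Function.periodicPts s
  · have hp := Function.minimalPeriod_pos_of_mem_periodicPts hw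
    refine ⟨Equiv.ofBijective (fun k : Fin (M.count w) =>
      (⟨(k + 1) * Function.minimalPeriod s w, Nat.mul_ne_zero (Nat.succ_ne_zero _) hp.ne',
        (Function.isPeriodicPt_minimalPeriod s w).const_mul _,
        (orbitMultiset_mul_le_iff hM hw _).2 k.2⟩ :
        {d : ℕ // d ≠ 0 ∧ s^[d] w = w ∧ orbitMultiset s d w ≤ M})) ⟨?_, ?_⟩⟩
    · intro k k' h
      have := Nat.eq_of_mul_eq_mul_right hp (Subtype.mk.inj h)
      exact Fin.ext (by omega)
    · rintro ⟨d, hd, hdw, hle⟩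
      obtain ⟨k, rfl⟩ := Function.IsPeriodicPt.minimalPeriod_dvd hdw
      have hk : k ≠ 0 := fun h => hd (by rw [h, mul_zero])
      have hle' := hle
      rw [mul_comm, orbitMultiset_mul_le_iff hM hw] at hle'
      refine ⟨⟨k - 1, by omega⟩, Subtype.ext ?_⟩
      change (k - 1 + 1) * _ = _
      rw [Nat.sub_add_cancel (by omega), mul_comm]
  · have h1 : M.count w = 0 :=
      Multiset.count_eq_zero_of_notMem fun h => hw (isPeriodicPt_of_mem hM h)
    rw [h1]
    have : IsEmpty {d : ℕ // d ≠ 0 ∧ s^[d] w = w ∧ orbitMultiset s d w ≤ M} :=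
      ⟨fun d => hw ⟨d.1, Nat.pos_of_ne_zero d.2.1, d.2.2.1⟩⟩
    exact ⟨Equiv.equivOfIsEmpty _ _⟩

open Classical in
theorem nonempty_equiv_marked {M : Multiset S} (hM : M.map s = M) :
    Nonempty (M.ToType ≃
      {x : S × ℕ // x.2 ≠ 0 ∧ s^[x.2] x.1 = x.1 ∧ orbitMultiset s x.2 x.1 ≤ M}) :=
  ⟨(Equiv.sigmaCongrRight fun w => (nonempty_equiv_orbitMultiset_le hM w).some).trans
    { toFun := fun x => ⟨(x.1, x.2.1), x.2.2⟩
      invFun := fun x => ⟨x.1.1, x.1.2, x.2⟩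
      left_inv := fun _ => rfl
      right_inv := fun _ => rfl }⟩

open Classical in
/-- The decomposition of invariant multisets with a marked point. -/
theorem size_mul_invCount (hwt : ∀ w, Weight.size (wt w) = 1)
    (hinv : ∀ μ, Finite {M : Multiset S // M.map s = M ∧ (M.map wt).sum = μ})
    (hcl : ∀ (d : ℕ) μ, Finite {w : S // s^[d + 1] w = w ∧ orbitWeight s wt (d + 1) w = μ})
    (μ : Weight) :
    Weight.size μ * invCount s wt μ = ∑ x ∈ Finset.HasAntidiagonal.antidiagonal μ,
      (if Weight.size x.1 = 0 then 0 else closedCount s wt (Weight.size x.1) x.1) *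
        invCount s wt x.2 := by
  have hfin : ∀ x : Finset.HasAntidiagonal.antidiagonal μ,
      Finite {w : S // Weight.size x.1.1 ≠ 0 ∧ s^[Weight.size x.1.1] w = w ∧
        orbitWeight s wt (Weight.size x.1.1) w = x.1.1} := by
    intro x
    rcases Nat.eq_zero_or_eq_succ_pred (Weight.size x.1.1) with h | h
    · rw [h]
      exact @Finite.of_subsingleton _ ⟨fun a => absurd rfl a.2.1⟩
    · have := hcl (Weight.size x.1.1).pred x.1.1
      rw [← Nat.succ_eq_add_one, ← h] at this
      exact Finite.of_injective (fun w => (⟨w.1, w.2.2⟩ :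
        {w : S // s^[Weight.size x.1.1] w = w ∧ orbitWeight s wt (Weight.size x.1.1) w = x.1.1}))
        fun a b hab => Subtype.ext (Subtype.mk.inj hab)
  have hR : ∑ x ∈ Finset.HasAntidiagonal.antidiagonal μ,
      (if Weight.size x.1 = 0 then 0 else closedCount s wt (Weight.size x.1) x.1) *
        invCount s wt x.2 = Nat.card (Σ x : Finset.HasAntidiagonal.antidiagonal μ,
      {w : S // Weight.size x.1.1 ≠ 0 ∧ s^[Weight.size x.1.1] w = w ∧
        orbitWeight s wt (Weight.size x.1.1) w = x.1.1} ×
      {M : Multiset S // M.map s = M ∧ (M.map wt).sum = x.1.2}) := by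
    rw [Nat.card_sigma, ← Finset.sum_coe_sort]
    refine Finset.sum_congr rfl fun x _ => ?_
    rw [Nat.card_prod]
    split_ifs with h
    · rw [zero_mul]
      simp [h]
    · simp only [closedCount, invCount, ne_eq, h, not_false_eq_true, true_and]
  -- Every element has size one, so an invariant multiset of weight `μ` has `size μ` elements, and
  -- the left side counts invariant multisets with one marked occurrence.
  have hL : Weight.size μ * invCount s wt μ =
      Nat.card (Σ M : {M : Multiset S // M.map s = M ∧ (M.map wt).sum = μ},
        {x : S × ℕ // x.2 ≠ 0 ∧ s^[x.2] x.1 = x.1 ∧ orbitMultiset s x.2 x.1 ≤ M.1}) := by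
    have := Fintype.ofFinite {M : Multiset S // M.map s = M ∧ (M.map wt).sum = μ}
    have hc : ∀ M : {M : Multiset S // M.map s = M ∧ (M.map wt).sum = μ},
        Multiset.card M.1 = Weight.size μ := by
      intro M
      have h := congrArg Weight.size M.2.2
      rw [map_multiset_sum, Multiset.map_map] at h
      rw [← h]
      simp [hwt]
    have hf : ∀ M : {M : Multiset S // M.map s = M ∧ (M.map wt).sum = μ},
        Finite {x : S × ℕ // x.2 ≠ 0 ∧ s^[x.2] x.1 = x.1 ∧ orbitMultiset s x.2 x.1 ≤ M.1} :=
      fun M => Finite.of_equiv _ (nonempty_equiv_marked M.2.1).some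
    rw [Nat.card_sigma, invCount, mul_comm, Nat.card_eq_fintype_card, ← smul_eq_mul,
      ← Finset.card_univ, ← Finset.sum_const]
    refine Finset.sum_congr rfl fun M _ => ?_
    rw [← Nat.card_congr (nonempty_equiv_marked M.2.1).some, Nat.card_eq_fintype_card,
      Multiset.card_coe, hc]
  rw [hL, hR]
  symm
  -- Adding a closed orbit to an invariant multiset marks its starting point together with its
  -- length; subtracting the marked orbit is the inverse.
  refine Nat.card_eq_of_bijective (fun y => ⟨⟨y.2.2.1 +
    orbitMultiset s (Weight.size y.1.1.1) y.2.1.1, ?_, ?_⟩, (y.2.1.1, Weight.size y.1.1.1),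
    y.2.1.2.1, y.2.1.2.2.1, Multiset.le_add_left _ _⟩) ⟨?_, ?_⟩
  · rw [Multiset.map_add, y.2.2.2.1, map_orbitMultiset y.2.1.2.2.1]
  · rw [Multiset.map_add, Multiset.sum_add, y.2.2.2.2, sum_map_orbitMultiset, y.2.1.2.2.2, add_comm]
    exact Finset.HasAntidiagonal.mem_antidiagonal.1 y.1.2
  · rintro ⟨⟨⟨a, b⟩, hx⟩, ⟨w, hw⟩, ⟨M, hM⟩⟩ ⟨⟨⟨a', b'⟩, hx'⟩, ⟨w', hw'⟩, ⟨M', hM'⟩⟩ h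
    have h1 : M + orbitMultiset s (Weight.size a) w = M' + orbitMultiset s (Weight.size a') w' :=
      congrArg (fun y => y.1.1) h
    have h2 : w = w' := congrArg (fun y => y.2.1.1) h
    have h3 : Weight.size a = Weight.size a' := congrArg (fun y => y.2.1.2) h
    subst h2
    obtain rfl : a = a' := by
      have e1 := hw.2.2
      have e2 := hw'.2.2
      simp only at e1 e2
      rw [← e1, ← e2, h3]
    obtain rfl : M = M' := add_right_cancel h1
    obtain rfl : b = b' := by
      have e1 := hM.2
      have e2 := hM'.2
      simp only at e1 e2
      rw [← e1, ← e2]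
    rfl
  · rintro ⟨⟨M, hM⟩, ⟨⟨w, d⟩, hd, hw, hle⟩⟩
    have hs : Weight.size (orbitWeight s wt d w) = d := size_orbitWeight hwt d w
    have hadd : (M - orbitMultiset s d w) + orbitMultiset s d w = M :=
      Multiset.sub_add_cancel hle
    refine ⟨⟨⟨(orbitWeight s wt d w, ((M - orbitMultiset s d w).map wt).sum), ?_⟩,
      ⟨w, ?_⟩, ⟨M - orbitMultiset s d w, ?_, rfl⟩⟩, ?_⟩
    · rw [Finset.HasAntidiagonal.mem_antidiagonal, ← hM.2, ← hadd, Multiset.map_add,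
        Multiset.sum_add, sum_map_orbitMultiset, hadd]
      exact add_comm _ _
    · rw [hs]; exact ⟨hd, hw, rfl⟩
    · have h1 := hM.1
      rw [← hadd, Multiset.map_add, map_orbitMultiset hw] at h1
      exact add_right_cancel h1
    · refine Sigma.subtype_ext (Subtype.ext ?_) ?_
      · simp only [hs]
        exact hadd
      · simp only [hs]

end Dynamics

end

/-! ### From closed orbits to primitive orbits -/

section

/-- Division of the exponents by `k`. -/
def Weight.div (μ : Weight) (k : ℕ) : Weight := μ.mapRange (· / k) (Nat.zero_div k)

theorem Weight.nsmul_div {k : ℕ} (hk : k ≠ 0) (μ : Weight) : (k • μ).div k = μ := by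
  ext i
  simp [Weight.div, Nat.pos_of_ne_zero hk]

theorem Weight.size_mul_of_nsmul_eq {k : ℕ} {μ ν : Weight} (h : k • ν = μ) :
    k * Weight.size ν = Weight.size μ := by
  rw [← h, map_nsmul, smul_eq_mul]

section Dynamics

variable {S : Type} {s : S → S} {wt : S → Weight}

theorem orbitWeight_mul {p : ℕ} {w : S} (h : s^[p] w = w) (k : ℕ) :
    orbitWeight s wt (k * p) w = k • orbitWeight s wt p w := by
  rw [← sum_map_orbitMultiset, orbitMultiset_mul h, Multiset.map_nsmul, Multiset.sum_nsmul,
    sum_map_orbitMultiset]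

/-- Closed orbits are powers of primitive closed orbits. -/
theorem closedCount_eq_sum {d N : ℕ} (hd : d ≠ 0) (hN : d ≤ N) (μ : Weight)
    (hcl : Finite {w : S // s^[d] w = w ∧ orbitWeight s wt d w = μ}) :
    closedCount s wt d μ = ∑ k ∈ Finset.Icc 1 N,
      if k ∣ d ∧ k • μ.div k = μ then primCount s wt (d / k) (μ.div k) else 0 := by
  have hmp : ∀ w : {w : S // s^[d] w = w ∧ orbitWeight s wt d w = μ},
      0 < Function.minimalPeriod s w.1 ∧ Function.minimalPeriod s w.1 ∣ d := fun w =>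
    ⟨Function.IsPeriodicPt.minimalPeriod_pos (Nat.pos_of_ne_zero hd) w.2.1,
      Function.IsPeriodicPt.minimalPeriod_dvd w.2.1⟩
  -- The exponent `k` of a closed orbit, which is the `k`-th power of a primitive one.
  let f : {w : S // s^[d] w = w ∧ orbitWeight s wt d w = μ} → Finset.Icc 1 N := fun w =>
    ⟨d / Function.minimalPeriod s w.1, Finset.mem_Icc.2
      ⟨Nat.div_pos (Nat.le_of_dvd (Nat.pos_of_ne_zero hd) (hmp w).2) (hmp w).1,
        (Nat.div_le_self _ _).trans hN⟩⟩
  rw [closedCount, ← Nat.card_congr (Equiv.sigmaFiberEquiv f), Nat.card_sigma,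
    ← Finset.sum_coe_sort (Finset.Icc 1 N)]
  refine Finset.sum_congr rfl ?_
  rintro ⟨k, hk⟩ _
  have hk0 : k ≠ 0 := by have := (Finset.mem_Icc.1 hk).1; omega
  have key : ∀ w : {w : S // s^[d] w = w ∧ orbitWeight s wt d w = μ}, f w = ⟨k, hk⟩ →
      k ∣ d ∧ Function.minimalPeriod s w.1 = d / k ∧
        orbitWeight s wt (d / k) w.1 = μ.div k ∧ k • μ.div k = μ := by
    intro w hw
    have h1 : d / Function.minimalPeriod s w.1 = k := congrArg Subtype.val hw
    have h2 : k * Function.minimalPeriod s w.1 = d := by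
      rw [← h1]; exact Nat.div_mul_cancel (hmp w).2
    have h3 : d / k = Function.minimalPeriod s w.1 :=
      Nat.div_eq_of_eq_mul_right (Nat.pos_of_ne_zero hk0) h2.symm
    have h4 := orbitWeight_mul (wt := wt) (Function.iterate_minimalPeriod (f := s) (x := w.1)) k
    rw [h2, w.2.2] at h4
    have h5 : μ.div k = orbitWeight s wt (Function.minimalPeriod s w.1) w.1 := by
      conv_lhs => rw [h4]
      exact Weight.nsmul_div hk0 _
    rw [h3, h5]
    exact ⟨⟨_, h2.symm⟩, rfl, rfl, h4.symm⟩
  have hfix : ∀ (p : ℕ) (v : S), Function.minimalPeriod s v = p → s^[p] v = v := by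
    rintro _ v rfl
    exact Function.iterate_minimalPeriod
  split_ifs with h
  · refine Nat.card_congr
      { toFun := fun w => ⟨w.1.1, (key w.1 w.2).2.1, (key w.1 w.2).2.2.1⟩
        invFun := fun w => ⟨⟨w.1, ?_, ?_⟩, ?_⟩
        left_inv := fun _ => rfl
        right_inv := fun _ => rfl }
    · have := Function.iterate_fixed (hfix _ _ w.2.1) k
      rwa [← Function.iterate_mul, Nat.div_mul_cancel h.1] at this
    · have h2 := orbitWeight_mul (wt := wt) (hfix _ _ w.2.1) k
      rw [Nat.mul_div_cancel' h.1, w.2.2, h.2] at h2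
      exact h2
    · refine Subtype.ext ?_
      change d / Function.minimalPeriod s w.1 = k
      rw [w.2.1, Nat.div_div_self h.1 hd]
  · have : IsEmpty {w // f w = ⟨k, hk⟩} := ⟨fun w => h ⟨(key w.1 w.2).1, (key w.1 w.2).2.2.2⟩⟩
    exact Nat.card_of_isEmpty

variable {S' : Type} {s' : S' → S'} {wt' : S' → Weight}

/-- A comparison of the numbers of closed orbits of two systems passes to primitive orbits. -/
theorem primCount_eq_sum_of_closedCount_eq_sum (P : Weight → Prop)
    (hP : ∀ (k : ℕ) μ, P (k • μ) → P μ) (hP0 : ∀ μ, P μ → Weight.size μ ≠ 0)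
    (hcl : ∀ (d : ℕ) μ, Finite {w : S // s^[d + 1] w = w ∧ orbitWeight s wt (d + 1) w = μ})
    (hcl' : ∀ (d : ℕ) μ, Finite {w : S' // s'^[d + 1] w = w ∧ orbitWeight s' wt' (d + 1) w = μ})
    (h : ∀ μ, P μ → (closedCount s wt (Weight.size μ) μ : ℚ) =
      ∑ r ∈ Finset.Icc 1 (Weight.size μ), (Weight.size μ / r : ℚ) * closedCount s' wt' r μ)
    (μ : Weight) (hμ : P μ) : (primCount s wt (Weight.size μ) μ : ℚ) =
      ∑ r ∈ Finset.Icc 1 (Weight.size μ), (Weight.size μ / r : ℚ) * primCount s' wt' r μ := by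
  induction hn : Weight.size μ using Nat.strong_induction_on generalizing μ with
  | _ n ih =>
    have hn0 : n ≠ 0 := hn ▸ hP0 μ hμ
    have hk0 : ∀ k ∈ Finset.Icc 1 n, k ≠ 0 := fun k hk => by
      have := (Finset.mem_Icc.1 hk).1; omega
    have h1 := h μ hμ
    rw [hn] at h1
    -- Both sides of the hypothesis are expanded over the exponent `k`. The term for `k` is the two
    -- sides of the claim at `μ / k`, because the ratio `n / r` does not change when both numbers
    -- are divided by `k`. The terms with `k ≥ 2` agree by induction, which leaves `k = 1`.
    have hL : (closedCount s wt n μ : ℚ) = ∑ k ∈ Finset.Icc 1 n, if k • μ.div k = μ then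
        (primCount s wt (Weight.size (μ.div k)) (μ.div k) : ℚ) else 0 := by
      have hf := hcl n.pred μ
      rw [← Nat.succ_eq_add_one, Nat.succ_pred hn0] at hf
      rw [closedCount_eq_sum hn0 le_rfl μ hf, Nat.cast_sum]
      refine Finset.sum_congr rfl fun k hk => ?_
      by_cases hd : k • μ.div k = μ
      · have hs := Weight.size_mul_of_nsmul_eq hd
        rw [hn] at hs
        rw [if_pos ⟨⟨_, hs.symm⟩, hd⟩, if_pos hd, ← hs,
          Nat.mul_div_cancel_left _ (Nat.pos_of_ne_zero (hk0 k hk))]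
      · rw [if_neg fun hc => hd hc.2, if_neg hd, Nat.cast_zero]
    have hR : ∑ r ∈ Finset.Icc 1 n, (n / r : ℚ) * closedCount s' wt' r μ =
        ∑ k ∈ Finset.Icc 1 n, if k • μ.div k = μ then
          ∑ r ∈ Finset.Icc 1 (Weight.size (μ.div k)),
            (Weight.size (μ.div k) / r : ℚ) * primCount s' wt' r (μ.div k) else 0 := by
      have : ∀ r ∈ Finset.Icc 1 n, (n / r : ℚ) * closedCount s' wt' r μ =
          ∑ k ∈ Finset.Icc 1 n, if k ∣ r ∧ k • μ.div k = μ then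
            (n / r : ℚ) * primCount s' wt' (r / k) (μ.div k) else 0 := by
        intro r hr
        have hf := hcl' r.pred μ
        rw [← Nat.succ_eq_add_one, Nat.succ_pred (hk0 r hr)] at hf
        rw [closedCount_eq_sum (hk0 r hr) (Finset.mem_Icc.1 hr).2 μ hf, Nat.cast_sum,
          Finset.mul_sum]
        refine Finset.sum_congr rfl fun k _ => ?_
        split_ifs <;> simp
      rw [Finset.sum_congr rfl this, Finset.sum_comm]
      refine Finset.sum_congr rfl fun k hk => ?_
      have hkp := hk0 k hk
      by_cases hd : k • μ.div k = μ
      · have hs := Weight.size_mul_of_nsmul_eq hd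
        rw [hn] at hs
        simp only [hd, and_true, if_true]
        rw [← Finset.sum_filter]
        symm
        refine Finset.sum_bij (fun d _ => k * d) ?_ ?_ ?_ ?_
        · intro d hd
          have := Finset.mem_Icc.1 hd
          refine Finset.mem_filter.2 ⟨Finset.mem_Icc.2 ⟨?_, ?_⟩, Dvd.intro _ rfl⟩
          · exact Nat.mul_pos (Nat.pos_of_ne_zero hkp) this.1
          · rw [← hs]; exact Nat.mul_le_mul_left _ this.2
        · intro d _ d' _ he
          exact Nat.eq_of_mul_eq_mul_left (Nat.pos_of_ne_zero hkp) he
        · intro r hr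
          obtain ⟨hr1, ⟨d, rfl⟩⟩ := Finset.mem_filter.1 hr
          refine ⟨d, Finset.mem_Icc.2 ⟨?_, ?_⟩, rfl⟩
          · have := (Finset.mem_Icc.1 hr1).1
            exact Nat.pos_of_ne_zero fun h => by simp [h] at this
          · have := (Finset.mem_Icc.1 hr1).2
            rw [← hs] at this
            exact Nat.le_of_mul_le_mul_left this (Nat.pos_of_ne_zero hkp)
        · intro d hd
          have hk' : (k : ℚ) ≠ 0 := Nat.cast_ne_zero.2 hkp
          rw [Nat.mul_div_cancel_left _ (Nat.pos_of_ne_zero hkp), ← hs, Nat.cast_mul, Nat.cast_mul,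
            mul_div_mul_left _ _ hk']
      · simp [hd]
    rw [hL, hR, ← Finset.add_sum_erase _ _ (Finset.mem_Icc.2 ⟨le_rfl, Nat.one_le_iff_ne_zero.2 hn0⟩),
      ← Finset.add_sum_erase (Finset.Icc 1 n) _
        (Finset.mem_Icc.2 ⟨le_rfl, Nat.one_le_iff_ne_zero.2 hn0⟩)] at h1
    have hrest : ∀ k ∈ (Finset.Icc 1 n).erase 1, (if k • μ.div k = μ then
        (primCount s wt (Weight.size (μ.div k)) (μ.div k) : ℚ) else 0) =
        if k • μ.div k = μ then
          ∑ r ∈ Finset.Icc 1 (Weight.size (μ.div k)),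
            (Weight.size (μ.div k) / r : ℚ) * primCount s' wt' r (μ.div k) else 0 := by
      intro k hk
      split_ifs with hd
      · have hs := Weight.size_mul_of_nsmul_eq hd
        rw [hn] at hs
        have hk1 := Finset.mem_erase.1 hk
        have hk2 := Finset.mem_Icc.1 hk1.2
        have hPd : P (μ.div k) := hP k _ (hd.symm ▸ hμ)
        have hlt : Weight.size (μ.div k) < n := by
          have h0 := Nat.pos_of_ne_zero (hP0 _ hPd)
          have : 2 ≤ k := by have := hk1.1; omega
          nlinarith
        exact ih _ hlt _ hPd rfl
      · rfl
    rw [Finset.sum_congr rfl hrest] at h1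
    have h2 := add_right_cancel h1
    have hdiv : μ.div 1 = μ := by
      have := Weight.nsmul_div one_ne_zero μ
      rwa [one_smul] at this
    simpa [hdiv, hn] using h2

end Dynamics

end

/-! ### Eulerian quasisymmetric functions count invariant multisets and primitive words -/

section

theorem sum_optionElim {ι : Type} (s : Finset ι) (f : ι → ℕ+ →₀ ℕ) (g : ι → ℕ) :
    ∑ i ∈ s, (f i).optionElim (g i) = (∑ i ∈ s, f i).optionElim (∑ i ∈ s, g i) := by
  classical
  induction s using Finset.induction_on with
  | empty => simp [Finsupp.optionElim_zero]
  | insert i s hi ih =>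
    rw [Finset.sum_insert hi, Finset.sum_insert hi, Finset.sum_insert hi, ih,
      Finsupp.optionElim_add]

theorem optionElim_inj {f f' : ℕ+ →₀ ℕ} {g g' : ℕ} :
    f.optionElim g = f'.optionElim g' ↔ f = f' ∧ g = g' := by
  constructor
  · intro h
    refine ⟨?_, ?_⟩
    · have := congrArg Finsupp.some h
      rwa [Finsupp.some_optionElim, Finsupp.some_optionElim] at this
    · have := DFunLike.congr_fun h none
      rwa [Finsupp.optionElim_apply_none, Finsupp.optionElim_apply_none] at this
  · rintro ⟨rfl, rfl⟩; rfl

/-- The weight of a letter. -/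
def Letter.weight (l : Letter) : Weight :=
  (Finsupp.single l.ab 1).optionElim (if l.plain then 0 else 1)

/-- The weight of the first letter of a word. -/
def BWord.weight (w : BWord) : Weight := (w.get 0).weight

theorem Letter.size_weight (l : Letter) : Weight.size l.weight = 1 := by
  rw [Letter.weight, Weight.size_optionElim, Finsupp.degree_single]

theorem BWord.size_weight (w : BWord) : Weight.size w.weight = 1 := Letter.size_weight _

section Count

variable {n : ℕ}

/-- The pairs that are counted by sums of fundamental quasisymmetric functions. -/
abbrev CompatiblePair (n : ℕ) (P : Equiv.Perm (Fin n) → Prop) (m : ℕ+ →₀ ℕ) : Type :=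
  {p : Equiv.Perm (Fin n) × (Fin n → ℕ+) //
    Compatible p.1 p.2 ∧ ∑ i, Finsupp.single (p.2 i) 1 = m ∧ P p.1}

instance (P : Equiv.Perm (Fin n) → Prop) (m : ℕ+ →₀ ℕ) : Finite (CompatiblePair n P m) :=
  Finite.of_injective (β := Equiv.Perm (Fin n) × Coloring n m)
    (fun p => (p.1.1, ⟨p.1.2, p.2.2.1⟩)) fun p q h => by
      rw [Prod.mk.injEq, Coloring.mk.injEq] at h
      exact Subtype.ext (Prod.ext h.1 h.2)

open Classical in
theorem coeff_sum_fundamental (P : Equiv.Perm (Fin n) → Prop) (m : ℕ+ →₀ ℕ) :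
    MvPowerSeries.coeff m (∑ σ : Equiv.Perm (Fin n), if P σ then fundamental n (exd σ) else 0) =
      Nat.card (CompatiblePair n P m) := by
  have hfin : ∀ σ : Equiv.Perm (Fin n), Finite {a : Fin n → ℕ+ //
      Compatible σ a ∧ ∑ i, Finsupp.single (a i) 1 = m ∧ P σ} := fun σ =>
    Finite.of_injective (β := Coloring n m) (fun a => ⟨a.1, a.2.2.1⟩) fun a b h =>
      Subtype.ext (Coloring.mk.inj h)
  let e : CompatiblePair n P m ≃ Σ σ : Equiv.Perm (Fin n), {a : Fin n → ℕ+ //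
      Compatible σ a ∧ ∑ i, Finsupp.single (a i) 1 = m ∧ P σ} :=
    { toFun := fun p => ⟨p.1.1, p.1.2, p.2⟩
      invFun := fun p => ⟨(p.1, p.2.1), p.2.2⟩
      left_inv := fun _ => rfl
      right_inv := fun _ => rfl }
  rw [Nat.card_congr e, Nat.card_sigma, map_sum, Nat.cast_sum]
  refine Finset.sum_congr rfl fun σ _ => ?_
  split_ifs with h
  · simp only [h, and_true]
    rw [MvPowerSeries.coeff_apply, fundamental, ← Nat.card_coe_set_eq]
    refine congrArg _ (Nat.card_congr (Equiv.subtypeEquivRight fun a => ?_))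
    exact and_assoc.symm
  · rw [map_zero]
    simp [h]

theorem CompatiblePair.degree_eq {P : Equiv.Perm (Fin n) → Prop} {m : ℕ+ →₀ ℕ}
    (p : CompatiblePair n P m) : m.degree = n := by
  rw [← p.2.2.1, map_sum]
  simp

theorem sum_map_weight_cycleWords
    (p : {p : Equiv.Perm (Fin n) × (Fin n → ℕ+) // Compatible p.1 p.2}) :
    ((cycleWords p).map BWord.weight).sum =
      (∑ i, Finsupp.single (p.1.2 i) 1).optionElim (exc p.1.1) := by
  rw [cycleWords, Multiset.map_map, exc, Finset.card_filter, ← sum_optionElim]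
  refine Finset.sum_congr rfl fun i _ => ?_
  change (letter p.1.1 p.1.2 i).weight = _
  rw [Letter.weight]
  congr 1
  by_cases h : i < p.1.1 i
  · rw [if_pos h, letter_not_plain.2 h]; rfl
  · rw [if_neg h, letter_plain.2 (not_lt.1 h)]; rfl

theorem card_eq_size {M : Multiset BWord} {μ : Weight} (h : (M.map BWord.weight).sum = μ) :
    Multiset.card M = Weight.size μ := by
  rw [← h, map_multiset_sum, Multiset.map_map]
  simp [BWord.size_weight]

/-- Compatible pairs as invariant multisets of words. -/
def pairEquiv {m : ℕ+ →₀ ℕ} (hm : m.degree = n) (j : ℕ) :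
    CompatiblePair n (fun σ => exc σ = j) m ≃ {M : Multiset BWord // M.map BWord.shift = M ∧
      (M.map BWord.weight).sum = m.optionElim j} :=
  Equiv.ofBijective (fun p => ⟨cycleWords ⟨p.1, p.2.1⟩, map_shift_cycleWords _,
      (sum_map_weight_cycleWords _).trans (optionElim_inj.2 p.2.2)⟩)
    ⟨fun p q h => Subtype.ext (Subtype.mk.inj (cycleWords_injective (Subtype.mk.inj h))), by
      rintro ⟨M, hM, hw⟩
      obtain ⟨p, rfl⟩ := exists_cycleWords_eq
        ((card_eq_size hw).trans ((Weight.size_optionElim m j).trans hm)) hM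
      have h := (sum_map_weight_cycleWords p).symm.trans hw
      rw [optionElim_inj] at h
      exact ⟨⟨p.1, p.2, h⟩, rfl⟩⟩

theorem coeff_eulerianQ {m : ℕ+ →₀ ℕ} (hm : m.degree = n) (j : ℕ) :
    MvPowerSeries.coeff m (eulerianQ n j) = invCount BWord.shift BWord.weight (m.optionElim j) := by
  classical
  rw [invCount, ← Nat.card_congr (pairEquiv hm j), ← coeff_sum_fundamental, eulerianQ]
  simp only [Nat.cast_inj]
  congr!

instance finite_invariant (μ : Weight) : Finite {M : Multiset BWord // M.map BWord.shift = M ∧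
    (M.map BWord.weight).sum = μ} := by
  rw [← Finsupp.optionElim_some μ]
  exact Finite.of_equiv _ (pairEquiv (m := μ.some) rfl (μ none))

/-- A closed orbit is determined by its starting point, an element of one of the finitely many
invariant multisets of the same weight. -/
theorem finite_closed (d : ℕ) (μ : Weight) : Finite {w : BWord // BWord.shift^[d + 1] w = w ∧
    orbitWeight BWord.shift BWord.weight (d + 1) w = μ} := by
  have : Finite (Σ M : {M : Multiset BWord // M.map BWord.shift = M ∧
      (M.map BWord.weight).sum = μ}, {w // w ∈ M.1}) := by
    have : ∀ M : Multiset BWord, Finite {w // w ∈ M} := fun M => by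
      classical
      exact Finite.of_injective (β := M.toFinset)
        (fun w => ⟨w.1, Multiset.mem_toFinset.2 w.2⟩) fun a b h => Subtype.ext (Subtype.mk.inj h)
    infer_instance
  refine Finite.of_injective (fun w => (⟨⟨orbitMultiset BWord.shift (d + 1) w.1,
    map_orbitMultiset w.2.1, (sum_map_orbitMultiset _ _).trans w.2.2⟩, w.1,
    Multiset.mem_map.2 ⟨0, Multiset.mem_range.2 (Nat.succ_pos d), rfl⟩⟩ :
    Σ M : {M : Multiset BWord // M.map BWord.shift = M ∧
      (M.map BWord.weight).sum = μ}, {w // w ∈ M.1})) fun w w' h => Subtype.ext ?_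
  exact congrArg (fun y => y.2.1) h

section Cycle

variable {σ : Equiv.Perm (Fin n)}

/-- The bound `2 ≤ n` matters: for `n = 1` the identity has the one-part type but is not a cycle in
the sense of `IsCycle`. -/
theorem hasCycleType_indiscrete_iff (hn : 2 ≤ n) :
    HasCycleType σ (Nat.Partition.indiscrete n) ↔ σ.IsCycle ∧ σ.support = Finset.univ := by
  have hparts : (Nat.Partition.indiscrete n).parts = {n} :=
    Nat.Partition.indiscrete_parts (by omega)
  rw [HasCycleType, hparts, Equiv.Perm.parts_partition, Fintype.card_fin]
  constructor
  · intro h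
    have hc := congrArg Multiset.card h
    rw [Multiset.card_add, Multiset.card_replicate, Multiset.card_singleton] at hc
    have hle : σ.support.card ≤ n := (Finset.card_le_univ _).trans (Fintype.card_fin n).le
    have h0 : n - σ.support.card = 0 := by
      by_contra h0
      have h1 : (1 : ℕ) ∈ ({n} : Multiset ℕ) := by
        rw [← h]
        exact Multiset.mem_add.2 (Or.inr (Multiset.mem_replicate.2 ⟨h0, rfl⟩))
      rw [Multiset.mem_singleton] at h1
      omega
    refine ⟨Equiv.Perm.card_cycleType_eq_one.1 (by omega), ?_⟩
    rw [← Finset.card_eq_iff_eq_univ, Fintype.card_fin]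
    omega
  · rintro ⟨hc, hs⟩
    rw [hc.cycleType, hs, Finset.card_univ, Fintype.card_fin, Nat.sub_self, Multiset.replicate_zero,
      add_zero]

theorem map_pow_range (hc : σ.IsCycle) (hs : σ.support = Finset.univ) (i : Fin n) :
    (Multiset.range n).map (fun k => (σ ^ k) i) = Finset.univ.val := by
  have hord : orderOf σ = n := by rw [hc.orderOf, hs, Finset.card_univ, Fintype.card_fin]
  have hi : σ i ≠ i := Equiv.Perm.mem_support.1 (hs ▸ Finset.mem_univ i)
  have hnd : ((Multiset.range n).map (fun k => (σ ^ k) i)).Nodup := by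
    refine Multiset.Nodup.map_on ?_ (Multiset.nodup_range _)
    have key : ∀ x < n, ∀ y < n, x < y → (σ ^ x) i ≠ (σ ^ y) i := by
      intro x hx y hy hlt heq
      have h1 : (σ ^ (y - x)) i = i := by
        apply (σ ^ x).injective
        rw [← Equiv.Perm.mul_apply, ← pow_add, Nat.add_sub_cancel' hlt.le, heq]
      have h2 := (hc.pow_eq_one_iff' hi).2 h1
      have h3 := Nat.le_of_dvd (by omega) (orderOf_dvd_of_pow_eq_one h2)
      omega
    intro x hx y hy heq
    rw [Multiset.mem_range] at hx hy
    rcases lt_trichotomy x y with h | h | h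
    · exact absurd heq (key x hx y hy h)
    · exact h
    · exact absurd heq.symm (key y hy x hx h)
  let s : Finset (Fin n) := ⟨_, hnd⟩
  have : s = Finset.univ := by
    rw [← Finset.card_eq_iff_eq_univ, Fintype.card_fin]
    change Multiset.card ((Multiset.range n).map _) = n
    rw [Multiset.card_map, Multiset.card_range]
  exact congrArg Finset.val this

variable {a : Fin n → ℕ+}

theorem orbitMultiset_cycleWord (h : Compatible σ a) (hc : σ.IsCycle)
    (hs : σ.support = Finset.univ) (i : Fin n) :
    orbitMultiset BWord.shift n (cycleWord h i) = cycleWords ⟨(σ, a), h⟩ := by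
  rw [cycleWords, ← map_pow_range hc hs i, Multiset.map_map, orbitMultiset]
  exact Multiset.map_congr rfl fun k _ => iterate_shift_cycleWord h i k

/-- Order is preserved along equal words. If `σ^d` moved `i` to a different point with the same
word, its iterates would form a strictly monotone infinite sequence of points. -/
theorem pow_apply_eq_of_cycleWord_eq (h : Compatible σ a) {i : Fin n} {d : ℕ}
    (heq : cycleWord h ((σ ^ d) i) = cycleWord h i) : (σ ^ d) i = i := by
  have hl : ∀ t, letter σ a ((σ ^ t) ((σ ^ d) i)) = letter σ a ((σ ^ t) i) := fun t =>
    congrArg (fun v => BWord.get v t) heq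
  have hp : ∀ t, (σ ^ (d * t)) ((σ ^ d) i) = (σ ^ (d * (t + 1))) i := fun t => by
    rw [← Equiv.Perm.mul_apply, ← pow_add, mul_add, mul_one]
  rcases lt_trichotomy ((σ ^ d) i) i with hlt | hlt | hlt
  · refine absurd (strictAnti_nat_of_succ_lt (f := fun t => (σ ^ (d * t)) i) fun t => ?_).injective
      (not_injective_infinite_finite _)
    rw [← hp]
    exact pow_lt_pow_of_letter_eq h hlt _ fun t _ => hl t
  · exact hlt
  · refine absurd (strictMono_nat_of_lt_succ (f := fun t => (σ ^ (d * t)) i) fun t => ?_).injective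
      (not_injective_infinite_finite _)
    rw [← hp]
    exact pow_lt_pow_of_letter_eq h hlt _ fun t _ => (hl t).symm

theorem minimalPeriod_cycleWord (h : Compatible σ a) (hc : σ.IsCycle)
    (hs : σ.support = Finset.univ) (i : Fin n) :
    Function.minimalPeriod BWord.shift (cycleWord h i) = n := by
  have hord : orderOf σ = n := by rw [hc.orderOf, hs, Finset.card_univ, Fintype.card_fin]
  have hi : σ i ≠ i := Equiv.Perm.mem_support.1 (hs ▸ Finset.mem_univ i)
  refine Nat.dvd_antisymm ?_ ?_
  · refine Function.IsPeriodicPt.minimalPeriod_dvd ?_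
    rw [Function.IsPeriodicPt, Function.IsFixedPt, iterate_shift_cycleWord]
    rw [orderOf_dvd_iff_pow_eq_one.1 hord.dvd, Equiv.Perm.one_apply]
  · conv_lhs => rw [← hord]
    refine orderOf_dvd_of_pow_eq_one ((hc.pow_eq_one_iff' hi).2 ?_)
    refine pow_apply_eq_of_cycleWord_eq h ?_
    rw [← iterate_shift_cycleWord, Function.iterate_minimalPeriod]

/-- Primitivity makes the `n` words distinct, so points can be identified with words, and a single
shift orbit is a single cycle. -/
theorem isCycle_of_minimalPeriod (hn : 2 ≤ n) (h : Compatible σ a) {i : Fin n}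
    (hp : Function.minimalPeriod BWord.shift (cycleWord h i) = n)
    (hM : cycleWords ⟨(σ, a), h⟩ = orbitMultiset BWord.shift n (cycleWord h i)) :
    σ.IsCycle ∧ σ.support = Finset.univ := by
  have hnd : (cycleWords ⟨(σ, a), h⟩).Nodup := by
    have := nodup_orbitMultiset_minimalPeriod (s := BWord.shift) (cycleWord h i)
    rwa [hp, ← hM] at this
  have hinj : Function.Injective (cycleWord h) := fun x y hxy =>
    Multiset.inj_on_of_nodup_map hnd x (Finset.mem_univ x) y (Finset.mem_univ y) hxy
  have hall : ∀ x, ∃ k : ℕ, (σ ^ k) i = x := by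
    intro x
    have hx : cycleWord h x ∈ cycleWords ⟨(σ, a), h⟩ :=
      Multiset.mem_map_of_mem _ (Finset.mem_univ x)
    rw [hM] at hx
    obtain ⟨k, _, hk⟩ := Multiset.mem_map.1 hx
    rw [iterate_shift_cycleWord] at hk
    exact ⟨k, hinj hk⟩
  have hne : ∀ x, σ x ≠ x := by
    intro x hx
    have hfix : ∀ k : ℕ, (σ ^ k) x = x := fun k => Equiv.Perm.pow_apply_eq_self_of_apply_eq_self hx k
    have hix : x = i := by
      obtain ⟨k, hk⟩ := hall x
      exact ((σ ^ k).injective (hk.trans (hfix k).symm)).symm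
    subst hix
    have : ∀ y, y = x := fun y => by
      obtain ⟨k, hk⟩ := hall y
      rw [← hk, hfix]
    have h1 := this ⟨0, by omega⟩
    have h2 := this ⟨1, by omega⟩
    have h3 := congrArg Fin.val (h1.trans h2.symm)
    simp at h3
  refine ⟨⟨i, hne i, fun y _ => ?_⟩, Finset.eq_univ_iff_forall.2 fun x =>
    Equiv.Perm.mem_support.2 (hne x)⟩
  obtain ⟨k, hk⟩ := hall y
  exact ⟨k, by rw [zpow_natCast]; exact hk⟩

end Cycle

/-- Cycle type Eulerian quasisymmetric functions of the one-part partition count primitive circular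
words with a starting point. -/
theorem mul_coeff_cycleTypeEulerianQ (hn : 2 ≤ n) {m : ℕ+ →₀ ℕ} (hm : m.degree = n) (j : ℕ) :
    n * MvPowerSeries.coeff m (cycleTypeEulerianQ (Nat.Partition.indiscrete n) j) =
      primCount BWord.shift BWord.weight n (m.optionElim j) := by
  classical
  have hcoeff : MvPowerSeries.coeff m (cycleTypeEulerianQ (Nat.Partition.indiscrete n) j) =
      Nat.card (CompatiblePair n (fun σ => exc σ = j ∧ σ.IsCycle ∧ σ.support = Finset.univ) m) := by
    rw [← coeff_sum_fundamental, cycleTypeEulerianQ]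
    simp only [Nat.cast_inj, hasCycleType_indiscrete_iff hn]
    congr!
  rw [hcoeff, ← Nat.cast_mul, ← Nat.card_fin n, ← Nat.card_prod, Nat.card_fin, primCount]
  -- A starting point on an `n`-cycle with a compatible coloring is sent to the word read from that
  -- point; the starting points account for the factor `n`.
  refine congrArg _ (Nat.card_eq_of_bijective (fun x => ⟨cycleWord x.2.2.1 x.1,
    minimalPeriod_cycleWord x.2.2.1 x.2.2.2.2.2.1 x.2.2.2.2.2.2 x.1, ?_⟩) ⟨?_, ?_⟩)
  · rw [← sum_map_orbitMultiset,
      orbitMultiset_cycleWord x.2.2.1 x.2.2.2.2.2.1 x.2.2.2.2.2.2 x.1, sum_map_weight_cycleWords,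
      optionElim_inj]
    exact ⟨x.2.2.2.1, x.2.2.2.2.1⟩
  · rintro ⟨i, ⟨⟨σ, a⟩, hp⟩⟩ ⟨i', ⟨⟨σ', a'⟩, hp'⟩⟩ h
    have hw : cycleWord hp.1 i = cycleWord hp'.1 i' := congrArg Subtype.val h
    have h1 := orbitMultiset_cycleWord hp.1 hp.2.2.2.1 hp.2.2.2.2 i
    rw [hw, orbitMultiset_cycleWord hp'.1 hp'.2.2.2.1 hp'.2.2.2.2 i'] at h1
    have h2 := congrArg Subtype.val (cycleWords_injective h1)
    simp only [Prod.mk.injEq] at h2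
    obtain ⟨rfl, rfl⟩ := h2
    have hi : σ' i' ≠ i' := Equiv.Perm.mem_support.1 (hp.2.2.2.2 ▸ Finset.mem_univ i')
    have hi' : σ' i ≠ i := Equiv.Perm.mem_support.1 (hp.2.2.2.2 ▸ Finset.mem_univ i)
    obtain ⟨k, rfl⟩ := hp.2.2.2.1.exists_pow_eq hi hi'
    rw [pow_apply_eq_of_cycleWord_eq hp.1 hw]
  · rintro ⟨w, hw, hwt⟩
    have hper : BWord.shift^[n] w = w := by
      conv_lhs => rw [← hw]
      exact Function.iterate_minimalPeriod
    obtain ⟨⟨⟨σ, a⟩, hp⟩, hM⟩ := exists_cycleWords_eq (card_orbitMultiset n w) (map_orbitMultiset hper)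
    have hmem : w ∈ cycleWords ⟨(σ, a), hp⟩ := by
      rw [hM]
      exact Multiset.mem_map.2 ⟨0, Multiset.mem_range.2 (by omega), rfl⟩
    obtain ⟨i, _, rfl⟩ := Multiset.mem_map.1 hmem
    have hsum := sum_map_weight_cycleWords ⟨(σ, a), hp⟩
    rw [hM, sum_map_orbitMultiset, hwt, optionElim_inj] at hsum
    exact ⟨⟨i, ⟨(σ, a), hp, hsum.1.symm, hsum.2.symm, isCycle_of_minimalPeriod hn hp hw hM⟩⟩, rfl⟩

theorem coeff_sum_fundamental_of_degree_ne {P : Equiv.Perm (Fin n) → Prop} {m : ℕ+ →₀ ℕ}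
    (hm : m.degree ≠ n) : Nat.card (CompatiblePair n P m) = 0 := by
  have : IsEmpty (CompatiblePair n P m) := ⟨fun p => hm p.degree_eq⟩
  exact Nat.card_of_isEmpty

end Count

end

/-! ### Power series with a bar variable: Euler derivation, restriction to finitely many variables,
supports -/

open MvPowerSeries

/-- Formal power series in a variable `none` that counts bars and variables `some i`. -/
abbrev Series : Type := MvPowerSeries (Option ℕ+) ℚ

namespace Series

/-- The Euler derivation in the variables other than `none`. -/
def euler : Derivation ℚ Series Series :=
  Derivation.mk'
    { toFun := fun f μ => Weight.size μ * coeff μ f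
      map_add' := fun f g => funext fun μ => by
        change _ * coeff μ (f + g) = _ * coeff μ f + _ * coeff μ g
        rw [map_add, mul_add]
      map_smul' := fun c f => funext fun μ => by
        change _ * coeff μ (c • f) = c * (_ * coeff μ f)
        rw [coeff_smul, mul_left_comm] }
    fun f g => by
      ext μ
      change Weight.size μ * coeff μ (f * g) = _
      rw [map_add, smul_eq_mul, smul_eq_mul, mul_comm g, coeff_mul, coeff_mul, coeff_mul,
        ← Finset.sum_add_distrib, Finset.mul_sum]
      refine Finset.sum_congr rfl fun x hx => ?_
      rw [← Finset.HasAntidiagonal.mem_antidiagonal.1 hx, map_add]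
      change _ = coeff x.1 f * (Weight.size x.2 * coeff x.2 g) +
        Weight.size x.1 * coeff x.1 f * coeff x.2 g
      push_cast
      ring

theorem coeff_euler (f : Series) (μ : Weight) :
    coeff μ (euler f) = Weight.size μ * coeff μ f := rfl

theorem euler_X_some (i : ℕ+) : euler (X (some i) : Series) = X (some i) := by
  classical
  ext μ
  rw [coeff_euler, coeff_X]
  split_ifs with h
  · rw [h, Weight.size]; simp
  · rw [mul_zero]

theorem euler_X_none : euler (X none : Series) = 0 := by
  classical
  ext μ
  rw [coeff_euler, coeff_X, coeff_zero]
  split_ifs with h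
  · rw [h, Weight.size]; simp
  · rw [mul_zero]

open Classical in
/-- The substitution of zero for the variables outside `F`. -/
def cut (F : Finset ℕ+) : Series →+* Series where
  toFun f μ := if μ.some.support ⊆ F then coeff μ f else 0
  map_zero' := funext fun μ => by rw [coeff_zero, ite_self]; rfl
  map_one' := by
    ext μ
    change (if μ.some.support ⊆ F then coeff μ (1 : Series) else 0) = _
    rw [coeff_one]
    split_ifs with h1 h2 h2
    · rfl
    · rfl
    · subst h2; simp at h1
    · rfl
  map_add' f g := funext fun μ => by
    change _ = (if μ.some.support ⊆ F then coeff μ f else 0) +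
      (if μ.some.support ⊆ F then coeff μ g else 0)
    rw [map_add]
    split_ifs
    · rfl
    · rw [add_zero]
  map_mul' f g := by
    ext μ
    refine Eq.trans ?_ (coeff_mul μ _ _).symm
    change (if μ.some.support ⊆ F then coeff μ (f * g) else 0) =
      ∑ x ∈ Finset.HasAntidiagonal.antidiagonal μ, (if x.1.some.support ⊆ F then coeff x.1 f else 0) *
        (if x.2.some.support ⊆ F then coeff x.2 g else 0)
    rw [coeff_mul]
    have hx : ∀ x ∈ Finset.HasAntidiagonal.antidiagonal μ,
        (μ.some.support ⊆ F ↔ x.1.some.support ⊆ F ∧ x.2.some.support ⊆ F) := by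
      intro x hx
      rw [← Finset.HasAntidiagonal.mem_antidiagonal.1 hx, Finsupp.some_add, ← Finset.union_subset_iff]
      have : (x.1.some + x.2.some).support = x.1.some.support ∪ x.2.some.support := by
        ext i
        simp only [Finsupp.mem_support_iff, Finset.mem_union, Finsupp.add_apply]
        omega
      rw [this]
    split_ifs with h
    · refine Finset.sum_congr rfl fun x hx' => ?_
      rw [if_pos ((hx x hx').1 h).1, if_pos ((hx x hx').1 h).2]
    · refine (Finset.sum_eq_zero fun x hx' => ?_).symm
      have := mt (hx x hx').2 h
      rw [not_and_or] at this
      rcases this with h1 | h1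
      · rw [if_neg h1, zero_mul]
      · rw [if_neg h1, mul_zero]

open Classical in
theorem coeff_cut (F : Finset ℕ+) (f : Series) (μ : Weight) :
    coeff μ (cut F f) = if μ.some.support ⊆ F then coeff μ f else 0 := rfl

theorem cut_euler (F : Finset ℕ+) (f : Series) : cut F (euler f) = euler (cut F f) := by
  ext μ
  rw [coeff_cut, coeff_euler, coeff_euler, coeff_cut, mul_ite, mul_zero]

theorem cut_X_none (F : Finset ℕ+) : cut F (X none : Series) = X none := by
  classical
  ext μ
  rw [coeff_cut, coeff_X]
  by_cases h : μ = Finsupp.single none 1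
  · rw [h]; simp
  · simp [h]

/-- The vanishing of the coefficients outside a set of exponents. -/
def SupportedOn (P : Weight → Prop) (f : Series) : Prop := ∀ μ, ¬ P μ → coeff μ f = 0

theorem SupportedOn.mul {P Q R : Weight → Prop} (hPQ : ∀ μ ν, P μ → Q ν → R (μ + ν)) {f g : Series}
    (hf : SupportedOn P f) (hg : SupportedOn Q g) : SupportedOn R (f * g) := by
  classical
  intro μ hμ
  rw [coeff_mul]
  refine Finset.sum_eq_zero fun x hx => ?_
  by_cases h1 : P x.1
  · rw [hg x.2 fun h2 => hμ (Finset.HasAntidiagonal.mem_antidiagonal.1 hx ▸ hPQ _ _ h1 h2), mul_zero]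
  · rw [hf x.1 h1, zero_mul]

/-- Induction on the degree. At an exponent outside `P` the product `f * f⁻¹` has coefficient zero,
and every term other than the constant one of `f` vanishes, because `P` is closed under addition. -/
theorem SupportedOn.inv {P : Weight → Prop} (hP : ∀ μ ν, P μ → P ν → P (μ + ν)) (hP0 : P 0)
    {f : Series} (hf : SupportedOn P f) (h0 : constantCoeff f ≠ 0) : SupportedOn P f⁻¹ := by
  classical
  intro μ
  induction hd : μ.degree using Nat.strong_induction_on generalizing μ with
  | _ d ih =>
    intro hμ
    have hne : μ ≠ 0 := fun h => hμ (h ▸ hP0)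
    have h1 : coeff μ (f * f⁻¹) = 0 := by
      rw [MvPowerSeries.mul_inv_cancel f h0, coeff_one, if_neg hne]
    rw [coeff_mul, ← Finset.add_sum_erase _ _ (Finset.HasAntidiagonal.mem_antidiagonal.2
      (zero_add μ) : (0, μ) ∈ Finset.HasAntidiagonal.antidiagonal μ), Finset.sum_eq_zero, add_zero,
      coeff_zero_eq_constantCoeff_apply] at h1
    · exact (mul_eq_zero.1 h1).resolve_left h0
    · intro x hx
      obtain ⟨hx0, hx⟩ := Finset.mem_erase.1 hx
      have hadd := Finset.HasAntidiagonal.mem_antidiagonal.1 hx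
      by_cases hx1 : P x.1
      · have hx2 : ¬ P x.2 := fun h => hμ (hadd ▸ hP _ _ hx1 h)
        have hne1 : x.1 ≠ 0 := fun h => hx0 (Prod.ext h (by simpa [h] using hadd))
        have hdeg : x.2.degree < d := by
          rw [← hd, ← hadd, map_add]
          have := (Finsupp.degree_eq_zero_iff x.1).not.2 hne1
          omega
        rw [ih _ hdeg _ rfl hx2, mul_zero]
      · rw [hf _ hx1, zero_mul]

end Series

/-! ### The determinant of the transfer matrix and its logarithmic derivative -/

section

namespace Series

section Determinant

variable {ι : Type} [Fintype ι] [LinearOrder ι]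

/-- The transfer matrix: an unbarred letter is followed by letters that are not smaller, a barred
letter by letters that are not larger. -/
def transfer (y : ι → Series) : Matrix ι ι Series :=
  Matrix.of fun p q => y p * ((if p ≤ q then 1 else 0) + if q ≤ p then X none else 0)

/-- The characteristic determinant of the transfer matrix. -/
def transferDet (y : ι → Series) : Series := (1 - transfer y).det

/-- Adding `l y_p` to every entry of row `p` is a rank-one perturbation, so the determinant `D(l)`
is affine in `l`. At `l = 1` the matrix is lower triangular with diagonal `1 - t y_i`, at `l = t`
upper triangular with diagonal `1 - y_i`, where `t = X none`. The value at zero follows from `(1 -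
t) D(0) = D(t) - t D(1)`. -/
theorem mul_transferDet (y : ι → Series) (hy : ∀ i, constantCoeff (y i) = 0) :
    (1 - X none) * transferDet y = ∏ i, (1 - y i) - X none * ∏ i, (1 - X none * y i) := by
  rw [transferDet]
  have hunit : IsUnit (1 - transfer y).det := by
    rw [MvPowerSeries.isUnit_iff_constantCoeff, RingHom.map_det]
    have : (constantCoeff (σ := Option ℕ+) (R := ℚ)).mapMatrix (1 - transfer y) = 1 := by
      ext p q
      rw [RingHom.mapMatrix_apply, Matrix.map_apply, Matrix.sub_apply, map_sub, transfer,
        Matrix.of_apply, map_mul, hy, zero_mul, sub_zero, Matrix.one_apply, Matrix.one_apply]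
      split_ifs <;> simp
    rw [this, Matrix.det_one]
    exact isUnit_one
  have haff : ∃ c, ∀ l : Series, (1 - transfer y + Matrix.of fun p _ => l * y p).det =
      (1 - transfer y).det + l * c := by
    let v : Matrix Unit ι Series := Matrix.replicateRow Unit fun _ => 1
    refine ⟨(1 - transfer y).det * (v * (1 - transfer y)⁻¹ * Matrix.replicateCol Unit y) () (),
      fun l => ?_⟩
    have h : (Matrix.of fun p (_ : ι) => l * y p : Matrix ι ι Series) =
        Matrix.replicateCol Unit y * (l • v) := by
      refine Matrix.ext fun p q => ?_
      rw [Matrix.mul_apply]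
      simp [v, mul_comm]
    rw [h, Matrix.det_add_mul _ _ hunit, Matrix.det_unique (n := Unit), Matrix.smul_mul, Matrix.smul_mul,
      Matrix.add_apply, Matrix.smul_apply, Matrix.one_apply, if_pos rfl, mul_add, mul_one, smul_eq_mul,
      mul_left_comm]
  obtain ⟨c, hc⟩ := haff
  have h1 : (1 - transfer y + Matrix.of fun p _ => 1 * y p).det = ∏ i, (1 - X none * y i) := by
    rw [Matrix.det_of_isLowerTriangular]
    · refine Finset.prod_congr rfl fun i _ => ?_
      simp [transfer]
      ring
    · intro p q hpq
      have hlt : p < q := hpq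
      simp [transfer, hlt.ne, hlt.le, hlt.not_ge]
  have h2 : (1 - transfer y + Matrix.of fun p _ => X none * y p).det = ∏ i, (1 - y i) := by
    rw [Matrix.det_of_isUpperTriangular]
    · refine Finset.prod_congr rfl fun i _ => ?_
      simp [transfer]
      ring
    · intro p q hpq
      have hlt : q < p := hpq
      simp [transfer, hlt.ne', hlt.le, hlt.not_ge]
      ring
  rw [← h1, ← h2, hc, hc]
  ring

theorem one_sub_X_none_ne_zero : (1 - X none : Series) ≠ 0 := fun h => by
  have := congrArg constantCoeff h
  simp at this

theorem transfer_update (y : ι → Series) (i : ι) :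
    (1 - transfer y).updateRow i (Pi.single i 1) = 1 - transfer (Function.update y i 0) := by
  refine Matrix.ext fun p q => ?_
  rw [Matrix.updateRow_apply, Matrix.sub_apply, Matrix.sub_apply, transfer, transfer,
    Matrix.of_apply, Matrix.of_apply]
  by_cases h : p = i
  · rw [if_pos h, h, Function.update_self, zero_mul, sub_zero, Matrix.one_apply, Pi.single_apply]
    simp only [eq_comm]
  · rw [if_neg h, Function.update_of_ne h]

/-- The trace of the resolvent as a logarithmic derivative. -/
theorem sum_resolvent_mul_det {e : ι → ℕ+} {y : ι → Series} (hy : y = fun i => X (some (e i)))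
    {G : Matrix ι ι Series} (hG : (1 - transfer y) * G = 1) :
    (∑ i, (G i i - 1)) * transferDet y = - euler (transferDet y) := by
  have hc : ∀ i, constantCoeff (y i) = 0 := fun i => by rw [hy]; simp
  -- Cramer's rule: the product is a principal minor, that is, the determinant with `y i` set to
  -- zero.
  have hdiag : ∀ i, G i i * transferDet y = transferDet (Function.update y i 0) := by
    intro i
    rw [transferDet, transferDet]
    have : (1 - transfer y).adjugate = (1 - transfer y).det • G := by
      have h := congrArg (fun A => (1 - transfer y).adjugate * A) hG
      simp only [mul_one] at h
      rw [← h, ← mul_assoc, Matrix.adjugate_mul, Matrix.smul_mul, one_mul]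
    rw [← transfer_update, ← Matrix.adjugate_apply, this, Matrix.smul_apply, smul_eq_mul, mul_comm]
  have hprod : ∀ (s : Series) (i : ι), ∏ k, (1 - s * Function.update y i 0 k) =
      ∏ k ∈ Finset.univ.erase i, (1 - s * y k) := by
    intro s i
    rw [← Finset.mul_prod_erase _ _ (Finset.mem_univ i), Function.update_self, mul_zero, sub_zero,
      one_mul]
    exact Finset.prod_congr rfl fun k hk => by rw [Function.update_of_ne (Finset.ne_of_mem_erase hk)]
  have heuler : ∀ (s : Series), euler s = 0 → ∀ t : Finset ι, euler (∏ k ∈ t, (1 - s * y k)) =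
      - ∑ i ∈ t, s * y i * ∏ k ∈ t.erase i, (1 - s * y k) := by
    intro s hs t
    induction t using Finset.induction_on with
    | empty => simp
    | insert i t hi ih =>
      rw [Finset.prod_insert hi, Derivation.leibniz, ih, Finset.sum_insert hi,
        Finset.erase_insert hi]
      have h1 : euler (1 - s * y i) = - (s * y i) := by
        rw [map_sub, Derivation.leibniz, hs, hy]
        simp only [euler_X_some]
        simp
      have h2 : ∑ k ∈ t, s * y k * ∏ l ∈ (insert i t).erase k, (1 - s * y l) =
          (1 - s * y i) * ∑ k ∈ t, s * y k * ∏ l ∈ t.erase k, (1 - s * y l) := by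
        rw [Finset.mul_sum]
        refine Finset.sum_congr rfl fun k hk => ?_
        have hki : k ≠ i := fun h => hi (h ▸ hk)
        rw [Finset.erase_insert_of_ne hki.symm, Finset.prod_insert fun h => hi (Finset.mem_of_mem_erase h)]
        ring
      rw [h1, h2]
      simp only [smul_eq_mul]
      ring
  have hy' := mul_transferDet y hc
  apply mul_left_cancel₀ one_sub_X_none_ne_zero
  have he : (1 - X none) * euler (transferDet y) =
      euler (∏ i, (1 - y i) - X none * ∏ i, (1 - X none * y i)) := by
    rw [← hy', Derivation.leibniz, map_sub, euler_X_none, Derivation.map_one_eq_zero, sub_zero, smul_zero,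
      add_zero, smul_eq_mul]
  have e1 := heuler 1 (by simp) Finset.univ
  have e2 := heuler (X none) euler_X_none Finset.univ
  simp only [one_mul] at e1
  rw [mul_neg, he, map_sub, Derivation.leibniz, e1, e2, euler_X_none, Finset.sum_mul,
    Finset.mul_sum]
  -- Setting `y i = 0` deletes one factor from each product of the determinant formula. The
  -- differences, summed over `i`, are what the Euler derivation produces from these products.
  have hterm : ∀ i, (1 - X none) * ((G i i - 1) * transferDet y) =
      y i * ∏ k ∈ Finset.univ.erase i, (1 - y k) -
        X none * (X none * y i * ∏ k ∈ Finset.univ.erase i, (1 - X none * y k)) := by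
    intro i
    have hc' : ∀ k, constantCoeff (Function.update y i 0 k) = 0 := by
      intro k
      by_cases h : k = i
      · subst h; simp
      · rw [Function.update_of_ne h, hc]
    have h3 := mul_transferDet _ hc'
    have h4 := hprod 1 i
    simp only [one_mul] at h4
    rw [hprod, h4] at h3
    rw [sub_mul (G i i), hdiag, one_mul, mul_sub (1 - X none : Series), h3, hy', ← Finset.mul_prod_erase _ _ (Finset.mem_univ i),
      ← Finset.mul_prod_erase Finset.univ (fun k => 1 - X none * y k) (Finset.mem_univ i)]
    ring
  simp only [hterm, Finset.sum_sub_distrib, ← Finset.mul_sum]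
  simp only [smul_eq_mul]
  ring

end Determinant

end Series

end

/-! ### Walks through letters and the resolvent of the transfer matrix -/

namespace Letter

/-- The letters of absolute value `q` may follow the letter. -/
def Follows (l : Letter) (q : ℕ+) : Prop := if l.plain then l.ab ≤ q else q ≤ l.ab

/-- The letter of given absolute value. -/
def of (p : ℕ+) (b : Bool) : Letter := toLex (OrderDual.toDual p, b)

end Letter

/-- The sequences of letters that start at the absolute value `p` and may be followed by the
absolute value `q`. -/
def IsWalk : ℕ+ → List Letter → ℕ+ → Prop
  | p, [], q => p = q
  | p, l :: ls, q => l.ab = p ∧ ∃ p', l.Follows p' ∧ IsWalk p' ls q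

theorem IsWalk.start_unique {p p' q : ℕ+} {ls : List Letter} (h : IsWalk p ls q)
    (h' : IsWalk p' ls q) : p = p' := by
  cases ls with
  | nil => exact Eq.trans h (Eq.symm h')
  | cons l ls => exact h.1.symm.trans h'.1

/-- The weight of a sequence of letters. -/
def listWeight (ls : List Letter) : Weight := (ls.map Letter.weight).sum

theorem listWeight_cons (l : Letter) (ls : List Letter) :
    listWeight (l :: ls) = l.weight + listWeight ls := by
  rw [listWeight, List.map_cons, List.sum_cons]; rfl

theorem size_listWeight (ls : List Letter) : Weight.size (listWeight ls) = ls.length := by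
  induction ls with
  | nil => exact map_zero _
  | cons l ls ih => rw [listWeight_cons, map_add, ih, Letter.size_weight, List.length_cons, add_comm]

theorem Letter.some_weight (l : Letter) : l.weight.some = Finsupp.single l.ab 1 := by
  rw [Letter.weight, Finsupp.some_optionElim]

theorem support_some_add (μ ν : Weight) :
    (μ + ν).some.support = μ.some.support ∪ ν.some.support := by
  ext i
  simp only [Finsupp.some_add, Finsupp.mem_support_iff, Finset.mem_union, Finsupp.add_apply]
  omega

theorem Letter.ab_mem_support {l : Letter} {μ : Weight} (h : l.weight ≤ μ) :
    l.ab ∈ μ.some.support := by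
  obtain ⟨ν, rfl⟩ := le_iff_exists_add.1 h
  rw [support_some_add, l.some_weight]
  simp

theorem finite_listWeight_eq (μ : Weight) : {ls : List Letter | listWeight ls = μ}.Finite := by
  induction hn : Weight.size μ generalizing μ with
  | zero =>
    refine (Set.finite_singleton []).subset fun ls hls => ?_
    have := size_listWeight ls
    rw [show listWeight ls = μ from hls, hn] at this
    exact List.eq_nil_of_length_eq_zero this.symm
  | succ n ih =>
    have hL : {l : Letter | l.weight ≤ μ}.Finite := by
      refine ((μ.some.support ×ˢ (Finset.univ : Finset Bool)).finite_toSet.image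
        fun x => Letter.of x.1 x.2).subset fun l hl => ?_
      exact ⟨(l.ab, l.plain), by simpa using Letter.ab_mem_support hl, rfl⟩
    refine (hL.biUnion (t := fun l => (fun ls => l :: ls) '' {ls | listWeight ls = μ - l.weight ∧
      Weight.size (μ - l.weight) = n}) fun l _ => ?_).subset fun ls hls => ?_
    · by_cases h : Weight.size (μ - l.weight) = n
      · exact ((ih _ h).subset fun ls hls => hls.1).image _
      · simp [h]
    · have hls : listWeight ls = μ := hls
      cases ls with
      | nil =>
        have := size_listWeight []
        rw [hls, hn] at this
        simp at this
      | cons l ls =>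
        rw [listWeight_cons] at hls
        have hsub : listWeight ls = μ - l.weight := by rw [← hls, add_tsub_cancel_left]
        refine Set.mem_biUnion (x := l) (show l.weight ≤ μ from hls ▸ le_self_add)
          ⟨ls, ⟨hsub, ?_⟩, rfl⟩
        have h1 := congrArg Weight.size hls
        rw [map_add, Letter.size_weight, hn, hsub] at h1
        omega

namespace Series

/-- The generating function of walks. -/
def walks (p q : ℕ+) : Series := fun μ => Nat.card {ls // IsWalk p ls q ∧ listWeight ls = μ}

theorem coeff_walks (p q : ℕ+) (μ : Weight) :
    coeff μ (walks p q) = Nat.card {ls // IsWalk p ls q ∧ listWeight ls = μ} := rfl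

open Classical in
/-- The generating function of the first step of a walk. -/
def step (p p' : ℕ+) (b : Bool) : Series :=
  if (Letter.of p b).Follows p' then monomial (Letter.of p b).weight 1 else 0

theorem coeff_step_mul_walks (p p' q : ℕ+) (b : Bool) (μ : Weight) :
    coeff μ (step p p' b * walks p' q) = Nat.card {ls // (Letter.of p b).Follows p' ∧
      IsWalk p' ls q ∧ (Letter.of p b).weight + listWeight ls = μ} := by
  classical
  rw [step]
  split_ifs with h
  · rw [coeff_monomial_mul]
    split_ifs with hle
    · rw [one_mul, coeff_walks]
      refine congrArg _ (Nat.card_congr (Equiv.subtypeEquivRight fun ls => ?_))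
      refine ⟨fun hls => ⟨h, hls.1, ?_⟩, fun hls => ⟨hls.2.1, ?_⟩⟩
      · rw [hls.2, add_tsub_cancel_of_le hle]
      · rw [← hls.2.2, add_tsub_cancel_left]
    · have : IsEmpty {ls // (Letter.of p b).Follows p' ∧ IsWalk p' ls q ∧
          (Letter.of p b).weight + listWeight ls = μ} :=
        ⟨fun ls => hle (ls.2.2.2 ▸ le_self_add)⟩
      rw [Nat.card_of_isEmpty, Nat.cast_zero]
  · rw [zero_mul, coeff_zero]
    simp [h]

-- Decomposition by the first letter. The next absolute value stays in `F`, because it is either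
-- that of a letter of the walk, all of which lie in the support of `μ`, or the endpoint `q`.
open Classical in
theorem coeff_walks_eq {F : Finset ℕ+} (p : ℕ+) {q : ℕ+} (hq : q ∈ F) {μ : Weight}
    (hμ : μ.some.support ⊆ F) : coeff μ (walks p q) =
      coeff μ ((if p = q then 1 else 0) + ∑ p' : F, ∑ b, step p p' b * walks p' q : Series) := by
  have h0 : coeff μ (if p = q then 1 else 0 : Series) = Nat.card {_x : Unit // p = q ∧ μ = 0} := by
    by_cases h1 : p = q
    · by_cases h2 : μ = 0
      · simp [h1, h2]
      · simp [h1, h2, coeff_one]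
    · simp [h1]
  rw [map_add, h0, map_sum]
  simp only [map_sum, coeff_step_mul_walks]
  have hfin : ∀ (p' : F) (b : Bool), Finite {ls // (Letter.of p b).Follows p' ∧
      IsWalk p' ls q ∧ (Letter.of p b).weight + listWeight ls = μ} := fun p' b =>
    ((finite_listWeight_eq (μ - (Letter.of p b).weight)).subset fun ls hls => by
      change listWeight ls = _
      rw [← hls.2.2, add_tsub_cancel_left]).to_subtype
  simp only [← Nat.cast_sum, ← Nat.cast_add, ← Nat.card_sigma, ← Nat.card_sum]
  rw [coeff_walks, Nat.cast_inj]
  symm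
  refine Nat.card_eq_of_bijective (Sum.elim (fun x => ⟨[], x.2.1, x.2.2.symm⟩) fun y =>
    ⟨Letter.of p y.2.1 :: y.2.2.1, ⟨rfl, y.1, y.2.2.2.1, y.2.2.2.2.1⟩,
      (listWeight_cons _ _).trans y.2.2.2.2.2⟩) ⟨?_, ?_⟩
  · rintro (⟨⟨⟩, h⟩ | ⟨p', b, ls, h⟩) (⟨⟨⟩, h'⟩ | ⟨p'', b', ls', h'⟩) heq
    · rfl
    · exact absurd (congrArg Subtype.val heq) (List.cons_ne_nil _ _).symm
    · exact absurd (congrArg Subtype.val heq) (List.cons_ne_nil _ _)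
    · have heq := congrArg Subtype.val heq
      simp only [Sum.elim_inr, List.cons.injEq] at heq
      obtain ⟨hb, rfl⟩ := heq
      obtain rfl : b = b' := congrArg Letter.plain hb
      obtain rfl : p' = p'' := Subtype.ext (h.2.1.start_unique h'.2.1)
      rfl
  · rintro ⟨ls, hw, hls⟩
    cases ls with
    | nil => exact ⟨Sum.inl ⟨(), hw, hls.symm⟩, rfl⟩
    | cons l ls =>
      obtain ⟨hl, p', hp', hw⟩ := hw
      have hl' : l = Letter.of p l.plain := Letter.ext hl rfl
      have hp'F : p' ∈ F := by
        cases ls with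
        | nil => exact (show p' = q from hw) ▸ hq
        | cons l' ls =>
          obtain rfl : l'.ab = p' := hw.1
          refine hμ (Letter.ab_mem_support ?_)
          rw [← hls, listWeight_cons, listWeight_cons, add_left_comm]
          exact le_self_add
      rw [listWeight_cons] at hls
      refine ⟨Sum.inr ⟨⟨p', hp'F⟩, l.plain, ls, hl' ▸ hp', hw, hl' ▸ hls⟩, ?_⟩
      refine Subtype.ext ?_
      exact congrArg (· :: ls) hl'.symm

theorem cut_X_some {F : Finset ℕ+} {p : ℕ+} (hp : p ∈ F) :
    cut F (X (some p) : Series) = X (some p) := by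
  classical
  ext μ
  rw [coeff_cut, coeff_X]
  by_cases h : μ = Finsupp.single (some p) 1
  · rw [h]
    simp only [Finsupp.some_single_some]
    rw [if_pos]
    exact Finsupp.support_single_subset.trans (Finset.singleton_subset_iff.2 hp)
  · simp [h]

theorem sum_step (p p' : ℕ+) : ∑ b, step p p' b =
    (X (some p) : Series) * ((if p ≤ p' then 1 else 0) + if p' ≤ p then X none else 0) := by
  have h1 : (X (some p) : Series) = monomial (Letter.of p true).weight 1 := by
    rw [X]
    refine congrArg (fun w => monomial w 1) (Finsupp.ext fun i => ?_)
    cases i <;> simp [Letter.weight, Letter.of, Letter.ab, Letter.plain, Finsupp.single_apply]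
  have h2 : (X (some p) : Series) * X none = monomial (Letter.of p false).weight 1 := by
    rw [X, X, monomial_mul_monomial, one_mul]
    refine congrArg (fun w => monomial w 1) (Finsupp.ext fun i => ?_)
    cases i <;> simp [Letter.weight, Letter.of, Letter.ab, Letter.plain, Finsupp.single_apply]
  have h3 : (Letter.of p true).Follows p' ↔ p ≤ p' := Iff.rfl
  have h4 : (Letter.of p false).Follows p' ↔ p' ≤ p := Iff.rfl
  rw [Fintype.sum_bool, step, step, ← h1, ← h2, mul_add]
  simp only [h3, h4, mul_ite, mul_one, mul_zero]

/-- The matrix of the generating functions of walks is a resolvent. -/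
theorem one_sub_transfer_mul_walks (F : Finset ℕ+) :
    (1 - transfer fun i : F => (X (some i.1) : Series)) *
      (Matrix.of fun p q : F => cut F (walks p q)) = 1 := by
  refine Matrix.ext fun p q => ?_
  have h : cut F (walks p q) = cut F ((if p.1 = q.1 then 1 else 0) +
      ∑ p' : F, ∑ b, step p p' b * walks p' q : Series) := by
    ext μ
    rw [coeff_cut, coeff_cut]
    by_cases hμ : μ.some.support ⊆ F
    · rw [if_pos hμ, if_pos hμ]
      convert coeff_walks_eq p.1 q.2 hμ
    · rw [if_neg hμ, if_neg hμ]
  have h2 : cut F (if p.1 = q.1 then 1 else 0 : Series) = (1 : Matrix F F Series) p q := by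
    rw [Matrix.one_apply]
    by_cases hpq : p = q
    · rw [if_pos hpq, if_pos (congrArg _ hpq), map_one]
    · rw [if_neg hpq, if_neg fun hc => hpq (Subtype.ext hc), map_zero]
  rw [sub_mul, one_mul, Matrix.sub_apply, sub_eq_iff_eq_add, Matrix.of_apply, h, map_add, h2,
    Matrix.mul_apply, map_sum]
  congr 1
  refine Finset.sum_congr rfl fun p' _ => ?_
  rw [← Finset.sum_mul, sum_step, map_mul, map_mul, map_add, cut_X_some p.2, Matrix.of_apply]
  congr 1
  rw [transfer, Matrix.of_apply]
  congr 2
  · simp only [Subtype.coe_le_coe]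
    split_ifs <;> simp
  · simp only [Subtype.coe_le_coe]
    split_ifs <;> simp [cut_X_none]

end Series

/-! ### Closed words as closed walks -/

theorem isWalk_ofFn (f : ℕ → Letter) (d : ℕ) :
    IsWalk (f 0).ab (List.ofFn fun i : Fin d => f i) (f d).ab ↔
      ∀ k < d, (f k).Allowed (f (k + 1)) := by
  induction d generalizing f with
  | zero => simp [IsWalk]
  | succ d ih =>
    rw [List.ofFn_succ]
    have ih' := ih fun k => f (k + 1)
    constructor
    · rintro ⟨_, p', hp', hw⟩
      have hp : p' = (f 1).ab := by
        rcases d with _ | d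
        · exact hw
        · rw [List.ofFn_succ] at hw
          exact hw.1.symm
      subst hp
      intro k hk
      rcases k with _ | k
      · exact hp'
      · exact ih'.1 hw k (by omega)
    · intro h
      exact ⟨rfl, (f 1).ab, h 0 (Nat.succ_pos d), ih'.2 fun k hk => h (k + 1) (by omega)⟩

theorem listWeight_ofFn (f : ℕ → Letter) (d : ℕ) :
    listWeight (List.ofFn fun i : Fin d => f i) = ∑ i ∈ Finset.range d, (f i).weight := by
  rw [listWeight, List.map_ofFn, List.sum_ofFn]
  exact Fin.sum_univ_eq_sum_range (fun i => (f i).weight) d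

theorem Letter.weight_none (l : Letter) : l.weight none = if l.plain then 0 else 1 := by
  rw [Letter.weight, Finsupp.optionElim_apply_none]

namespace BWord

theorem orbitWeight_eq (w : BWord) (d : ℕ) :
    orbitWeight shift weight d w = ∑ i ∈ Finset.range d, (w.get i).weight := by
  refine Finset.sum_congr rfl fun i _ => ?_
  rw [weight, get_iterate_shift, zero_add]

theorem get_add_of_iterate_eq {w : BWord} {d : ℕ} (h : shift^[d] w = w) (k : ℕ) :
    w.get (k + d) = w.get k := by
  rw [← get_iterate_shift, h]

theorem get_mod {w : BWord} {d : ℕ} (h : shift^[d] w = w) (k : ℕ) : w.get (k % d) = w.get k :=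
  Function.Periodic.map_mod_nat (f := w.get) (get_add_of_iterate_eq h) k

/-- An unbarred letter occurs somewhere, hence within each period. -/
theorem orbitWeight_none_lt {w : BWord} {d : ℕ} (hd : d ≠ 0) (h : shift^[d] w = w) :
    orbitWeight shift weight d w none < d := by
  obtain ⟨k, _, hk⟩ := w.2.2 0
  have hk' : (w.get (k % d)).plain = true := by rw [get_mod h]; exact hk
  rw [orbitWeight_eq, Finsupp.finsetSum_apply]
  calc _ < ∑ _i ∈ Finset.range d, 1 := Finset.sum_lt_sum (fun i _ => ?_)
        ⟨k % d, Finset.mem_range.2 (Nat.mod_lt _ (Nat.pos_of_ne_zero hd)), ?_⟩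
    _ = d := by simp
  · rw [Letter.weight_none]; split_ifs <;> omega
  · rw [Letter.weight_none, if_pos hk']; exact one_pos

/-- The periodic word with a given period. -/
def ofPeriodic (f : ℕ → Letter) (d : ℕ) (hf : ∀ k, f (k + d) = f k)
    (hall : ∀ k < d, (f k).Allowed (f (k + 1))) (hp : ∃ k < d, (f k).plain = true) : BWord :=
  ⟨toLex f, fun k => by
    obtain ⟨i, hi, _⟩ := hp
    have h1 : f k = f (k % d) := (Function.Periodic.map_mod_nat hf k).symm
    have h2 : f (k + 1) = f (k % d + 1) := by
      rw [← Function.Periodic.map_mod_nat hf (k + 1), ← Function.Periodic.map_mod_nat hf (k % d + 1),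
        Nat.mod_add_mod]
    change (f k).Allowed (f (k + 1))
    rw [h1, h2]
    exact hall _ (Nat.mod_lt _ (by omega)), fun N => by
    obtain ⟨i, hi, hplain⟩ := hp
    refine ⟨i + N * d, ?_, ?_⟩
    · exact (Nat.le_mul_of_pos_right N (by omega)).trans (Nat.le_add_left _ _)
    · have := (Function.Periodic.nat_mul (f := f) hf N) i
      change (f (i + N * d)).plain = true
      rw [show f (i + N * d) = f i from this]
      exact hplain⟩

/-- A word fixed by `d` shifts repeats its first `d` letters, which form a closed walk. Conversely,
having fewer bars than letters ensures that the repetition of a closed walk has infinitely many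
unbarred letters. -/
theorem closedCount_eq_sum_walks {F : Finset ℕ+} {μ : Weight} (hF : μ.some.support ⊆ F)
    (h0 : Weight.size μ ≠ 0) (hlt : μ none < Weight.size μ) :
    (closedCount shift weight (Weight.size μ) μ : ℚ) =
      ∑ p : F, coeff μ (Series.walks p p) := by
  set d := Weight.size μ with hd
  have hfin : ∀ p : F, Finite {ls // IsWalk p ls p ∧ listWeight ls = μ} := fun p =>
    ((finite_listWeight_eq μ).subset fun ls hls => hls.2).to_subtype
  simp only [Series.coeff_walks, ← Nat.cast_sum, ← Nat.card_sigma]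
  have hmem : ∀ {w : BWord}, orbitWeight shift weight d w = μ → (w.get 0).ab ∈ F := by
    intro w hw
    refine hF (Letter.ab_mem_support ?_)
    rw [← hw, orbitWeight_eq]
    exact Finset.single_le_sum (f := fun i => (w.get i).weight) (fun _ _ => zero_le)
      (Finset.mem_range.2 (Nat.pos_of_ne_zero h0))
  rw [closedCount, Nat.cast_inj]
  refine Nat.card_eq_of_bijective (fun w => ⟨⟨(w.1.get 0).ab, hmem w.2.2⟩,
    List.ofFn fun i : Fin d => w.1.get i, ?_, ?_⟩) ⟨?_, ?_⟩
  · have h := (isWalk_ofFn w.1.get d).2 fun k _ => w.1.2.1 k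
    have h1 := get_add_of_iterate_eq w.2.1 0
    rw [zero_add] at h1
    rwa [h1] at h
  · rw [listWeight_ofFn, ← orbitWeight_eq, w.2.2]
  · rintro ⟨w, hw⟩ ⟨w', hw'⟩ h
    refine Subtype.ext (BWord.ext fun k => ?_)
    have h1 : (List.ofFn fun i : Fin d => w.get i) = List.ofFn fun i : Fin d => w'.get i :=
      congrArg (fun y => y.2.1) h
    have h2 := congrFun (List.ofFn_injective h1) ⟨k % d, Nat.mod_lt _ (Nat.pos_of_ne_zero h0)⟩
    simp only at h2
    rw [← get_mod hw.1 k, ← get_mod hw'.1 k, h2]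
  · rintro ⟨p, ls, hw, hls⟩
    have hlen : ls.length = d := by rw [← size_listWeight, hls]
    let f : ℕ → Letter := fun k =>
      ls.get ⟨k % d, by rw [hlen]; exact Nat.mod_lt _ (Nat.pos_of_ne_zero h0)⟩
    have hf : ∀ k, f (k + d) = f k := fun k => by
      simp only [f, Nat.add_mod_right]
    have hls' : (List.ofFn fun i : Fin d => f i) = ls := by
      refine List.ext_get (by rw [List.length_ofFn, hlen]) fun i h1 h2 => ?_
      rw [List.get_ofFn]
      simp only [f]
      congr 2
      exact Nat.mod_eq_of_lt (h2.trans_eq hlen)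
    have hp : (f 0).ab = p := by
      have h1 := hw
      rw [← hls'] at h1
      obtain ⟨d', hd'⟩ := Nat.exists_eq_succ_of_ne_zero h0
      rw [hd', List.ofFn_succ] at h1
      exact h1.1
    have hall : ∀ k < d, (f k).Allowed (f (k + 1)) := by
      rw [← isWalk_ofFn, hls', hp]
      have : f d = f 0 := by simpa using hf 0
      rw [this, hp]
      exact hw
    have hsum : ∑ i ∈ Finset.range d, (f i).weight = μ := by
      rw [← listWeight_ofFn, hls', hls]
    have hplain : ∃ k < d, (f k).plain = true := by
      by_contra hc
      push Not at hc
      have h1 := DFunLike.congr_fun hsum none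
      rw [Finsupp.finsetSum_apply, Finset.sum_congr rfl (g := fun _ => 1)] at h1
      · simp at h1
        omega
      · intro i hi
        rw [Letter.weight_none, if_neg (hc i (Finset.mem_range.1 hi))]
    refine ⟨⟨ofPeriodic f d hf hall hplain, BWord.ext fun k => ?_, ?_⟩, ?_⟩
    · rw [get_iterate_shift]
      exact hf k
    · rw [orbitWeight_eq]
      exact hsum
    · exact Sigma.subtype_ext (Subtype.ext hp) hls'

end BWord

/-! ### Generating functions of marked multisets and of closed words -/

namespace Series

/-- The generating function of multisets. -/
def full : Series := fun μ => if μ none = 0 then 1 else 0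

/-- The generating function of multisets of barred elements. -/
def fullBar : Series := fun μ => if μ none = Weight.size μ then 1 else 0

/-- The generating function of multisets with a positive mark smaller than the size, enlarged by
`e`. -/
def marked (e : ℕ) : Series := fun μ => if 1 ≤ μ none ∧ μ none < Weight.size μ + e then 1 else 0

theorem coeff_full (μ : Weight) : coeff μ full = if μ none = 0 then 1 else 0 := rfl

theorem coeff_fullBar (μ : Weight) :
    coeff μ fullBar = if μ none = Weight.size μ then 1 else 0 := rfl

theorem coeff_marked (e : ℕ) (μ : Weight) :
    coeff μ (marked e) = if 1 ≤ μ none ∧ μ none < Weight.size μ + e then 1 else 0 := rfl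

theorem constantCoeff_full : constantCoeff full = 1 := by
  rw [← coeff_zero_eq_constantCoeff_apply, coeff_full]; simp

theorem constantCoeff_fullBar : constantCoeff fullBar = 1 := by
  rw [← coeff_zero_eq_constantCoeff_apply, coeff_fullBar]; simp

theorem constantCoeff_marked (e : ℕ) : constantCoeff (marked e) = 0 := by
  rw [← coeff_zero_eq_constantCoeff_apply, coeff_marked]; simp

theorem constantCoeff_one_sub_marked : constantCoeff (1 - marked 0) = 1 := by
  rw [map_sub, constantCoeff_marked, map_one, sub_zero]

theorem coeff_X_none_mul_zero (m : ℕ+ →₀ ℕ) (f : Series) :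
    coeff (m.optionElim 0) (X none * f) = 0 := by
  classical
  rw [X, coeff_monomial_mul, if_neg]
  intro h
  have := h none
  rw [Finsupp.optionElim_apply_none, Finsupp.single_eq_same] at this
  omega

theorem coeff_X_none_mul_succ (m : ℕ+ →₀ ℕ) (j : ℕ) (f : Series) :
    coeff (m.optionElim (j + 1)) (X none * f) = coeff (m.optionElim j) f := by
  have : m.optionElim (j + 1) = Finsupp.single none 1 + m.optionElim j := by
    rw [← Finsupp.optionElim_zero, ← Finsupp.optionElim_add, zero_add, add_comm j]
  rw [X, this, coeff_add_monomial_mul, one_mul]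

theorem ext_optionElim {f g : Series}
    (h : ∀ (m : ℕ+ →₀ ℕ) (j : ℕ), coeff (m.optionElim j) f = coeff (m.optionElim j) g) : f = g :=
  MvPowerSeries.ext fun μ => by
    have := h μ.some (μ none)
    rwa [Finsupp.optionElim_some] at this

theorem coeff_one_optionElim (m : ℕ+ →₀ ℕ) (j : ℕ) :
    coeff (m.optionElim j) (1 : Series) = if m.degree = 0 ∧ j = 0 then 1 else 0 := by
  classical
  rw [coeff_one]
  congr 1
  rw [Finsupp.degree_eq_zero_iff, ← optionElim_inj, Finsupp.optionElim_zero, Finsupp.single_zero]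

/-- A multiset of size `n ≥ 1` has marks `t + ⋯ + t^(n-1)`, and this sum times `1 - t` is `t - t^n`.
-/
theorem one_sub_X_none_mul_one_sub_marked :
    (1 - X none) * (1 - marked 0) = fullBar - X none * full := by
  refine ext_optionElim fun m j => ?_
  rw [sub_mul, one_mul, map_sub, map_sub, map_sub]
  rcases j with _ | j
  · rw [coeff_X_none_mul_zero, coeff_X_none_mul_zero, coeff_one_optionElim, coeff_marked,
      coeff_fullBar, Finsupp.optionElim_apply_none, Weight.size_optionElim]
    simp [eq_comm]
  · rw [coeff_X_none_mul_succ, coeff_X_none_mul_succ, map_sub, coeff_one_optionElim,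
      coeff_one_optionElim, coeff_marked, coeff_marked, coeff_fullBar, coeff_full,
      Finsupp.optionElim_apply_none, Finsupp.optionElim_apply_none, Weight.size_optionElim,
      Weight.size_optionElim]
    split_ifs <;> first | omega | (norm_num; done) | simp_all

/-- At size `n ≥ 1` this is `t + ⋯ + t^n = t + t (t + ⋯ + t^(n-1))`; at size zero both sides vanish.
-/
theorem marked_one : marked 1 = X none * full - X none * (1 - marked 0) := by
  refine ext_optionElim fun m j => ?_
  rw [map_sub]
  rcases j with _ | j
  · rw [coeff_X_none_mul_zero, coeff_X_none_mul_zero, coeff_marked, Finsupp.optionElim_apply_none]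
    simp
  · rw [coeff_X_none_mul_succ, coeff_X_none_mul_succ, map_sub, coeff_one_optionElim,
      coeff_marked, coeff_marked, coeff_full,
      Finsupp.optionElim_apply_none, Finsupp.optionElim_apply_none, Weight.size_optionElim,
      Weight.size_optionElim]
    split_ifs <;> first | omega | norm_num

/-- Multiplication by `1 -` (the letter `i`) removes the multisets that contain `i`, since the
coefficients do not change when the letter is added. After all `i ∈ F` only the empty multiset is
left. -/
theorem cut_mul_prod {f : Series} (hf0 : constantCoeff f = 1) (b : Bool)
    (hf : ∀ (i : ℕ+) ν, coeff ((Letter.of i b).weight + ν) f = coeff ν f)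
    (hf' : ∀ (i : ℕ+) μ, ¬ (Letter.of i b).weight ≤ μ → i ∈ μ.some.support → coeff μ f = 0)
    (hf'' : ∀ μ : Weight, μ.some = 0 → μ ≠ 0 → coeff μ f = 0) (F : Finset ℕ+) :
    cut F f * ∏ i ∈ F, (1 - monomial (Letter.of i b).weight 1) = 1 := by
  classical
  induction F using Finset.induction_on with
  | empty =>
    rw [Finset.prod_empty, mul_one]
    ext μ
    rw [coeff_cut, coeff_one]
    by_cases h : μ = 0
    · rw [if_pos h, h]
      simpa using hf0
    · rw [if_neg h]
      split_ifs with h'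
      · refine hf'' μ ?_ h
        simpa using h'
      · rfl
  | insert i F hi ih =>
    rw [Finset.prod_insert hi, ← mul_assoc]
    refine Eq.trans ?_ ih
    congr 1
    ext μ
    rw [mul_sub, mul_one, map_sub, coeff_mul_monomial, coeff_cut, coeff_cut, coeff_cut, mul_one]
    by_cases hle : (Letter.of i b).weight ≤ μ
    · obtain ⟨ν, rfl⟩ := le_iff_exists_add.1 hle
      have hnot : ¬ ((Letter.of i b).weight + ν).some.support ⊆ F := fun h =>
        hi (h (Letter.ab_mem_support (l := Letter.of i b) le_self_add))
      have hiff : ((Letter.of i b).weight + ν).some.support ⊆ insert i F ↔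
          ν.some.support ⊆ insert i F := by
        rw [support_some_add, Letter.some_weight, Finset.union_subset_iff]
        refine and_iff_right (Finsupp.support_single_subset.trans ?_)
        exact Finset.singleton_subset_iff.2 (Finset.mem_insert_self _ _)
      rw [if_pos hle, if_neg hnot, add_tsub_cancel_left, hf]
      simp only [hiff, sub_self]
    · rw [if_neg hle, sub_zero]
      by_cases hmem : i ∈ μ.some.support
      · rw [hf' i μ hle hmem, ite_self, ite_self]
      · have : μ.some.support ⊆ insert i F ↔ μ.some.support ⊆ F :=
          Finset.subset_insert_iff_of_notMem hmem
        simp only [this]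

theorem monomial_weight_true (i : ℕ+) :
    (monomial (Letter.of i true).weight 1 : Series) = X (some i) := by
  rw [X]
  refine congrArg (fun w => monomial w 1) (Finsupp.ext fun i => ?_)
  cases i <;> simp [Letter.weight, Letter.of, Letter.ab, Letter.plain, Finsupp.single_apply]

theorem monomial_weight_false (i : ℕ+) :
    (monomial (Letter.of i false).weight 1 : Series) = X none * X (some i) := by
  rw [X, X, monomial_mul_monomial, one_mul]
  refine congrArg (fun w => monomial w 1) (Finsupp.ext fun i => ?_)
  cases i <;> simp [Letter.weight, Letter.of, Letter.ab, Letter.plain, Finsupp.single_apply]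

theorem cut_inv_eq {F : Finset ℕ+} {f g : Series} (hf : constantCoeff f = 1)
    (h : cut F f * g = 1) : cut F f⁻¹ = g := by
  have h1 : cut F f * cut F f⁻¹ = 1 := by
    rw [← map_mul, MvPowerSeries.mul_inv_cancel f (by rw [hf]; exact one_ne_zero), map_one]
  calc cut F f⁻¹ = (cut F f * g) * cut F f⁻¹ := by rw [h, one_mul]
    _ = g * (cut F f * cut F f⁻¹) := by ring
    _ = g := by rw [h1, mul_one]

theorem cut_inv_full (F : Finset ℕ+) : cut F full⁻¹ = ∏ i ∈ F, (1 - X (some i)) := by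
  refine cut_inv_eq constantCoeff_full ?_
  simp only [← monomial_weight_true]
  refine cut_mul_prod constantCoeff_full true ?_ ?_ ?_ F
  · intro i ν
    rw [coeff_full, coeff_full, Finsupp.add_apply, Letter.weight_none,
      show (Letter.of i true).plain = true from rfl, if_pos rfl, zero_add]
  · intro i μ hle hi
    exfalso
    refine hle fun k => ?_
    rcases k with _ | k
    · rw [Letter.weight_none]; exact Nat.zero_le _
    · rw [← Finsupp.some_apply, Letter.some_weight]
      change Finsupp.single i 1 k ≤ _
      rw [Finsupp.single_apply]
      split_ifs with h
      · subst h
        exact Nat.one_le_iff_ne_zero.2 ((Finsupp.mem_support_iff (f := μ.some)).1 hi)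
      · exact Nat.zero_le _
  · intro μ h h'
    rw [coeff_full, if_neg]
    intro h0
    apply h'
    rw [← Finsupp.optionElim_some μ, h, h0, Finsupp.optionElim_zero, Finsupp.single_zero]

theorem cut_inv_fullBar (F : Finset ℕ+) :
    cut F fullBar⁻¹ = ∏ i ∈ F, (1 - X none * X (some i)) := by
  refine cut_inv_eq constantCoeff_fullBar ?_
  simp only [← monomial_weight_false]
  refine cut_mul_prod constantCoeff_fullBar false ?_ ?_ ?_ F
  · intro i ν
    rw [coeff_fullBar, coeff_fullBar, Finsupp.add_apply, Letter.weight_none,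
      show (Letter.of i false).plain = false from rfl, map_add, Letter.size_weight]
    simp
  · intro i μ hle hi
    rw [coeff_fullBar, if_neg]
    intro h0
    have hpos := Nat.one_le_iff_ne_zero.2 ((Finsupp.mem_support_iff (f := μ.some)).1 hi)
    refine hle fun k => ?_
    rcases k with _ | k
    · rw [Letter.weight_none, h0]
      have : μ.some i ≤ Weight.size μ := Finsupp.le_degree i μ.some
      change 1 ≤ _
      omega
    · rw [← Finsupp.some_apply, Letter.some_weight]
      change Finsupp.single i 1 k ≤ _
      rw [Finsupp.single_apply]
      split_ifs with h
      · subst h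
        exact hpos
      · exact Nat.zero_le _
  · intro μ h h'
    rw [coeff_fullBar, if_neg]
    intro h0
    apply h'
    have h1 : Weight.size μ = 0 := by
      change μ.some.degree = 0
      rw [h, map_zero]
    rw [← Finsupp.optionElim_some μ, h, h0, h1, Finsupp.optionElim_zero, Finsupp.single_zero]

/-- The generating function of all closed walks is a logarithmic derivative. -/
theorem sum_cut_walks (F : Finset ℕ+) : ∑ i : F, (cut F (walks i i) - 1) =
    cut F ((1 - marked 0)⁻¹ * euler (marked 0) + full⁻¹ * euler full +
      fullBar⁻¹ * euler fullBar) := by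
  have hD : (1 - marked 0) * (1 - marked 0)⁻¹ = 1 :=
    MvPowerSeries.mul_inv_cancel _ (by rw [constantCoeff_one_sub_marked]; exact one_ne_zero)
  have hH : full * full⁻¹ = 1 :=
    MvPowerSeries.mul_inv_cancel _ (by rw [constantCoeff_full]; exact one_ne_zero)
  have hHt : fullBar * fullBar⁻¹ = 1 :=
    MvPowerSeries.mul_inv_cancel _ (by rw [constantCoeff_fullBar]; exact one_ne_zero)
  set Δ := (1 - marked 0) * full⁻¹ * fullBar⁻¹ with hΔ
  -- The series `Δ = (1 - M) / (H H~)` and the determinant agree on `F`, because after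
  -- multiplication by `1 - t` both become `1/H - t/H~`.
  have hdet : cut F Δ = transferDet fun i : F => (X (some i.1) : Series) := by
    apply mul_left_cancel₀ one_sub_X_none_ne_zero
    rw [mul_transferDet _ fun i => by simp,
      Finset.prod_coe_sort F (fun i => 1 - (X (some i) : Series)),
      Finset.prod_coe_sort F (fun i => 1 - X none * (X (some i) : Series)),
      ← cut_inv_full, ← cut_inv_fullBar]
    have h1 : (1 - X none) * Δ = full⁻¹ - X none * fullBar⁻¹ := by
      rw [hΔ, ← mul_assoc, ← mul_assoc, one_sub_X_none_mul_one_sub_marked]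
      linear_combination full⁻¹ * hHt - X none * fullBar⁻¹ * hH
    have h2 := congrArg (cut F) h1
    rwa [map_mul (cut F) (1 - X none) Δ, map_sub, map_one, cut_X_none, map_sub,
      map_mul (cut F) (X none), cut_X_none] at h2
  have hne : cut F Δ ≠ 0 := fun h => by
    have h1 := congrArg (coeff 0) h
    rw [coeff_cut, Finsupp.some_zero, Finsupp.support_zero, if_pos (Finset.empty_subset _), hΔ,
      coeff_zero_eq_constantCoeff_apply, map_mul, map_mul, constantCoeff_one_sub_marked,
      constantCoeff_inv, constantCoeff_inv, constantCoeff_full, constantCoeff_fullBar] at h1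
    simp at h1
  have hinv : ∀ f : Series, f * f⁻¹ = 1 → euler f⁻¹ = - (f⁻¹ * f⁻¹ * euler f) := by
    intro f hf
    have h1 := congrArg euler hf
    rw [Derivation.leibniz, Derivation.map_one_eq_zero, smul_eq_mul, smul_eq_mul] at h1
    linear_combination f⁻¹ * h1 - euler f⁻¹ * hf
  have heuler : - euler Δ = Δ * ((1 - marked 0)⁻¹ * euler (marked 0) + full⁻¹ * euler full +
      fullBar⁻¹ * euler fullBar) := by
    rw [hΔ, Derivation.leibniz, Derivation.leibniz, map_sub, Derivation.map_one_eq_zero,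
      hinv _ hH, hinv _ hHt]
    simp only [smul_eq_mul]
    linear_combination - full⁻¹ * fullBar⁻¹ * euler (marked 0) * hD
  have hmain := sum_resolvent_mul_det (e := fun i : F => i.1) rfl (one_sub_transfer_mul_walks F)
  rw [← hdet] at hmain
  apply mul_right_cancel₀ hne
  refine Eq.trans hmain ?_
  rw [← cut_euler, ← map_neg, heuler, map_mul, mul_comm]

/-- The generating function of closed orbits of words. -/
def closedWords : Series := fun μ => if Weight.size μ = 0 then 0 else
  closedCount BWord.shift BWord.weight (Weight.size μ) μ

theorem coeff_closedWords (μ : Weight) : coeff μ closedWords = if Weight.size μ = 0 then 0 else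
  (closedCount BWord.shift BWord.weight (Weight.size μ) μ : ℚ) := rfl

/-- Bounds on the number of bars separate the logarithmic derivatives: fewer bars than letters here,
none for `full`, as many as letters for `fullBar`. In particular, exponents with fewer bars than
letters do not see `fullBar`. -/
theorem supportedOn_marked : SupportedOn (fun μ => μ none < Weight.size μ)
    ((1 - marked 0)⁻¹ * euler (marked 0)) := by
  refine SupportedOn.mul (P := fun μ => μ none ≤ Weight.size μ)
    (Q := fun μ => μ none < Weight.size μ) ?_ (SupportedOn.inv ?_ ?_ ?_ ?_) ?_
  · intro μ ν h1 h2
    rw [Finsupp.add_apply, map_add]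
    exact add_lt_add_of_le_of_lt h1 h2
  · intro μ ν h1 h2
    rw [Finsupp.add_apply, map_add]
    exact add_le_add h1 h2
  · simp
  · classical
    intro μ hμ
    rw [map_sub, coeff_one, coeff_marked, if_neg fun h => hμ (by rw [h]; simp), if_neg, sub_zero]
    intro h
    exact hμ (by omega)
  · rw [constantCoeff_one_sub_marked]; exact one_ne_zero
  · intro μ hμ
    rw [coeff_euler, coeff_marked, if_neg, mul_zero]
    intro h
    exact hμ (by omega)

theorem supportedOn_full : SupportedOn (fun μ => μ none = 0) (full⁻¹ * euler full) := by
  have hadd : ∀ μ ν : Weight, μ none = 0 → ν none = 0 → (μ + ν) none = 0 := by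
    intro μ ν h1 h2
    rw [Finsupp.add_apply, h1, h2]
  have hfull : SupportedOn (fun μ => μ none = 0) full := fun μ hμ => by
    rw [coeff_full, if_neg hμ]
  refine SupportedOn.mul hadd (SupportedOn.inv hadd rfl hfull ?_) fun μ hμ => ?_
  · rw [constantCoeff_full]; exact one_ne_zero
  · rw [coeff_euler, hfull μ hμ, mul_zero]

theorem supportedOn_fullBar :
    SupportedOn (fun μ => μ none = Weight.size μ) (fullBar⁻¹ * euler fullBar) := by
  have hadd : ∀ μ ν : Weight, μ none = Weight.size μ → ν none = Weight.size ν →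
      (μ + ν) none = Weight.size (μ + ν) := by
    intro μ ν h1 h2
    rw [Finsupp.add_apply, h1, h2, map_add]
  have hfull : SupportedOn (fun μ => μ none = Weight.size μ) fullBar := fun μ hμ => by
    rw [coeff_fullBar, if_neg hμ]
  refine SupportedOn.mul hadd (SupportedOn.inv hadd (map_zero _).symm hfull ?_) fun μ hμ => ?_
  · rw [constantCoeff_fullBar]; exact one_ne_zero
  · rw [coeff_euler, hfull μ hμ, mul_zero]

/-- With fewer bars than letters, the coefficient is that of the closed walks over the finite
support of the exponent, where the `fullBar` term vanishes. At all other exponents both sides are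
zero. -/
theorem closedWords_eq :
    closedWords = (1 - marked 0)⁻¹ * euler (marked 0) + full⁻¹ * euler full := by
  classical
  ext μ
  rw [coeff_closedWords, map_add]
  by_cases hlt : μ none < Weight.size μ
  · have h0 : Weight.size μ ≠ 0 := by omega
    have hμ0 : μ ≠ 0 := fun h => h0 (by rw [h, map_zero])
    have h := congrArg (coeff μ) (sum_cut_walks μ.some.support)
    rw [coeff_cut, if_pos subset_rfl, map_add, map_add,
      supportedOn_fullBar μ (ne_of_lt hlt), add_zero, map_sum] at h
    rw [if_neg h0, BWord.closedCount_eq_sum_walks subset_rfl h0 hlt, ← h]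
    refine Finset.sum_congr rfl fun i _ => ?_
    rw [map_sub, coeff_cut, if_pos subset_rfl, coeff_one, if_neg hμ0, sub_zero]
  · rw [supportedOn_marked μ hlt, zero_add]
    split_ifs with h0
    · by_cases h1 : μ none = 0
      · have : μ = 0 := by
          rw [← Finsupp.optionElim_some μ, h1, (Finsupp.degree_eq_zero_iff μ.some).1 h0,
            Finsupp.optionElim_zero, Finsupp.single_zero]
        rw [this, coeff_zero_eq_constantCoeff_apply, map_mul,
          ← coeff_zero_eq_constantCoeff_apply (euler full), coeff_euler, map_zero, Nat.cast_zero,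
          zero_mul, mul_zero]
      · rw [supportedOn_full μ h1]
    · have h1 : μ none ≠ 0 := by omega
      rw [supportedOn_full μ h1, closedCount]
      have : IsEmpty {w : BWord // BWord.shift^[Weight.size μ] w = w ∧
          orbitWeight BWord.shift BWord.weight (Weight.size μ) w = μ} := ⟨fun w => hlt (by
        have h2 := BWord.orbitWeight_none_lt h0 w.2.1
        rwa [w.2.2] at h2)⟩
      rw [Nat.card_of_isEmpty, Nat.cast_zero]

end Series

/-! ### The generating function of the Eulerian quasisymmetric functions, and geometric series in
marked multisets -/

namespace Series

/-- The generating function of invariant multisets of words. -/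
def invariants : Series := fun μ => invCount BWord.shift BWord.weight μ

theorem coeff_invariants (μ : Weight) :
    coeff μ invariants = invCount BWord.shift BWord.weight μ := rfl

theorem euler_invariants : euler invariants = closedWords * invariants := by
  ext μ
  rw [coeff_euler, coeff_invariants, coeff_mul, ← Nat.cast_mul,
    size_mul_invCount BWord.size_weight finite_invariant finite_closed, Nat.cast_sum]
  refine Finset.sum_congr rfl fun x _ => ?_
  rw [coeff_closedWords, coeff_invariants, Nat.cast_mul, Nat.cast_ite, Nat.cast_zero]

theorem one_sub_marked_mul_inv : (1 - marked 0) * (1 - marked 0)⁻¹ = 1 :=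
  MvPowerSeries.mul_inv_cancel _ (by rw [constantCoeff_one_sub_marked]; exact one_ne_zero)

theorem full_mul_inv : full * full⁻¹ = 1 :=
  MvPowerSeries.mul_inv_cancel _ (by rw [constantCoeff_full]; exact one_ne_zero)

theorem eq_zero_of_sum_weight {M : Multiset BWord} {μ : Weight} (hM : (M.map BWord.weight).sum = μ)
    (hμ : Weight.size μ = 0) : M = 0 :=
  Multiset.card_eq_zero.1 ((card_eq_size hM).trans hμ)

theorem constantCoeff_invariants : constantCoeff invariants = 1 := by
  rw [← coeff_zero_eq_constantCoeff_apply, coeff_invariants, invCount, Nat.cast_eq_one,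
    Nat.card_eq_one_iff_unique]
  exact ⟨⟨fun a b => Subtype.ext ((eq_zero_of_sum_weight a.2.2 (map_zero _)).trans
    (eq_zero_of_sum_weight b.2.2 (map_zero _)).symm)⟩, ⟨0, by simp, by simp⟩⟩

/-- The product formula for the generating function of invariant multisets. -/
theorem invariants_mul_one_sub_marked : invariants * (1 - marked 0) = full := by
  classical
  -- The Euler derivative of `U` vanishes because the logarithmic derivatives of its factors cancel,
  -- by `euler_invariants` and `closedWords_eq`.
  set U := invariants * (1 - marked 0) * full⁻¹ with hU
  have hinv : euler full⁻¹ = - (full⁻¹ * full⁻¹ * euler full) := by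
    have h1 := congrArg euler full_mul_inv
    rw [Derivation.leibniz, Derivation.map_one_eq_zero, smul_eq_mul, smul_eq_mul] at h1
    linear_combination full⁻¹ * h1 - euler full⁻¹ * full_mul_inv
  have hE : euler U = 0 := by
    rw [hU, Derivation.leibniz, Derivation.leibniz, map_sub, Derivation.map_one_eq_zero,
      euler_invariants, hinv, closedWords_eq]
    simp only [smul_eq_mul]
    linear_combination full⁻¹ * invariants * euler (marked 0) * one_sub_marked_mul_inv
  -- The Euler derivation also kills pure powers of the bar variable, so these are excluded by a
  -- support condition before concluding `U = 1`.
  let P : Weight → Prop := fun μ => Weight.size μ = 0 → μ none = 0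
  have hadd : ∀ μ ν, P μ → P ν → P (μ + ν) := by
    intro μ ν h1 h2 h
    rw [map_add] at h
    rw [Finsupp.add_apply, h1 (by omega), h2 (by omega)]
  have hP : SupportedOn P U := by
    refine SupportedOn.mul hadd (SupportedOn.mul hadd ?_ ?_)
      (SupportedOn.inv hadd (fun _ => rfl) ?_ ?_)
    · intro μ hμ
      rw [Classical.not_imp] at hμ
      rw [coeff_invariants, invCount, Nat.cast_eq_zero]
      have : IsEmpty {M : Multiset BWord // M.map BWord.shift = M ∧
          (M.map BWord.weight).sum = μ} := ⟨fun M => by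
        have h0 := eq_zero_of_sum_weight M.2.2 hμ.1
        have h1 := M.2.2
        rw [h0] at h1
        exact hμ.2 (by rw [← h1]; rfl)⟩
      exact Nat.card_of_isEmpty
    · intro μ hμ
      rw [Classical.not_imp] at hμ
      rw [map_sub, coeff_one, coeff_marked, if_neg fun h => hμ.2 (by rw [h]; rfl), if_neg (by omega),
        sub_zero]
    · intro μ hμ
      rw [Classical.not_imp] at hμ
      rw [coeff_full, if_neg hμ.2]
    · rw [constantCoeff_full]; exact one_ne_zero
  have hU1 : U = 1 := by
    ext μ
    rw [coeff_one]
    split_ifs with h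
    · rw [h, coeff_zero_eq_constantCoeff_apply, hU, map_mul, map_mul, constantCoeff_invariants,
        constantCoeff_one_sub_marked, constantCoeff_inv, constantCoeff_full]
      norm_num
    · by_cases h0 : Weight.size μ = 0
      · refine hP μ fun hc => h ?_
        rw [← Finsupp.optionElim_some μ, hc h0, (Finsupp.degree_eq_zero_iff μ.some).1 h0,
            Finsupp.optionElim_zero, Finsupp.single_zero]
      · have := congrArg (coeff μ) hE
        rw [coeff_euler, coeff_zero] at this
        exact (mul_eq_zero.1 this).resolve_left (Nat.cast_ne_zero.2 h0)
  calc invariants * (1 - marked 0) = U * full := by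
        rw [hU]; linear_combination - invariants * (1 - marked 0) * full_mul_inv
    _ = full := by rw [hU1, one_mul]

theorem one_sub_marked_inv_eq (n : ℕ) : (1 - marked 0)⁻¹ =
    ∑ i ∈ Finset.range n, marked 0 ^ i + marked 0 ^ n * (1 - marked 0)⁻¹ := by
  have h := geom_sum_mul_neg (marked 0) n
  linear_combination - (1 - marked 0)⁻¹ * h + (∑ i ∈ Finset.range n, marked 0 ^ i) *
    one_sub_marked_mul_inv

theorem supportedOn_pow (n : ℕ) : SupportedOn (fun μ => n ≤ Weight.size μ) (marked 0 ^ n) := by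
  induction n with
  | zero => exact fun μ hμ => absurd (Nat.zero_le _) hμ
  | succ n ih =>
    rw [pow_succ]
    refine SupportedOn.mul (Q := fun μ => 1 ≤ Weight.size μ) ?_ ih fun μ hμ => ?_
    · intro μ ν h1 h2
      rw [map_add]
      exact add_le_add h1 h2
    · rw [coeff_marked, if_neg (by omega)]

/-- Geometric series in marked multisets stop at the size of the exponent. -/
theorem coeff_inv_mul {f : Series} (hf : SupportedOn (fun μ => 1 ≤ Weight.size μ) f) (μ : Weight) :
    coeff μ ((1 - marked 0)⁻¹ * f) =
      ∑ i ∈ Finset.range (Weight.size μ), coeff μ (marked 0 ^ i * f) := by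
  rw [one_sub_marked_inv_eq (Weight.size μ), add_mul, map_add, Finset.sum_mul, map_sum, add_eq_left]
  refine SupportedOn.mul (P := fun ν => Weight.size μ ≤ Weight.size ν)
    (R := fun ν => Weight.size μ + 1 ≤ Weight.size ν) ?_
    (SupportedOn.mul (Q := fun _ => True) ?_ (supportedOn_pow _) fun ν hν => absurd trivial hν) hf μ
    (by omega)
  · intro ν ξ h1 h2
    rw [map_add]
    exact add_le_add h1 h2
  · intro ν ξ h1 _
    rw [map_add]
    exact h1.trans (Nat.le_add_right _ _)

theorem sum_Icc_one {M : Type} [AddCommMonoid M] (n : ℕ) (f : ℕ → M) :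
    ∑ r ∈ Finset.Icc 1 n, f r = ∑ i ∈ Finset.range n, f (i + 1) := by
  refine Finset.sum_nbij' (fun r => r - 1) (fun i => i + 1) ?_ ?_ ?_ ?_ ?_
  · intro r hr
    have := Finset.mem_Icc.1 hr
    exact Finset.mem_range.2 (by omega)
  · intro i hi
    have := Finset.mem_range.1 hi
    exact Finset.mem_Icc.2 (by omega)
  · intro r hr
    have := Finset.mem_Icc.1 hr
    change r - 1 + 1 = r
    omega
  · intro i _
    exact Nat.add_sub_cancel i 1
  · intro r hr
    have := Finset.mem_Icc.1 hr
    change f r = f (r - 1 + 1)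
    rw [Nat.sub_add_cancel this.1]

/-- The Euler derivative of `M^r` is `r M^(r-1)` times that of `M`, so the terms of the geometric
series are the `size μ / r` multiples of the coefficients of `M^r`. -/
theorem coeff_log_marked (μ : Weight) : coeff μ ((1 - marked 0)⁻¹ * euler (marked 0)) =
    ∑ r ∈ Finset.Icc 1 (Weight.size μ), (Weight.size μ / r : ℚ) * coeff μ (marked 0 ^ r) := by
  rw [coeff_inv_mul fun ν hν => by
    rw [coeff_euler, show Weight.size ν = 0 by omega, Nat.cast_zero, zero_mul]]
  rw [sum_Icc_one]
  refine Finset.sum_congr rfl fun i _ => ?_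
  have h := congrArg (coeff μ) (euler.leibniz_pow (marked 0) (i + 1))
  rw [coeff_euler, Nat.add_sub_cancel, map_nsmul, nsmul_eq_mul, smul_eq_mul] at h
  rw [div_mul_eq_mul_div, h, mul_div_cancel_left₀ _ (Nat.cast_ne_zero.2 (Nat.succ_ne_zero i))]

/-- Products of marked multisets as cyclic words. -/
theorem coeff_prod_marked {r : ℕ} [NeZero r] (m : ℕ+ →₀ ℕ) (j : ℕ) (ε : ZMod r → ℕ) :
    coeff (m.optionElim j) (∏ i, marked (ε i)) = Nat.card (MWord r m j ε) := by
  classical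
  rw [coeff_prod]
  have hterm : ∀ l : ZMod r →₀ Weight, ∏ i, coeff (l i) (marked (ε i)) =
      if ∀ i, 1 ≤ l i none ∧ l i none < Weight.size (l i) + ε i then 1 else 0 := by
    intro l
    simp only [coeff_marked]
    rw [Finset.prod_ite_zero]
    simp
  simp only [hterm]
  rw [← Finset.sum_filter, Finset.sum_const, nsmul_one, Nat.cast_inj, ← Fintype.card_coe,
    ← Nat.card_eq_fintype_card]
  have hmem : ∀ l : ZMod r →₀ Weight, l ∈ (Finset.finsuppAntidiag Finset.univ
      (m.optionElim j)).filter (fun l => ∀ i, 1 ≤ l i none ∧ l i none < Weight.size (l i) + ε i) ↔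
      (∑ i, (l i).some = m ∧ ∑ i, l i none = j) ∧
        ∀ i, 1 ≤ l i none ∧ l i none < Weight.size (l i) + ε i := by
    intro l
    rw [Finset.mem_filter, Finset.mem_finsuppAntidiag]
    refine and_congr_left fun _ => ?_
    rw [← optionElim_inj, ← sum_optionElim]
    simp only [Finsupp.optionElim_some]
    simp
  refine Nat.card_eq_of_bijective (fun l => ⟨fun i => (l.1 i).some, fun i => l.1 i none,
    fun i => (((hmem _).1 l.2).2 i).1, fun i => (((hmem _).1 l.2).2 i).2,
    ((hmem _).1 l.2).1.1, ((hmem _).1 l.2).1.2⟩) ⟨?_, ?_⟩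
  · intro l l' h
    have h1 := congrArg MWord.κ h
    have h2 := congrArg MWord.b h
    refine Subtype.ext (Finsupp.ext fun i => ?_)
    rw [← Finsupp.optionElim_some (l.1 i), ← Finsupp.optionElim_some (l'.1 i)]
    exact optionElim_inj.2 ⟨congrFun h1 i, congrFun h2 i⟩
  · intro u
    refine ⟨⟨Finsupp.equivFunOnFinite.symm fun i => (u.κ i).optionElim (u.b i), ?_⟩, ?_⟩
    · rw [hmem]
      simp only [Finsupp.equivFunOnFinite_symm_apply_apply, Finsupp.some_optionElim,
        Finsupp.optionElim_apply_none, Weight.size_optionElim]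
      exact ⟨⟨u.content, u.sum⟩, fun i => ⟨u.pos i, u.lt i⟩⟩
    · refine MWord.ext (funext fun i => ?_) (funext fun i => ?_)
      · simp
      · simp

end Series

/-! ### Primitive words compared with primitive sequences of marked multisets -/

section

/-- A multiset with a positive mark smaller than its size. -/
abbrev Marked : Type := {ν : Weight // 1 ≤ ν none ∧ ν none < Weight.size ν}

/-- Infinite sequences of marked multisets. -/
abbrev MarkedSeq : Type := ℕ → Marked

namespace MarkedSeq

/-- Removal of the first term. -/
def shift (f : MarkedSeq) : MarkedSeq := fun k => f (k + 1)

/-- The weight of the first term. -/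
def weight (f : MarkedSeq) : Weight := (f 0).1

theorem iterate_shift (f : MarkedSeq) (i k : ℕ) : (shift^[i] f) k = f (k + i) := by
  induction i generalizing f with
  | zero => rfl
  | succ i ih =>
    rw [Function.iterate_succ_apply, ih]
    exact congrArg f (by omega)

theorem orbitWeight_eq (f : MarkedSeq) (d : ℕ) :
    orbitWeight shift weight d f = ∑ i ∈ Finset.range d, (f i).1 := by
  refine Finset.sum_congr rfl fun i _ => ?_
  rw [weight, iterate_shift, zero_add]

variable {r : ℕ} [NeZero r] {m : ℕ+ →₀ ℕ} {j : ℕ}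

theorem sum_range_eq_sum_zmod {M : Type} [AddCommMonoid M] (g : ZMod r → M) :
    ∑ i ∈ Finset.range r, g i = ∑ i, g i := by
  refine Finset.sum_nbij' (fun i : ℕ => (i : ZMod r)) ZMod.val ?_ ?_ ?_ ?_ ?_
  · intro i _; exact Finset.mem_univ _
  · intro i _; exact Finset.mem_range.2 (ZMod.val_lt i)
  · intro i hi; exact ZMod.val_cast_of_lt (Finset.mem_range.1 hi)
  · intro i _; exact ZMod.natCast_zmod_val i
  · intro i _; rfl

/-- Cyclic words as periodic sequences. -/
def ofMWord (u : MWord r m j 0) : MarkedSeq := fun k =>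
  ⟨(u.κ k).optionElim (u.b k), by
    rw [Finsupp.optionElim_apply_none, Weight.size_optionElim]
    exact ⟨u.pos k, u.lt k⟩⟩

theorem ofMWord_injective : Function.Injective (ofMWord (r := r) (m := m) (j := j)) := by
  intro u v h
  have h1 : ∀ i : ZMod r, u.κ i = v.κ i ∧ u.b i = v.b i := fun i => by
    have := congrArg Subtype.val (congrFun h i.val)
    simp only [ofMWord, ZMod.natCast_zmod_val] at this
    exact optionElim_inj.1 this
  exact MWord.ext (funext fun i => (h1 i).1) (funext fun i => (h1 i).2)

theorem ofMWord_rotWord_iterate (u : MWord r m j 0) (k : ℕ) :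
    ofMWord (rotWord^[k] u) = shift^[k] (ofMWord u) := by
  funext i
  rw [iterate_shift]
  refine Subtype.ext ?_
  simp only [ofMWord, rotWord_iterate_κ, rotWord_iterate_b, Nat.cast_add]

theorem shift_iterate_ofMWord (u : MWord r m j 0) : shift^[r] (ofMWord u) = ofMWord u := by
  rw [← ofMWord_rotWord_iterate, rotWord_iterate_eq]

theorem orbitWeight_ofMWord (u : MWord r m j 0) :
    orbitWeight shift weight r (ofMWord u) = m.optionElim j := by
  rw [orbitWeight_eq]
  refine (sum_range_eq_sum_zmod fun i => (u.κ i).optionElim (u.b i)).trans ?_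
  rw [sum_optionElim, u.content, u.sum]

theorem exists_ofMWord_eq {f : MarkedSeq} (hf : shift^[r] f = f)
    (hw : orbitWeight shift weight r f = m.optionElim j) :
    ∃ u : MWord r m j 0, ofMWord u = f := by
  have hper : Function.Periodic f r := fun k =>
    (iterate_shift f r k).symm.trans (congrFun hf k)
  have hval : ∀ k : ℕ, f (k : ZMod r).val = f k := fun k => by
    rw [ZMod.val_natCast]
    exact hper.map_mod_nat k
  rw [orbitWeight_eq] at hw
  have hsum : ∑ i : ZMod r, (f i.val).1 = m.optionElim j := by
    rw [← hw, ← sum_range_eq_sum_zmod]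
    simp only [hval]
  have h2 : (∑ i : ZMod r, (f i.val).1.some) = m ∧ (∑ i : ZMod r, (f i.val).1 none) = j := by
    rw [← optionElim_inj, ← sum_optionElim]
    simpa only [Finsupp.optionElim_some] using hsum
  refine ⟨⟨fun i => (f i.val).1.some, fun i => (f i.val).1 none, fun i => (f i.val).2.1,
    fun i => (f i.val).2.2, h2.1, h2.2⟩, funext fun k => Subtype.ext ?_⟩
  simp only [ofMWord, Finsupp.optionElim_some, hval]

theorem minimalPeriod_ofMWord (u : MWord r m j 0) :
    Function.minimalPeriod shift (ofMWord u) = Function.minimalPeriod rotWord u := by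
  have h : ∀ k, Function.IsPeriodicPt shift k (ofMWord u) ↔ Function.IsPeriodicPt rotWord k u := by
    intro k
    rw [Function.IsPeriodicPt, Function.IsPeriodicPt, Function.IsFixedPt, Function.IsFixedPt,
      ← ofMWord_rotWord_iterate, ofMWord_injective.eq_iff]
  refine Nat.dvd_antisymm ?_ ?_
  · exact Function.IsPeriodicPt.minimalPeriod_dvd ((h _).2 (Function.isPeriodicPt_minimalPeriod _ _))
  · exact Function.IsPeriodicPt.minimalPeriod_dvd ((h _).1 (Function.isPeriodicPt_minimalPeriod _ _))

/-- Closed orbits of sequences as cyclic words. -/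
def closedEquiv : MWord r m j 0 ≃
    {f : MarkedSeq // shift^[r] f = f ∧ orbitWeight shift weight r f = m.optionElim j} :=
  Equiv.ofBijective (fun u => ⟨ofMWord u, shift_iterate_ofMWord u, orbitWeight_ofMWord u⟩)
    ⟨fun u v h => ofMWord_injective (congrArg Subtype.val h), fun f => by
      obtain ⟨u, hu⟩ := exists_ofMWord_eq f.2.1 f.2.2
      exact ⟨u, Subtype.ext hu⟩⟩

theorem primCount_eq : primCount shift weight r (m.optionElim j) =
    Nat.card {u : MWord r m j 0 // Function.minimalPeriod rotWord u = r} := by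
  symm
  refine Nat.card_eq_of_bijective (fun u => ⟨ofMWord u.1, (minimalPeriod_ofMWord u.1).trans u.2,
    orbitWeight_ofMWord u.1⟩) ⟨fun u v h => ?_, fun f => ?_⟩
  · exact Subtype.ext (ofMWord_injective (congrArg Subtype.val h))
  · have hper : shift^[r] f.1 = f.1 := by
      have := Function.iterate_minimalPeriod (f := shift) (x := f.1)
      rwa [f.2.1] at this
    obtain ⟨u, hu⟩ := exists_ofMWord_eq hper f.2.2
    refine ⟨⟨u, ?_⟩, Subtype.ext hu⟩
    rw [← minimalPeriod_ofMWord, hu, f.2.1]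

theorem finite_closed (d : ℕ) (μ : Weight) : Finite {f : MarkedSeq // shift^[d + 1] f = f ∧
    orbitWeight shift weight (d + 1) f = μ} := by
  rw [← Finsupp.optionElim_some μ]
  exact Finite.of_equiv _ closedEquiv

theorem closedCount_eq (μ : Weight) (r : ℕ) (hr : r ≠ 0) :
    (closedCount shift weight r μ : ℚ) = coeff μ (Series.marked 0 ^ r) := by
  have : NeZero r := ⟨hr⟩
  rw [← Finsupp.optionElim_some μ, closedCount, ← Nat.card_congr closedEquiv,
    ← Series.coeff_prod_marked]
  simp [ZMod.card]

end MarkedSeq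

/-- The condition of having some bars, but fewer than letters, is inherited by divisors of the
exponent, and it removes the `full` term from the closed-word formula. The comparison of closed
orbits then passes to primitive ones. -/
theorem primCount_words_eq_sum {μ : Weight} (h0 : 0 < μ none) (hlt : μ none < Weight.size μ) :
    (primCount BWord.shift BWord.weight (Weight.size μ) μ : ℚ) =
      ∑ r ∈ Finset.Icc 1 (Weight.size μ),
        (Weight.size μ / r : ℚ) * primCount MarkedSeq.shift MarkedSeq.weight r μ := by
  refine primCount_eq_sum_of_closedCount_eq_sum (fun μ => 0 < μ none ∧ μ none < Weight.size μ)
    ?_ (fun μ hμ => by omega) finite_closed MarkedSeq.finite_closed ?_ μ ⟨h0, hlt⟩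
  · intro k μ hμ
    rw [map_nsmul, Finsupp.smul_apply, smul_eq_mul, smul_eq_mul] at hμ
    exact ⟨Nat.pos_of_mul_pos_left hμ.1, lt_of_mul_lt_mul_left hμ.2 (Nat.zero_le k)⟩
  · intro μ hμ
    have h := congrArg (coeff μ) Series.closedWords_eq
    rw [Series.coeff_closedWords, if_neg (by omega), map_add, Series.coeff_log_marked,
      Series.supportedOn_full μ (by omega), add_zero] at h
    rw [h]
    refine Finset.sum_congr rfl fun r hr => ?_
    rw [MarkedSeq.closedCount_eq μ r (by have := (Finset.mem_Icc.1 hr).1; omega)]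

/-- Without bars a word weakly decreases under every shift. Being periodic, it is fixed by the
shift, so its minimal period is one. -/
theorem primCount_words_eq_zero {μ : Weight} (h0 : μ none = 0) (h2 : 2 ≤ Weight.size μ) :
    primCount BWord.shift BWord.weight (Weight.size μ) μ = 0 := by
  have : IsEmpty {w : BWord // Function.minimalPeriod BWord.shift w = Weight.size μ ∧
      orbitWeight BWord.shift BWord.weight (Weight.size μ) w = μ} := by
    refine ⟨fun w => ?_⟩
    obtain ⟨w, hw, hμ⟩ := w
    set d := Weight.size μ
    have hper : BWord.shift^[d] w = w := by
      have := Function.iterate_minimalPeriod (f := BWord.shift) (x := w)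
      rwa [hw] at this
    have hplain : ∀ k, (w.get k).plain = true := by
      intro k
      rw [← BWord.get_mod hper]
      have h1 := DFunLike.congr_fun hμ none
      rw [h0, BWord.orbitWeight_eq, Finsupp.finsetSum_apply, Finset.sum_eq_zero_iff] at h1
      have h3 := h1 _ (Finset.mem_range.2 (Nat.mod_lt k (by omega)))
      rw [Letter.weight_none] at h3
      by_contra hc
      rw [if_neg hc] at h3
      exact one_ne_zero h3
    have hle : ∀ k, BWord.shift^[k + 1] w ≤ BWord.shift^[k] w := by
      intro k
      rw [Function.iterate_succ_apply']
      refine BWord.shift_le ?_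
      rw [BWord.get_iterate_shift]
      exact hplain _
    have hanti : Antitone fun k => BWord.shift^[k] w := antitone_nat_of_succ_le hle
    have heq : BWord.shift w = w := by
      refine le_antisymm (hle 0) ?_
      have := hanti (show 1 ≤ d by omega)
      simp only [hper, Function.iterate_one] at this
      exact this
    have := Function.IsPeriodicPt.minimalPeriod_dvd (show Function.IsPeriodicPt BWord.shift 1 w from heq)
    rw [hw, Nat.dvd_one] at this
    omega
  exact Nat.card_of_isEmpty

/-- Primitive circular words and primitive cyclic sequences of marked multisets. -/
theorem primCount_words {n j : ℕ} (hn : 2 ≤ n) (hj : j ≤ n - 1) {m : ℕ+ →₀ ℕ} (hm : m.degree = n) :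
    (primCount BWord.shift BWord.weight n (m.optionElim j) : ℚ) =
      n * ∑ k ∈ Finset.range n, ((k + 1 : ℕ) : ℚ)⁻¹ *
        Nat.card {u : MWord (k + 1) m j 0 // Function.minimalPeriod rotWord u = k + 1} := by
  have hs : Weight.size (m.optionElim j) = n := (Weight.size_optionElim m j).trans hm
  have hnone : (m.optionElim j) none = j := Finsupp.optionElim_apply_none _ _
  -- For `j = 0` both sides vanish: there are no primitive words without bars of length at least
  -- two, and marks are positive.
  rcases Nat.eq_zero_or_pos j with rfl | hj0
  · have h := primCount_words_eq_zero hnone (by rw [hs]; exact hn)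
    rw [hs] at h
    rw [h, Nat.cast_zero, Finset.sum_eq_zero, mul_zero]
    intro k _
    have : IsEmpty {u : MWord (k + 1) m 0 0 // Function.minimalPeriod rotWord u = k + 1} :=
      ⟨fun u => by
        have h1 := u.1.sum
        rw [Finset.sum_eq_zero_iff] at h1
        have h2 := u.1.pos 0
        rw [h1 0 (Finset.mem_univ _)] at h2
        omega⟩
    rw [Nat.card_of_isEmpty, Nat.cast_zero, mul_zero]
  · have h := primCount_words_eq_sum (μ := m.optionElim j) (by rw [hnone]; exact hj0)
      (by rw [hnone, hs]; omega)
    rw [hs, Series.sum_Icc_one] at h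
    rw [h, Finset.mul_sum]
    refine Finset.sum_congr rfl fun k _ => ?_
    rw [MarkedSeq.primCount_eq, div_eq_mul_inv, mul_assoc]

/-- The coefficients of the cycle type Eulerian quasisymmetric functions of the one-part
partition. -/
theorem coeff_cycleTypeEulerianQ {n j : ℕ} (hn : 2 ≤ n) (hj : j ≤ n - 1) {m : ℕ+ →₀ ℕ}
    (hm : m.degree = n) :
    coeff m (cycleTypeEulerianQ (Nat.Partition.indiscrete n) j) =
      ∑ k ∈ Finset.range n, ((k + 1 : ℕ) : ℚ)⁻¹ *
        Nat.card {u : MWord (k + 1) m j 0 // Function.minimalPeriod rotWord u = k + 1} := by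
  have hn0 : (n : ℚ) ≠ 0 := Nat.cast_ne_zero.2 (by omega)
  apply mul_left_cancel₀ hn0
  rw [mul_coeff_cycleTypeEulerianQ hn hm, primCount_words hn hj hm]

/-- The coefficients of the Eulerian quasisymmetric functions. -/
theorem coeff_eulerianQ_eq_sum {n j : ℕ} (hn : n ≠ 0) {m : ℕ+ →₀ ℕ} (hm : m.degree = n) :
    coeff m (eulerianQ n ((j : ℤ) - 1)) =
      ∑ k ∈ Finset.range (n + 1), (Nat.card (MWord (k + 1) m j (Pi.single 0 1)) : ℚ) := by
  classical
  have hterm : ∀ k, (Nat.card (MWord (k + 1) m j (Pi.single 0 1)) : ℚ) =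
      coeff (m.optionElim j) (Series.marked 0 ^ k * Series.marked 1) := by
    intro k
    rw [← Series.coeff_prod_marked, ← Finset.mul_prod_erase _ _ (Finset.mem_univ (0 : ZMod (k + 1))),
      Pi.single_eq_same, Finset.prod_congr rfl (g := fun _ => Series.marked 0), Finset.prod_const,
      Finset.card_erase_of_mem (Finset.mem_univ _), Finset.card_univ, ZMod.card, Nat.add_sub_cancel,
      mul_comm]
    intro i hi
    rw [Pi.single_eq_of_ne (Finset.ne_of_mem_erase hi)]
  have hs : Weight.size (m.optionElim j) = n := (Weight.size_optionElim m j).trans hm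
  have hsupp : Series.SupportedOn (fun ν => 1 ≤ Weight.size ν) (Series.marked 1) := fun ν hν => by
    rw [Series.coeff_marked, if_neg (by omega)]
  have h := Series.coeff_inv_mul hsupp (m.optionElim j)
  -- The last summand `k = n` is superfluous, since `n + 1` nonempty multisets have total size above
  -- `n`.
  have hzero : coeff (m.optionElim j) (Series.marked 0 ^ n * Series.marked 1) = 0 := by
    refine Series.SupportedOn.mul (R := fun ν => n + 1 ≤ Weight.size ν) (fun μ ν h1 h2 => ?_)
      (Series.supportedOn_pow n) hsupp _ (by omega)
    rw [map_add]
    exact add_le_add h1 h2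
  -- With `M₁ = t H - t (1 - M)` and `H = invariants * (1 - M)`, division by `1 - M` gives `t
  -- (invariants - 1)`. The factor `t` is the shift from `j` to `j - 1`.
  have hmul : (1 - Series.marked 0)⁻¹ * Series.marked 1 = X none * (Series.invariants - 1) := by
    rw [Series.marked_one, ← Series.invariants_mul_one_sub_marked]
    linear_combination X none * (Series.invariants - 1) * Series.one_sub_marked_mul_inv
  rw [hmul, hs] at h
  simp only [hterm]
  rw [Finset.sum_range_succ, hzero, add_zero, ← h]
  rcases j with _ | j
  · rw [Series.coeff_X_none_mul_zero, eulerianQ, Finset.sum_eq_zero, coeff_zero]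
    intro σ _
    refine if_neg fun hc => ?_
    have := Int.natCast_nonneg (exc σ)
    rw [Nat.cast_zero, zero_sub] at hc
    omega
  · rw [Series.coeff_X_none_mul_succ, map_sub, Series.coeff_one_optionElim, if_neg (by omega),
      sub_zero, Series.coeff_invariants, Nat.cast_succ, add_sub_cancel_right, coeff_eulerianQ hm]

theorem coeff_eulerianQ_of_degree_ne {n : ℕ} {j : ℤ} {m : ℕ+ →₀ ℕ} (hm : m.degree ≠ n) :
    coeff m (eulerianQ n j) = 0 := by
  classical
  have h := coeff_sum_fundamental (fun σ : Equiv.Perm (Fin n) => (exc σ : ℤ) = j) m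
  rw [coeff_sum_fundamental_of_degree_ne hm, Nat.cast_zero] at h
  rw [← h, eulerianQ]
  congr!

theorem coeff_cycleTypeEulerianQ_of_degree_ne {n : ℕ} {lam : n.Partition} {j : ℤ} {m : ℕ+ →₀ ℕ}
    (hm : m.degree ≠ n) : coeff m (cycleTypeEulerianQ lam j) = 0 := by
  classical
  have h := coeff_sum_fundamental (fun σ : Equiv.Perm (Fin n) =>
    (exc σ : ℤ) = j ∧ HasCycleType σ lam) m
  rw [coeff_sum_fundamental_of_degree_ne hm, Nat.cast_zero] at h
  rw [← h, cycleTypeEulerianQ]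
  congr!

end

/-! ### Assembly of the representation from its isotypic pieces -/

theorem coeff_frobeniusChar_sum {ι : Type} {n : ℕ} (s : Finset ι)
    (V : ι → VirtualRep (Equiv.Perm (Fin n))) (m : ℕ+ →₀ ℕ) :
    coeff m (frobeniusChar (∑ i ∈ s, V i)) = ∑ i ∈ s, coeff m (frobeniusChar (V i)) := by
  simp only [coeff_frobeniusChar, map_sum, Finset.sum_apply]
  rw [← Finset.mul_sum, Finset.sum_comm]
  simp only [Finset.sum_mul]

theorem permutation_sigma {G ι : Type} [Group G] [Finite G] [Fintype ι] (X : ι → Type)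
    [∀ i, Finite (X i)] [∀ i, MulAction G (X i)] :
    VirtualRep.permutation G (Σ i, X i) = ∑ i, VirtualRep.permutation G (X i) := by
  apply VirtualRep.character_injective
  funext g
  rw [map_sum, Finset.sum_apply, VirtualRep.character_permutation]
  simp only [VirtualRep.character_permutation]
  rw [← Nat.cast_sum, ← Nat.card_sigma, Nat.cast_inj]
  have h : ∀ x : Σ i, X i, g • x = x ↔ g • x.2 = x.2 := by
    rintro ⟨i, x⟩
    rw [Sigma.smul_mk, Sigma.mk.injEq, heq_eq_eq, and_iff_right rfl]
  exact Nat.card_congr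
    { toFun := fun x => ⟨x.1.1, x.1.2, (h _).1 x.2⟩
      invFun := fun x => ⟨⟨x.1, x.2.1⟩, (h _).2 x.2.2⟩
      left_inv := fun _ => rfl
      right_inv := fun _ => rfl }

theorem hasFrobeniusChar_of_coeff_eq {n : ℕ} {V : VirtualRep (Equiv.Perm (Fin n))}
    {f : MvPowerSeries ℕ+ ℚ} (h : ∀ m : ℕ+ →₀ ℕ, m.degree = n →
      coeff m (frobeniusChar V) = ((coeff m f : ℚ) : ℂ)) (h' : ∀ m : ℕ+ →₀ ℕ, m.degree ≠ n → coeff m f = 0) :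
    HasFrobeniusChar V f := by
  rw [HasFrobeniusChar]
  ext m
  rw [coeff_map]
  by_cases hm : m.degree = n
  · rw [h m hm]; rfl
  · rw [coeff_frobeniusChar_eq_zero V hm, h' m hm, map_zero]

/-- The representations for the one-part partition and their restrictions. -/
theorem exists_virtualRep {n j : ℕ} (hn : n ≠ 0) (hj : j ≤ n) :
    ∃ V : VirtualRep (Equiv.Perm (Fin (n + 1))),
      HasFrobeniusChar V (cycleTypeEulerianQ (Nat.Partition.indiscrete (n + 1)) j) ∧
      ∃ (X : Type) (_ : Finite X) (_ : MulAction (Equiv.Perm (Fin n)) X),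
        VirtualRep.res (permEmbedding (n + 1)) V =
          VirtualRep.permutation (Equiv.Perm (Fin n)) X ∧
        HasFrobeniusChar (VirtualRep.permutation (Equiv.Perm (Fin n)) X)
          (eulerianQ n ((j : ℤ) - 1)) := by
  -- `W k` belongs to `k + 1` blocks. Taking `k ≤ n` suffices, since `n + 1` points cannot fill more
  -- than `n + 1` nonempty blocks.
  choose W hW hW' using fun k : ℕ => exists_isotypic n (k + 1) j
  refine ⟨∑ k : Fin (n + 1), W k, hasFrobeniusChar_of_coeff_eq (fun m hm => ?_)
    (fun m hm => coeff_cycleTypeEulerianQ_of_degree_ne hm),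
    Σ k : Fin (n + 1), Conf n (k + 1) j (Pi.single 0 1), inferInstance, inferInstance, ?_,
    hasFrobeniusChar_of_coeff_eq (fun m hm => ?_) (fun m hm => coeff_eulerianQ_of_degree_ne hm)⟩
  · rw [coeff_frobeniusChar_sum, coeff_cycleTypeEulerianQ (n := n + 1) (j := j) (by omega) (show j ≤ n + 1 - 1 from hj) hm,
      Fin.sum_univ_eq_sum_range (fun k => coeff m (frobeniusChar (W k)))]
    push_cast
    refine Finset.sum_congr rfl fun k _ => ?_
    rw [hW k m hm]
    push_cast
    rfl
  · apply VirtualRep.character_injective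
    funext σ
    rw [VirtualRep.character_res, permutation_sigma, map_sum, map_sum, Finset.sum_apply,
      Finset.sum_apply]
    refine Finset.sum_congr rfl fun k _ => ?_
    exact (hW' k σ).trans (VirtualRep.character_permutation (G := Equiv.Perm (Fin n))
      (Conf n (k + 1) j (Pi.single 0 1)) σ).symm
  · rw [permutation_sigma, coeff_frobeniusChar_sum, coeff_eulerianQ_eq_sum hn hm]
    push_cast
    rw [← Fin.sum_univ_eq_sum_range (fun k => (Nat.card (MWord (k + 1) m j (Pi.single 0 1)) : ℂ))]
    exact Finset.sum_congr rfl fun k _ => coeff_frobeniusChar_permutation hm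

end EulerianQuasisymmetric

end

open EulerianQuasisymmetric in
theorem mainTheorem10 (n : ℕ) (hn : 2 ≤ n) (j : ℕ) (hj : j ≤ n - 1) :
    (∃! V : VirtualRep (Equiv.Perm (Fin n)),
      HasFrobeniusChar V (cycleTypeEulerianQ (Nat.Partition.indiscrete n) j)) ∧
    ∀ V : VirtualRep (Equiv.Perm (Fin n)),
      HasFrobeniusChar V (cycleTypeEulerianQ (Nat.Partition.indiscrete n) j) →
      ∃ (X : Type) (_ : Finite X) (_ : MulAction (Equiv.Perm (Fin (n - 1))) X),
        VirtualRep.res (permEmbedding n) V =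
          VirtualRep.permutation (Equiv.Perm (Fin (n - 1))) X ∧
        HasFrobeniusChar (VirtualRep.permutation (Equiv.Perm (Fin (n - 1))) X)
          (eulerianQ (n - 1) ((j : ℤ) - 1)) := by
  obtain ⟨k, rfl⟩ := Nat.exists_eq_succ_of_ne_zero (show n ≠ 0 by omega)
  obtain ⟨V, hV, hX⟩ := exists_virtualRep (n := k) (j := j) (by omega) hj
  have huniq : ∀ W : VirtualRep (Equiv.Perm (Fin (k + 1))),
      HasFrobeniusChar W (cycleTypeEulerianQ (Nat.Partition.indiscrete (k + 1)) j) → W = V :=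
    fun W hW => frobeniusChar_injective (hW.trans hV.symm)
  exact ⟨⟨V, hV, huniq⟩, fun W hW => huniq W hW ▸ hX⟩
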